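/- Let $n\ge 0$ be an integer, let $V$ be a two-dimensional real vector space, and let $E$ be a real vector space of dimension $n+3$ with a quadratic form $\mathbf q$ of signature $(2,n+1)$ and associated bilinear form $\langle\cdot,\cdot\rangle$. Write $\partial_\infty\mathbf H^{2,n}=\{x\in\mathbf P(E):\mathbf q(x)=0\}$ for the Einstein universe. *Positivity.* In $\mathbf P(V)$ a positive triple is a triple of pairwise distinct points, and a positive quadruple $(a,b,c,d)$ is a quadruple of pairwise distinct points such that $b$ and $d$ lie in different connected components of $\mathbf P(V)\setminus\{a,c\}$. In $\partial_\infty\mathbf H^{2,n}$ a triple $(a,b,c)$ of pairwise distinct points is positive if $a\oplus b\oplus c$ has signature $(2,1)$; a quadruple $(a,b,c,d)$ is positive if all its sub-triples are positive and $b$ and $d$ lie in different connected components of the set of those $x$ for which $(a,c,x)$ is a positive triple. A map from a subset of $\mathbf P(V)$ to $\partial_\infty\mathbf H^{2,n}$ is positive if it sends positive quadruples to positive quadruples. *Cross-ratios.* With $\omega$ a nonzero area form on $V$ and $x_0,y_0,z_0,t_0$ nonzero vectors in $x,y,z,t$, put $$[x,y,z,t]=\frac{\omega(x_0,y_0)\,\omega(z_0,t_0)}{\omega(x_0,t_0)\,\omega(z_0,y_0)},\qquad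 \mathrm b(x,y,z,t)=\frac{\langle x_0,y_0\rangle\langle z_0,t_0\rangle}{\langle x_0,t_0\rangle\langle z_0,y_0\rangle}$$ for points of $\mathbf P(V)$ and of $\partial_\infty\mathbf H^{2,n}$ respectively. For $A,B>1$ and $\Omega\subset\mathbf P(V)$ dense, a map $\xi:\Omega\to\partial_\infty\mathbf H^{2,n}$ is $(A,B)$-quasisymmetric if it is positive and, for all pairwise distinct $x,y,z,t\in\Omega$, $A^{-1}\le|[x,y,z,t]|\le A$ implies $B^{-1}\le|\mathrm b(\xi(x),\xi(y),\xi(z),\xi(t))|\le B$. *Visual distances.* Let $\tau=(a,b,c)$ be a positive triple in $\partial_\infty\mathbf H^{2,n}$. The barycenter of the ideal hyperbolic triangle with vertices $a,b,c$ is a negative line in $a\oplus b\oplus c$; let $U$ be its orthogonal in $a\oplus b\oplus c$, a positive definite plane. Every isotropic ray of $E$ contains a unique vector $u+v$ with $u\in U$, $v\in U^\perp$, $\mathbf q(u)=1=-\mathbf q(v)$; this identifies the space of isotropic rays with $\mathbb S^1\times\mathbb S^n$. The visual distance $d_\tau$ on $\partial_\infty\mathbf H^{2,n}$ is the distance induced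 on the quotient by $-1$ by the product of the round metrics of curvature $1$. For a positive triple $\tau=(a,b,c)$ in $\mathbf P(V)$, the visual distance $d_\tau$ on $\mathbf P(V)$ is likewise the angular distance (total length $2\pi$) on the circle at infinity $\mathbf P(V)=\partial_\infty\mathbf H^2$ seen from the barycenter of the ideal triangle with vertices $a,b,c$; that is, $d_\tau(x,y)$ is twice the angle between the lines $x$ and $y$ for the scalar product on $V$ (unique up to scale) for which the lines $a,b,c$ make pairwise angles $\pi/3$. **Theorem (Hölder modulus of continuity).** For all constants $A,B>1$ there exist constants $M>0$ and $\alpha>0$ with the following property. Let $\xi$ be an $(A,B)$-quasisymmetric map from a dense subset $\Omega$ of $\mathbf P(V)$ to $\partial_\infty\mathbf H^{2,n}$. Then $\xi$ has an extension to a continuous map $\xi:\mathbf P(V)\to\partial_\infty\mathbf H^{2,n}$ such that for every positive triple $\tau_0$ in $\mathbf P(V)$ the triple $\xi(\tau_0)$ is positive and $$d_{\xi(\tau_0)}(\xi(x),\xi(y))\le M\, d_{\tau_0}(x,y)^\alpha\qquad\text{for all }x,y\in\mathbf P(V).$$ This extension is unique: it is the only continuous extension of $\xi$ to $\mathbf P(V)$,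 and also the only extension with the displayed property for all positive triples. -/

import Mathlib

open scoped LinearAlgebra.Projectivization

noncomputable section

namespace QSEinstein

/-- The usual topology of the projective space of a real topological vector space: the quotient
topology of the complement of the origin. -/
instance projectiveTopology {M : Type*} [AddCommGroup M] [Module ℝ M] [TopologicalSpace M] :
    TopologicalSpace (ℙ ℝ M) :=
  TopologicalSpace.coinduced (Projectivization.mk' ℝ : {v : M // v ≠ 0} → ℙ ℝ M) inferInstance

section ProjectiveLine

variable {V : Type*} [AddCommGroup V] [Module ℝ V]

/-- The cross-ratio `[x,y,z,t]` on the projective line `P(V)`, computed with a volume form `ω`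
of the plane `V` (its value does not depend on the nonzero form `ω`). -/
def crossRatio (ω : V [⋀^Fin 2]→ₗ[ℝ] ℝ) (x y z t : ℙ ℝ V) : ℝ :=
  (ω ![x.rep, y.rep] * ω ![z.rep, t.rep]) / (ω ![x.rep, t.rep] * ω ![z.rep, y.rep])

/-- Positive triples of the projective line: triples of pairwise distinct points. -/
def IsPositiveTripleLine (a b c : ℙ ℝ V) : Prop :=
  a ≠ b ∧ b ≠ c ∧ a ≠ c

/-- Positive quadruples of the projective line: the four points are pairwise distinct, and `b`
and `d` lie in different connected components of `P(V) ∖ {a, c}`. -/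
def IsPositiveQuadrupleLine [TopologicalSpace V] (a b c d : ℙ ℝ V) : Prop :=
  [a, b, c, d].Pairwise (· ≠ ·) ∧
    connectedComponentIn ({a, c}ᶜ : Set (ℙ ℝ V)) b ≠
      connectedComponentIn ({a, c}ᶜ : Set (ℙ ℝ V)) d

/-- A point of the hyperbolic plane bounded by `P(V)` is a scalar product on `V` up to scale. This
is the scalar product which represents the barycenter of the ideal triangle with vertices
`a`, `b`, `c`: up to scale, it is the only one for which the three lines `a`, `b`, `c` make
pairwise angles `π / 3`. -/
def barycenterForm (ω : V [⋀^Fin 2]→ₗ[ℝ] ℝ) (a b c : ℙ ℝ V) (v w : V) : ℝ :=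
  ω ![b.rep, c.rep] ^ 2 * (ω ![a.rep, v] * ω ![a.rep, w]) +
  ω ![c.rep, a.rep] ^ 2 * (ω ![b.rep, v] * ω ![b.rep, w]) +
  ω ![a.rep, b.rep] ^ 2 * (ω ![c.rep, v] * ω ![c.rep, w])

/-- The visual distance on `P(V)` attached to the positive triple `(a,b,c)`: the visual distance
of the circle at infinity seen from the barycenter of the ideal triangle `a`, `b`, `c` of the
hyperbolic plane. The circle at infinity is seen with total length `2π`, so this is twice the
angle between the lines `x` and `y` for the scalar product `barycenterForm`. -/
def visualDistLine (ω : V [⋀^Fin 2]→ₗ[ℝ] ℝ) (a b c x y : ℙ ℝ V) : ℝ :=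
  2 * Real.arccos (|barycenterForm ω a b c x.rep y.rep| /
    Real.sqrt (barycenterForm ω a b c x.rep x.rep * barycenterForm ω a b c y.rep y.rep))

end ProjectiveLine

section Einstein

variable {E : Type*} [AddCommGroup E] [Module ℝ E]

/-- `Q` is nondegenerate of signature `(p, q)`: `p` positive and `q` negative squares. -/
def HasSignature (Q : QuadraticForm ℝ E) (p q : ℕ) : Prop :=
  Module.finrank ℝ E = p + q ∧ sigPos Q = p ∧ sigNeg Q = q

/-- The symmetric bilinear form `⟨x, y⟩` with `⟨x, x⟩ = Q x`. -/
def bil (Q : QuadraticForm ℝ E) : LinearMap.BilinForm ℝ E :=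
  QuadraticMap.associated (R := ℝ) Q

/-- The quadric of isotropic lines of `Q`. It is the Einstein universe of signature `(1, n)` when
`Q` has signature `(2, n + 1)`. -/
abbrev EinsteinUniverse (Q : QuadraticForm ℝ E) : Type _ :=
  {x : ℙ ℝ E // Q x.rep = 0}

/-- The pairing `⟨x₀, y₀⟩` of representatives of two points. -/
def pairing (Q : QuadraticForm ℝ E) (x y : EinsteinUniverse Q) : ℝ :=
  bil Q x.1.rep y.1.rep

/-- The cross-ratio of four pairwise transverse points of the Einstein universe. -/
def crossRatioEin (Q : QuadraticForm ℝ E) (x y z t : EinsteinUniverse Q) : ℝ :=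
  (pairing Q x y * pairing Q z t) / (pairing Q x t * pairing Q z y)

/-- The space `a ⊕ b ⊕ c` spanned by three points. -/
def tripleSpan (Q : QuadraticForm ℝ E) (a b c : EinsteinUniverse Q) : Submodule ℝ E :=
  a.1.submodule ⊔ b.1.submodule ⊔ c.1.submodule

/-- Positive triples: pairwise distinct points spanning a linear space of signature `(2, 1)`. -/
def IsPositiveTriple (Q : QuadraticForm ℝ E) (a b c : EinsteinUniverse Q) : Prop :=
  a ≠ b ∧ b ≠ c ∧ a ≠ c ∧ HasSignature (Q.restrict (tripleSpan Q a b c)) 2 1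

/-- The diamond defined by `a` and `c` which contains `b`: the connected component of `b` in the
set of all points `x` such that `(a, c, x)` is a positive triple. -/
def diamond (Q : QuadraticForm ℝ E) [TopologicalSpace E] (a c b : EinsteinUniverse Q) :
    Set (EinsteinUniverse Q) :=
  connectedComponentIn {x | IsPositiveTriple Q a c x} b

/-- Positive quadruples `(a,b,c,d)`: all sub-triples are positive, and `b` and `d` lie in different
diamonds defined by `a` and `c` (of which there are exactly two). -/
def IsPositiveQuadruple (Q : QuadraticForm ℝ E) [TopologicalSpace E]
    (a b c d : EinsteinUniverse Q) : Prop :=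
  IsPositiveTriple Q a b c ∧ IsPositiveTriple Q a b d ∧ IsPositiveTriple Q a c d ∧
    IsPositiveTriple Q b c d ∧ diamond Q a c b ≠ diamond Q a c d

/-- A vector spanning the barycenter of the ideal hyperbolic triangle with vertices `a`, `b`, `c`.
The formula does not depend on the representatives up to a factor; with representatives whose
pairwise products are equal, it gives a multiple of their sum. -/
def barycenter (Q : QuadraticForm ℝ E) (a b c : EinsteinUniverse Q) : E :=
  pairing Q b c • a.1.rep + pairing Q c a • b.1.rep + pairing Q a b • c.1.rep

/-- The positive definite plane attached to a positive triple: the orthogonal of the barycenter in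
the space spanned by the triple. -/
def barycentricPlane (Q : QuadraticForm ℝ E) (a b c : EinsteinUniverse Q) : Submodule ℝ E :=
  tripleSpan Q a b c ⊓ LinearMap.ker (bil Q (barycenter Q a b c))

/-- The visual distance attached to a positive definite plane `U`. The double cover of the Einstein
universe (isotropic rays) is the product of the unit circle of `U` and of the unit sphere of the
orthogonal of `U` (for `-Q`), with the product Riemannian metric: a ray corresponds to its vector
`u + v` with `u` and `v` of norm one. The distance on the quotient by `-1` is the least
distance between lifts. -/
def visualDistPlane (Q : QuadraticForm ℝ E) (U : Submodule ℝ E) (x y : EinsteinUniverse Q) : ℝ :=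
  sInf {r : ℝ | ∃ u ∈ U, ∃ v ∈ (bil Q).orthogonal U, ∃ u' ∈ U, ∃ v' ∈ (bil Q).orthogonal U,
    u + v ∈ x.1.submodule ∧ Q u = 1 ∧ -Q v = 1 ∧
    u' + v' ∈ y.1.submodule ∧ Q u' = 1 ∧ -Q v' = 1 ∧
    r = Real.sqrt (Real.arccos (bil Q u u') ^ 2 + Real.arccos (-bil Q v v') ^ 2)}

/-- The visual distance attached to a positive triple `(a,b,c)` of the Einstein universe. -/
def visualDist (Q : QuadraticForm ℝ E) (a b c x y : EinsteinUniverse Q) : ℝ :=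
  visualDistPlane Q (barycentricPlane Q a b c) x y

end Einstein

section Maps

variable {V : Type*} [AddCommGroup V] [Module ℝ V]
variable {E : Type*} [AddCommGroup E] [Module ℝ E]

/-- A positive map from a subset of `P(V)` to the Einstein universe: it sends positive quadruples
to positive quadruples. -/
def IsPositiveMap [TopologicalSpace V] [TopologicalSpace E] (Q : QuadraticForm ℝ E)
    {Ω : Set (ℙ ℝ V)} (ξ : Ω → EinsteinUniverse Q) : Prop :=
  ∀ a b c d : Ω, IsPositiveQuadrupleLine (a : ℙ ℝ V) (b : ℙ ℝ V) (c : ℙ ℝ V) (d : ℙ ℝ V) →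
    IsPositiveQuadruple Q (ξ a) (ξ b) (ξ c) (ξ d)

/-- `(A,B)`-quasisymmetric maps from a subset of `P(V)` to the Einstein universe. -/
def IsQuasisymmetric [TopologicalSpace V] [TopologicalSpace E] (ω : V [⋀^Fin 2]→ₗ[ℝ] ℝ)
    (Q : QuadraticForm ℝ E) (A B : ℝ) {Ω : Set (ℙ ℝ V)} (ξ : Ω → EinsteinUniverse Q) : Prop :=
  IsPositiveMap Q ξ ∧
  ∀ x y z t : Ω, [x, y, z, t].Pairwise (· ≠ ·) →
    A⁻¹ ≤ |crossRatio ω (x : ℙ ℝ V) y z t| → |crossRatio ω (x : ℙ ℝ V) y z t| ≤ A →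
    B⁻¹ ≤ |crossRatioEin Q (ξ x) (ξ y) (ξ z) (ξ t)| ∧
      |crossRatioEin Q (ξ x) (ξ y) (ξ z) (ξ t)| ≤ B

/-- The Hölder property with constants `M` and `α`, for the visual distances of all positive
triples. That the image of a positive triple is positive is part of the property, since it is
what gives a meaning to the visual distance of the image. -/
def IsVisuallyHolder (ω : V [⋀^Fin 2]→ₗ[ℝ] ℝ) (Q : QuadraticForm ℝ E) (M α : ℝ)
    (ξ : ℙ ℝ V → EinsteinUniverse Q) : Prop :=
  ∀ a b c : ℙ ℝ V, IsPositiveTripleLine a b c →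
    IsPositiveTriple Q (ξ a) (ξ b) (ξ c) ∧
    ∀ x y : ℙ ℝ V,
      visualDist Q (ξ a) (ξ b) (ξ c) (ξ x) (ξ y) ≤ M * visualDistLine ω a b c x y ^ α

end Maps

end QSEinstein

end

/-! ### Linear algebra in signature `(2, q)`: the cone in the orthogonal of an isotropic vector, and
positive triples. -/

namespace QSEinstein

noncomputable section

section Lorentz

variable {E : Type*} [AddCommGroup E] [Module ℝ E] {Q : QuadraticForm ℝ E}

/-! Send a point `a` of the curve to infinity and lift the other points to isotropic vectors `F t`
with `⟨a, F t⟩ = -1`. The chords `F t - F s` lie in the orthogonal of `a`, on which `Q` is a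
degenerate Lorentzian form, and `Q (F t - F s) = -2 ⟨F s, F t⟩`. Positivity of triples makes the
chords timelike. Positivity of quadruples, used through the reverse Ptolemy inequality
(`IsPositiveQuadruple.ptolemy`), puts all of them in the same half of the cone (`increments_pos`).
Quasisymmetry compares the Lorentzian lengths of chords with a common end.

The crucial point is that such a comparison of lengths becomes a comparison for the order of the
cone: if `v` and `w` are future and `Q (v + w) ≤ C Q w`, then `C w - v` is future
(`bil_le_of_map_add_le`). Hence a chord is at most `K` times the next one over an interval of
comparable length (`increment_le`). Pairing with a fixed future chord is an additive positive
quantity, which therefore drops by a factor `κ = K / (K + 1)` each time the interval is roughly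
halved. Geometric decay at dyadic scales is Hölder decay with exponent `-log₂ κ`
(`IsTimelikeCurve.holder`). Once the lifts of a triple are normalized to have pairings `-1`,
quasisymmetry also bounds the reference chord, so the constants depend only on `A` and `B`.

For the visual distance, the nonpositive pairing of two lifts makes the spherical angle at most the
circular one, so only the components in the positive plane matter (`visualDistPlane_le`). These are
combinations of pairings with the lifts of the triple. The chart based at a vertex handles points
away from that vertex, and any two points are away from a common vertex (`farFrom_or`).

The same decay makes the lifts Cauchy, whence the extension. Strict positivity survives the limit
because a vanishing pairing would propagate through the reverse Ptolemy inequality and yield an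
isotropic vector orthogonal to a positive triple (`IsAdmissible.of_dense`). Uniqueness is density
together with `IsVisuallyHolder.continuous`. -/

lemma bil_self (x : E) : bil Q x x = Q x :=
  QuadraticMap.associated_eq_self_apply ℝ Q x

lemma bil_comm (x y : E) : bil Q x y = bil Q y x :=
  QuadraticMap.associated_isSymm ℝ Q x y

lemma HasSignature.finiteDimensional {p q : ℕ} (hQ : HasSignature Q p q) (h : 0 < p + q) :
    FiniteDimensional ℝ E :=
  FiniteDimensional.of_finrank_pos (hQ.1 ▸ h)

lemma linearIndependent_three {a b c : E}
    (h : ∀ x y z : ℝ, x • a + y • b + z • c = 0 → x = 0 ∧ y = 0 ∧ z = 0) :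
    LinearIndependent ℝ ![a, b, c] := by
  rw [Fintype.linearIndependent_iff]
  intro g hg
  have := h (g 0) (g 1) (g 2) (by simpa [Fin.sum_univ_three] using hg)
  intro i
  fin_cases i
  · exact this.1
  · exact this.2.1
  · exact this.2.2

lemma mem_span_three {a b c x : E} :
    x ∈ Submodule.span ℝ (Set.range ![a, b, c]) ↔
      ∃ r s t : ℝ, r • a + s • b + t • c = x := by
  rw [Submodule.mem_span_range_iff_exists_fun]
  constructor
  · rintro ⟨g, hg⟩
    exact ⟨g 0, g 1, g 2, by simpa [Fin.sum_univ_three] using hg⟩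
  · rintro ⟨r, s, t, h⟩
    exact ⟨![r, s, t], by simpa [Fin.sum_univ_three] using h⟩

/-- The orthogonal of a positive definite plane is negative definite in signature `(2, q)`. -/
lemma neg_of_orthogonal {q : ℕ} (hQ : HasSignature Q 2 q) {v w z : E} (hv : 0 < Q v)
    (hvw : bil Q v w ^ 2 < Q v * Q w) (hzv : bil Q v z = 0) (hzw : bil Q w z = 0) (hz : z ≠ 0) :
    Q z < 0 := by
  -- Otherwise `Q` would be nonnegative on the three-dimensional span of `v`, `w`, `z`, leaving room
  -- for at most `q - 1` negative squares.
  by_contra! hcon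
  have := hQ.finiteDimensional (by omega)
  have hexp : ∀ x y t : ℝ, Q (x • v + y • w + t • z) =
      x ^ 2 * Q v + 2 * (x * y) * bil Q v w + y ^ 2 * Q w + t ^ 2 * Q z := by
    intro x y t
    simp only [← bil_self, map_add, map_smul, LinearMap.add_apply, LinearMap.smul_apply,
      smul_eq_mul, bil_comm w v, bil_comm z v, bil_comm z w, hzv, hzw]
    ring
  have hnn : ∀ x y t : ℝ, 0 ≤ Q (x • v + y • w + t • z) ∧
      (Q (x • v + y • w + t • z) = 0 → x = 0 ∧ y = 0) := by
    intro x y t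
    rw [hexp]
    have h1 : Q v * (x ^ 2 * Q v + 2 * (x * y) * bil Q v w + y ^ 2 * Q w) =
      (x * Q v + y * bil Q v w) ^ 2 + y ^ 2 * (Q v * Q w - bil Q v w ^ 2) := by ring
    have h2 : 0 ≤ x ^ 2 * Q v + 2 * (x * y) * bil Q v w + y ^ 2 * Q w := by
      refine nonneg_of_mul_nonneg_right (a := Q v) ?_ hv
      rw [h1]
      exact add_nonneg (sq_nonneg _) (mul_nonneg (sq_nonneg _) (by linarith))
    have h3 : 0 ≤ t ^ 2 * Q z := by positivity
    refine ⟨by linarith, fun h => ?_⟩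
    have h4 : x ^ 2 * Q v + 2 * (x * y) * bil Q v w + y ^ 2 * Q w = 0 := by linarith
    rw [h4, mul_zero] at h1
    have h5 : y ^ 2 * (Q v * Q w - bil Q v w ^ 2) = 0 := by
      nlinarith [sq_nonneg (x * Q v + y * bil Q v w),
        mul_nonneg (sq_nonneg y) (sub_nonneg.2 hvw.le)]
    have hy : y = 0 := by
      rcases mul_eq_zero.1 h5 with h | h
      · exact pow_eq_zero_iff (two_ne_zero) |>.1 h
      · linarith
    subst hy
    have hx : x ^ 2 * Q v = 0 := by simpa using h4
    rcases mul_eq_zero.1 hx with h | h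
    · exact ⟨pow_eq_zero_iff (two_ne_zero) |>.1 h, rfl⟩
    · linarith
  have hli : LinearIndependent ℝ ![v, w, z] := by
    refine linearIndependent_three fun x y t h => ?_
    obtain ⟨hx, hy⟩ := (hnn x y t).2 (by rw [h, map_zero])
    subst hx hy
    refine ⟨rfl, rfl, ?_⟩
    simpa [hz] using h
  have hdim := finrank_span_eq_card hli
  have key := QuadraticForm.sigPos_add_finrank_le_of_nonpos (Q := -Q)
    (V := Submodule.span ℝ (Set.range ![v, w, z])) (by
      intro x hx
      obtain ⟨r, s, t, rfl⟩ := mem_span_three.1 hx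
      simpa using (hnn r s t).1)
  rw [hdim, sigPos_neg, hQ.2.2, hQ.1, Fintype.card_fin] at key
  omega

/-- The reverse Cauchy-Schwarz inequality in the orthogonal of an isotropic vector. -/
lemma reverse_cauchy_schwarz {q : ℕ} (hQ : HasSignature Q 2 q) {a v w : E} (ha : a ≠ 0)
    (ha0 : Q a = 0) (hv : bil Q a v = 0) (hw : bil Q a w = 0) (hpos : 0 < Q v) :
    Q v * Q w ≤ bil Q v w ^ 2 := by
  -- If the inequality failed, `v` and `w` would span a positive definite plane whose orthogonal
  -- contains the nonzero isotropic vector `a`.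
  by_contra! h
  have := neg_of_orthogonal hQ hpos h (by rw [bil_comm, hv]) (by rw [bil_comm, hw]) ha
  linarith

/-- Two timelike vectors in the orthogonal of `a` are never orthogonal to each other, by the reverse
Cauchy-Schwarz inequality; a weak sign therefore becomes strict. -/
lemma pairing_pos_of_nonneg {q : ℕ} (hQ : HasSignature Q 2 q) {a v w : E} (ha : a ≠ 0)
    (ha0 : Q a = 0) (hv : bil Q a v = 0) (hw : bil Q a w = 0) (hv0 : 0 < Q v) (hw0 : 0 < Q w)
    (h : 0 ≤ bil Q v w) : 0 < bil Q v w := by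
  have h1 := reverse_cauchy_schwarz hQ ha ha0 hv hw hv0
  have h2 := mul_pos hv0 hw0
  refine h.lt_of_ne fun h0 => ?_
  rw [← h0] at h1
  norm_num at h1
  linarith

lemma map_sub_smul (s t : E) (k : ℝ) :
    Q (t - k • s) = Q t - 2 * k * bil Q s t + k ^ 2 * Q s := by
  simp only [← bil_self, map_sub, map_smul, LinearMap.sub_apply, LinearMap.smul_apply,
      smul_eq_mul, bil_comm t s]
  ring

lemma map_add_bil (s t : E) : Q (s + t) = Q s + 2 * bil Q s t + Q t := by
  simp only [← bil_self, map_add, LinearMap.add_apply, bil_comm t s]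
  ring

lemma map_sub_bil (s t : E) : Q (s - t) = Q s - 2 * bil Q s t + Q t := by
  simp only [← bil_self, map_sub, LinearMap.sub_apply, bil_comm t s]
  ring

/-- Being in the same half of the cone of positive vectors is transitive. -/
lemma same_cone_trans {q : ℕ} (hQ : HasSignature Q 2 q) {a s t w : E} (ha : a ≠ 0)
    (ha0 : Q a = 0) (hs : bil Q a s = 0) (ht : bil Q a t = 0) (hw : bil Q a w = 0)
    (hs0 : 0 < Q s) (ht0 : 0 < Q t) (hw0 : 0 < Q w)
    (hsw : 0 < bil Q s w) (htw : 0 < bil Q t w) : 0 < bil Q s t := by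
  -- This `k` makes `t - k s` orthogonal to the timelike vector `w`, so `Q (t - k s) ≤ 0`. Expanding
  -- forces `⟨s, t⟩` to be positive.
  set k := bil Q t w / bil Q s w with hk
  have hkpos : 0 < k := div_pos htw hsw
  have h1 : bil Q w (t - k • s) = 0 := by
    simp only [map_sub, map_smul, smul_eq_mul, bil_comm w t, bil_comm w s, hk]
    field_simp
    ring
  have h2 := reverse_cauchy_schwarz hQ ha ha0 hw (w := t - k • s) (by simp [hs, ht]) hw0
  rw [h1, map_sub_smul] at h2
  have h3 : Q t - 2 * k * bil Q s t + k ^ 2 * Q s ≤ 0 := by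
    by_contra! h
    have := mul_pos hw0 h
    norm_num at h2
    linarith
  have : 0 < k ^ 2 * Q s := by positivity
  by_contra! h
  nlinarith

/-- If adding `v` to `w` multiplies the square of the Lorentzian length by at most `C`, then `v`
is at most `C` times `w` for the order of the cone. -/
lemma bil_le_of_map_add_le {q : ℕ} (hQ : HasSignature Q 2 q) {a v w e : E} (ha : a ≠ 0)
    (ha0 : Q a = 0) (hv : bil Q a v = 0) (hw : bil Q a w = 0) (he : bil Q a e = 0)
    (hv0 : 0 < Q v) (hw0 : 0 < Q w) (he0 : 0 < Q e) (hew : 0 < bil Q e w)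
    {C : ℝ} (hC : 0 < C) (h : Q (v + w) ≤ C * Q w) : bil Q v e ≤ C * bil Q w e := by
  rw [map_add_bil] at h
  -- The hypothesis gives `2⟨v, w⟩ ≤ (C - 1) Q w - Q v`, hence `Q (C w - v) ≥ C Q w + (C + 1) Q v`.
  -- So `C w - v` is timelike, in the half cone of `w` and therefore in that of `e`.
  have h1 : 0 < Q (C • w - v) := by
    have : C • w - v = -(v - C • w) := by abel
    rw [this, QuadraticMap.map_neg, map_sub_smul, bil_comm w v]
    have : 0 < C * Q w := mul_pos hC hw0
    have : 0 < C * Q v := mul_pos hC hv0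
    nlinarith
  have h2 : 0 < bil Q (C • w - v) w := by
    have : 0 < C * Q w := mul_pos hC hw0
    simp only [map_sub, map_smul, LinearMap.sub_apply, LinearMap.smul_apply, smul_eq_mul, bil_self]
    linarith
  have h3 := same_cone_trans hQ ha ha0 (by simp [hv, hw]) he hw h1 he0 hw0 h2 hew
  simp only [map_sub, map_smul, LinearMap.sub_apply, LinearMap.smul_apply, smul_eq_mul] at h3
  linarith

/-- Three isotropic vectors which span a space of signature `(2, 1)` have a negative triple
product. -/
lemma triple_product_neg {a b c : E} (ha : Q a = 0) (hb : Q b = 0) (hc : Q c = 0)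
    (h : HasSignature (Q.restrict (Submodule.span ℝ (Set.range ![a, b, c]))) 2 1) :
    bil Q a b * bil Q b c * bil Q c a < 0 := by
  set W := Submodule.span ℝ (Set.range ![a, b, c]) with hW
  have hWf := h.finiteDimensional (by omega)
  have hli : LinearIndependent ℝ ![a, b, c] := by
    rw [linearIndependent_iff_card_eq_finrank_span]
    exact h.1.symm
  -- a plane on which the form is nonpositive cannot exist
  have key : ∀ v ∈ W, ∀ w ∈ W, LinearIndependent ℝ ![v, w] →
      (∀ x y : ℝ, Q (x • v + y • w) ≤ 0) → False := by
    intro v hv w hw hvw hneg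
    have hvw' : LinearIndependent ℝ ![(⟨v, hv⟩ : W), ⟨w, hw⟩] := by
      refine LinearIndependent.of_comp W.subtype ?_
      convert hvw using 1
      ext i
      fin_cases i <;> rfl
    have hdim := finrank_span_eq_card hvw'
    have := QuadraticForm.sigPos_add_finrank_le_of_nonpos (Q := Q.restrict W)
      (V := Submodule.span ℝ (Set.range ![(⟨v, hv⟩ : W), ⟨w, hw⟩])) (by
        intro x hx
        rw [Matrix.range_cons, Matrix.range_cons, Matrix.range_empty, Set.union_empty,
          Set.singleton_union, Submodule.mem_span_pair] at hx
        obtain ⟨r, s, rfl⟩ := hx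
        exact hneg r s)
    rw [h.2.1, h.1, hdim, Fintype.card_fin] at this
    omega
  have haW : a ∈ W := Submodule.subset_span ⟨0, rfl⟩
  have hbW : b ∈ W := Submodule.subset_span ⟨1, rfl⟩
  have hcW : c ∈ W := Submodule.subset_span ⟨2, rfl⟩
  have hrel : ∀ x y z : ℝ, x • a + y • b + z • c = 0 → x = 0 ∧ y = 0 ∧ z = 0 := by
    intro x y z hx
    have := Fintype.linearIndependent_iff.1 hli ![x, y, z]
      (by simpa [Fin.sum_univ_three] using hx)
    exact ⟨this 0, this 1, this 2⟩
  have hexp : ∀ x y z : ℝ, Q (x • a + y • b + z • c) =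
      2 * (x * y * bil Q a b + y * z * bil Q b c + z * x * bil Q c a) := by
    intro x y z
    simp only [← bil_self, map_add, map_smul, LinearMap.add_apply, LinearMap.smul_apply,
      smul_eq_mul, bil_comm b a, bil_comm c b, bil_comm a c]
    simp only [bil_self, ha, hb, hc]
    ring
  by_contra! hcon
  -- Two orthogonal isotropic vectors would span a totally isotropic plane.
  have hab : bil Q a b ≠ 0 := by
    intro h0
    refine key a haW b hbW (LinearIndependent.pair_iff.2 fun x y hxy => ?_) fun x y => ?_
    · have := hrel x y 0 (by simpa using hxy)
      exact ⟨this.1, this.2.1⟩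
    · have := hexp x y 0
      simp [h0] at this
      exact this.le
  have hbc : bil Q b c ≠ 0 := by
    intro h0
    refine key b hbW c hcW (LinearIndependent.pair_iff.2 fun x y hxy => ?_) fun x y => ?_
    · have := hrel 0 x y (by simpa using hxy)
      exact ⟨this.2.1, this.2.2⟩
    · have := hexp 0 x y
      simp [h0] at this
      exact this.le
  have hca : bil Q c a ≠ 0 := by
    intro h0
    refine key a haW c hcW (LinearIndependent.pair_iff.2 fun x y hxy => ?_) fun x y => ?_
    · have := hrel x 0 y (by simpa using hxy)
      exact ⟨this.1, this.2.2⟩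
    · have := hexp x 0 y
      simp [h0] at this
      exact this.le
  set p := bil Q a b
  set q := bil Q b c
  set r := bil Q c a
  -- In the rescaled basis `q a`, `r b`, `p c` the form is `2pqr (xy + yz + zx)`. On the plane `x +
  -- y + z = 0` it has the sign of `-pqr`, assumed nonpositive here.
  refine key (q • a - r • b) (W.sub_mem (W.smul_mem _ haW) (W.smul_mem _ hbW))
    (r • b - p • c) (W.sub_mem (W.smul_mem _ hbW) (W.smul_mem _ hcW))
    (LinearIndependent.pair_iff.2 fun x y hxy => ?_) fun x y => ?_
  · have := hrel (x * q) ((y - x) * r) (-(y * p)) (by rw [← hxy]; module)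
    refine ⟨(mul_eq_zero.1 this.1).resolve_right hbc, ?_⟩
    have h3 := this.2.2
    rw [neg_eq_zero] at h3
    exact (mul_eq_zero.1 h3).resolve_right hab
  · have h1 := hexp (x * q) ((y - x) * r) (-(y * p))
    have h2 : x • (q • a - r • b) + y • (r • b - p • c) =
      (x * q) • a + ((y - x) * r) • b + (-(y * p)) • c := by module
    rw [h2, h1]
    have : 2 * (x * q * ((y - x) * r) * p + (y - x) * r * (-(y * p)) * q
        + -(y * p) * (x * q) * r) = - (p * q * r) * (x ^ 2 + y ^ 2 + (x - y) ^ 2) := by ring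
    rw [this]
    have : 0 ≤ (p * q * r) * (x ^ 2 + y ^ 2 + (x - y) ^ 2) := by positivity
    linarith

/-- Three isotropic vectors with a negative triple product span a space of signature `(2, 1)`. -/
lemma hasSignature_span_of_triple_product_neg {a b c : E} (ha : Q a = 0) (hb : Q b = 0)
    (hc : Q c = 0) (h : bil Q a b * bil Q b c * bil Q c a < 0) :
    HasSignature (Q.restrict (Submodule.span ℝ (Set.range ![a, b, c]))) 2 1 := by
  set W := Submodule.span ℝ (Set.range ![a, b, c]) with hW
  have haW : a ∈ W := Submodule.subset_span ⟨0, rfl⟩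
  have hbW : b ∈ W := Submodule.subset_span ⟨1, rfl⟩
  have hcW : c ∈ W := Submodule.subset_span ⟨2, rfl⟩
  have hexp : ∀ x y z : ℝ, Q (x • a + y • b + z • c) =
      2 * (x * y * bil Q a b + y * z * bil Q b c + z * x * bil Q c a) := by
    intro x y z
    simp only [← bil_self, map_add, map_smul, LinearMap.add_apply, LinearMap.smul_apply,
      smul_eq_mul, bil_comm b a, bil_comm c b, bil_comm a c]
    simp only [bil_self, ha, hb, hc]
    ring
  set p := bil Q a b with hp
  set q := bil Q b c with hq
  set r := bil Q c a with hr
  have hp0 : p ≠ 0 := by rintro h0; simp [h0] at h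
  have hq0 : q ≠ 0 := by rintro h0; simp [h0] at h
  have hr0 : r ≠ 0 := by rintro h0; simp [h0] at h
  have hli : LinearIndependent ℝ ![a, b, c] := by
    refine linearIndependent_three fun x y z h0 => ?_
    have h1 : bil Q a (x • a + y • b + z • c) = y * p + z * r := by
      simp [bil_self, ha, ← hp, bil_comm a c, ← hr]
    have h2 : bil Q b (x • a + y • b + z • c) = x * p + z * q := by
      simp [bil_self, hb, ← hq, bil_comm b a, ← hp]
    have h3 : bil Q c (x • a + y • b + z • c) = x * r + y * q := by
      simp [bil_self, hc, ← hr, bil_comm c b, ← hq]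
    rw [h0, map_zero] at h1 h2 h3
    have hx : 2 * (p * r) * x = 0 := by linear_combination (-r) * h2 - p * h3 + q * h1
    have hy : 2 * (p * q) * y = 0 := by linear_combination r * h2 - p * h3 - q * h1
    have hz : 2 * (q * r) * z = 0 := by linear_combination - r * h2 + p * h3 - q * h1
    refine ⟨?_, ?_, ?_⟩
    · exact (mul_eq_zero.1 hx).resolve_left (by positivity)
    · exact (mul_eq_zero.1 hy).resolve_left (by positivity)
    · exact (mul_eq_zero.1 hz).resolve_left (by positivity)
  have hdim : Module.finrank ℝ W = 3 := by
    rw [hW, finrank_span_eq_card hli, Fintype.card_fin]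
  have hWf : FiniteDimensional ℝ W := FiniteDimensional.of_finrank_pos (by omega)
  have hrel : ∀ x y z : ℝ, x • a + y • b + z • c = 0 → x = 0 ∧ y = 0 ∧ z = 0 := by
    intro x y z hx
    have := Fintype.linearIndependent_iff.1 hli ![x, y, z]
      (by simpa [Fin.sum_univ_three] using hx)
    exact ⟨this 0, this 1, this 2⟩
  -- In this rescaled basis, `xy + yz + zx` shows the signature: with `pqr < 0`, the form is
  -- positive definite on `x + y + z = 0` and negative on `(1, 1, 1)`.
  have hexp' : ∀ x y z : ℝ, Q ((x * q) • a + (y * r) • b + (z * p) • c) =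
      2 * (p * q * r) * (x * y + y * z + z * x) := by
    intro x y z
    rw [hexp]
    ring
  have hneg : Module.finrank ℝ (Submodule.span ℝ {(⟨q • a + r • b + p • c,
      W.add_mem (W.add_mem (W.smul_mem _ haW) (W.smul_mem _ hbW)) (W.smul_mem _ hcW)⟩ : W)}) = 1 := by
    refine finrank_span_singleton fun h0 => ?_
    exact hq0 (hrel _ _ _ (Subtype.ext_iff.1 h0)).1
  have hpd : ∃ P : Submodule ℝ W, Module.finrank ℝ P = 2 ∧ ((Q.restrict W).restrict P).PosDef := by
    refine ⟨Submodule.span ℝ (Set.range ![(⟨q • a - r • b, W.sub_mem (W.smul_mem _ haW)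
      (W.smul_mem _ hbW)⟩ : W), ⟨r • b - p • c, W.sub_mem (W.smul_mem _ hbW)
      (W.smul_mem _ hcW)⟩]), ?_, ?_⟩
    · rw [finrank_span_eq_card, Fintype.card_fin]
      refine LinearIndependent.pair_iff.2 fun x y hxy => ?_
      have hxy' := Subtype.ext_iff.1 hxy
      simp only [Submodule.coe_add, Submodule.coe_smul, Submodule.coe_zero] at hxy'
      have := hrel (x * q) ((y - x) * r) (-(y * p)) (by rw [← hxy']; module)
      refine ⟨(mul_eq_zero.1 this.1).resolve_right hq0, ?_⟩
      have h3 := this.2.2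
      rw [neg_eq_zero] at h3
      exact (mul_eq_zero.1 h3).resolve_right hp0
    · rintro ⟨x, hx⟩ hx0
      rw [Matrix.range_cons, Matrix.range_cons, Matrix.range_empty, Set.union_empty,
          Set.singleton_union, Submodule.mem_span_pair] at hx
      obtain ⟨r', s', rfl⟩ := hx
      change 0 < Q (r' • (q • a - r • b) + s' • (r • b - p • c))
      have h2 : r' • (q • a - r • b) + s' • (r • b - p • c) =
        (r' * q) • a + ((s' - r') * r) • b + (-s' * p) • c := by module
      rw [h2, hexp']
      have : 2 * (p * q * r) * (r' * (s' - r') + (s' - r') * -s' + -s' * r') =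
        -(p * q * r) * (r' ^ 2 + s' ^ 2 + (r' - s') ^ 2) := by ring
      rw [this]
      refine mul_pos (by linarith) ?_
      by_contra! hle
      have h5 : r' = 0 := by
        have : r' ^ 2 = 0 := by nlinarith [sq_nonneg r', sq_nonneg s', sq_nonneg (r' - s')]
        exact pow_eq_zero_iff (two_ne_zero) |>.1 this
      have h6 : s' = 0 := by
        have : s' ^ 2 = 0 := by nlinarith [sq_nonneg r', sq_nonneg s', sq_nonneg (r' - s')]
        exact pow_eq_zero_iff (two_ne_zero) |>.1 this
      apply hx0
      ext
      simp [h5, h6]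
  have hnd : ((-(Q.restrict W)).restrict (Submodule.span ℝ {(⟨q • a + r • b + p • c,
      W.add_mem (W.add_mem (W.smul_mem _ haW) (W.smul_mem _ hbW)) (W.smul_mem _ hcW)⟩ : W)})).PosDef := by
    rintro ⟨x, hx⟩ hx0
    obtain ⟨t, rfl⟩ := Submodule.mem_span_singleton.1 hx
    change 0 < -Q (t • (q • a + r • b + p • c))
    have ht : t ≠ 0 := by
      rintro rfl
      apply hx0
      ext
      simp
    have := hexp' 1 1 1
    simp only [one_mul] at this
    rw [QuadraticMap.map_smul, this, smul_eq_mul]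
    have : 0 < t * t := mul_self_pos.2 ht
    nlinarith
  obtain ⟨P, hP, hPd⟩ := hpd
  have h1 := le_sigPos_of_posDef _ hPd
  have h2 := le_sigNeg_of_negDef _ hnd
  have h3 := QuadraticForm.sigPos_add_sigNeg_add_radical (Q := Q.restrict W)
  rw [hP] at h1
  rw [hneg] at h2
  rw [hdim] at h3
  exact ⟨hdim, by omega, by omega⟩

end Lorentz

end

end QSEinstein

/-! ### Timelike curves in an affine chart: doubling, Hölder decay, and existence of limits. -/

namespace QSEinstein

noncomputable section

section Curve

open Filter Topology

variable {E : Type*} [AddCommGroup E] [Module ℝ E] {Q : QuadraticForm ℝ E}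

/-- A quasisymmetric positive curve in the affine chart of the Einstein universe defined by the
isotropic vector `a`: its points are normalized by `⟨a, F t⟩ = -1`, and the differences of its
points lie in the future cone of the orthogonal of `a`. -/
structure IsTimelikeCurve (Q : QuadraticForm ℝ E) (A B : ℝ) (a : E) (D : Set ℝ) (F : ℝ → E) :
    Prop where
  ne_zero : a ≠ 0
  map_base : Q a = 0
  dense : Dense D
  map_eq : ∀ t ∈ D, Q (F t) = 0
  bil_base : ∀ t ∈ D, bil Q a (F t) = -1
  bil_neg : ∀ s ∈ D, ∀ t ∈ D, s < t → bil Q (F s) (F t) < 0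
  superadditive : ∀ x ∈ D, ∀ y ∈ D, ∀ z ∈ D, x < y → y < z →
    bil Q (F x) (F z) ≤ bil Q (F x) (F y) + bil Q (F y) (F z)
  quasisymmetric : ∀ x ∈ D, ∀ y ∈ D, ∀ t ∈ D, x ≠ y → x ≠ t → y ≠ t →
    |x - y| < A * |x - t| → |x - t| < A * |x - y| →
    -bil Q (F x) (F y) ≤ B * -bil Q (F x) (F t)

namespace IsTimelikeCurve

variable {A B : ℝ} {a : E} {D : Set ℝ} {F : ℝ → E} {q : ℕ}

lemma exists_mem_Ioo (h : IsTimelikeCurve Q A B a D F) {s t : ℝ} (hst : s < t) :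
    ∃ x ∈ D, s < x ∧ x < t := by
  obtain ⟨x, hx, h1⟩ := h.dense.exists_between hst
  exact ⟨x, hx, h1.1, h1.2⟩

/-- Time reversal transfers estimates anchored at the left end of an interval to its right end. -/
lemma reflect (h : IsTimelikeCurve Q A B a D F) :
    IsTimelikeCurve Q A B a (-D) (fun t => F (-t)) where
  ne_zero := h.ne_zero
  map_base := h.map_base
  dense := by
    have := h.dense.preimage (Homeomorph.neg ℝ).isOpenMap
    exact this
  map_eq t ht := h.map_eq _ ht
  bil_base t ht := h.bil_base _ ht
  bil_neg s hs t ht hst := by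
    rw [bil_comm]
    exact h.bil_neg _ ht _ hs (by linarith)
  superadditive x hx y hy z hz hxy hyz := by
    have := h.superadditive _ hz _ hy _ hx (by linarith) (by linarith)
    rw [bil_comm (F (-x)) (F (-z)), bil_comm (F (-x)), bil_comm (F (-y)) (F (-z))]
    linarith
  quasisymmetric x hx y hy t ht hxy hxt hyt h1 h2 := by
    refine h.quasisymmetric _ hx _ hy _ ht (by simpa using hxy) (by simpa using hxt)
      (by simpa using hyt) ?_ ?_
    · rwa [neg_sub_neg, neg_sub_neg, abs_sub_comm y, abs_sub_comm t]
    · rwa [neg_sub_neg, neg_sub_neg, abs_sub_comm y, abs_sub_comm t]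

lemma bil_sub (h : IsTimelikeCurve Q A B a D F) {s t : ℝ} (hs : s ∈ D) (ht : t ∈ D) :
    bil Q a (F t - F s) = 0 := by
  rw [map_sub, h.bil_base s hs, h.bil_base t ht, sub_self]

/-- The lifts being isotropic, their pairings are squared lengths of chords; this is how cross-ratio
bounds become metric information. -/
lemma map_sub_eq (h : IsTimelikeCurve Q A B a D F) {s t : ℝ} (hs : s ∈ D) (ht : t ∈ D) :
    Q (F t - F s) = -2 * bil Q (F s) (F t) := by
  rw [map_sub_bil, h.map_eq s hs, h.map_eq t ht, bil_comm]
  ring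

lemma map_sub_pos (h : IsTimelikeCurve Q A B a D F) {s t : ℝ} (hs : s ∈ D) (ht : t ∈ D)
    (hst : s < t) : 0 < Q (F t - F s) := by
  rw [h.map_sub_eq hs ht]
  linarith [h.bil_neg s hs t ht hst]

/-- Since `F y` is isotropic, superadditivity is literally the nonnegativity of the pairing of the
two adjacent chords. -/
lemma consecutive_pos (h : IsTimelikeCurve Q A B a D F) (hQ : HasSignature Q 2 q) {x y z : ℝ}
    (hx : x ∈ D) (hy : y ∈ D) (hz : z ∈ D) (hxy : x < y) (hyz : y < z) :
    0 < bil Q (F y - F x) (F z - F y) := by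
  refine pairing_pos_of_nonneg hQ h.ne_zero h.map_base (h.bil_sub hx hy) (h.bil_sub hy hz)
    (h.map_sub_pos hx hy hxy) (h.map_sub_pos hy hz hyz) ?_
  have := h.superadditive x hx y hy z hz hxy hyz
  simp only [map_sub, LinearMap.sub_apply, bil_self, h.map_eq y hy]
  linarith

lemma same_end_pos (h : IsTimelikeCurve Q A B a D F) (hQ : HasSignature Q 2 q) {x y z : ℝ}
    (hx : x ∈ D) (hy : y ∈ D) (hz : z ∈ D) (hxz : x < z) (hyz : y < z) :
    0 < bil Q (F z - F x) (F z - F y) := by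
  rcases lt_trichotomy x y with hxy | rfl | hxy
  · have h1 := h.consecutive_pos hQ hx hy hz hxy hyz
    have h2 := h.map_sub_pos hy hz hyz
    have : F z - F x = (F y - F x) + (F z - F y) := by abel
    rw [this, map_add, LinearMap.add_apply, bil_self]
    linarith
  · rw [bil_self]
    exact h.map_sub_pos hx hz hxz
  · have h1 := h.consecutive_pos hQ hy hx hz hxy hxz
    have h2 := h.map_sub_pos hx hz hxz
    have : F z - F y = (F x - F y) + (F z - F x) := by abel
    rw [this, map_add, bil_self, bil_comm]
    linarith

/-- All increments of the curve lie in the same half of the cone. -/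
lemma increments_pos (h : IsTimelikeCurve Q A B a D F) (hQ : HasSignature Q 2 q) {x y s t : ℝ}
    (hx : x ∈ D) (hy : y ∈ D) (hs : s ∈ D) (ht : t ∈ D) (hxy : x < y) (hst : s < t) :
    0 < bil Q (F y - F x) (F t - F s) := by
  -- A point `m` beyond both intervals: each chord is consecutive to a chord ending at `m`, and two
  -- chords with the same end are in the same half cone.
  obtain ⟨m, hm, hm1, -⟩ := h.exists_mem_Ioo (lt_add_one (max y t))
  have hym : y < m := (le_max_left _ _).trans_lt hm1
  have htm : t < m := (le_max_right _ _).trans_lt hm1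
  have h1 := h.consecutive_pos hQ hx hy hm hxy hym
  have h2 := h.consecutive_pos hQ hs ht hm hst htm
  have h3 := h.same_end_pos hQ ht hy hm htm hym
  have h4 := same_cone_trans hQ h.ne_zero h.map_base (h.bil_sub hx hy) (h.bil_sub ht hm)
    (h.bil_sub hy hm) (h.map_sub_pos hx hy hxy) (h.map_sub_pos ht hm htm)
    (h.map_sub_pos hy hm hym) h1 h3
  exact same_cone_trans hQ h.ne_zero h.map_base (h.bil_sub hx hy) (h.bil_sub hs ht)
    (h.bil_sub ht hm) (h.map_sub_pos hx hy hxy) (h.map_sub_pos hs ht hst)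
    (h.map_sub_pos ht hm htm) h4 h2

lemma increments_nonneg (h : IsTimelikeCurve Q A B a D F) (hQ : HasSignature Q 2 q) {x y s t : ℝ}
    (hx : x ∈ D) (hy : y ∈ D) (hs : s ∈ D) (ht : t ∈ D) (hxy : x ≤ y) (hst : s ≤ t) :
    0 ≤ bil Q (F y - F x) (F t - F s) := by
  rcases hxy.lt_or_eq with hxy | rfl
  · rcases hst.lt_or_eq with hst | rfl
    · exact (h.increments_pos hQ hx hy hs ht hxy hst).le
    · simp
  · simp

lemma increments_mono (h : IsTimelikeCurve Q A B a D F) (hQ : HasSignature Q 2 q)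
    {x y l r s t : ℝ} (hx : x ∈ D) (hy : y ∈ D) (hl : l ∈ D) (hr : r ∈ D) (hs : s ∈ D)
    (ht : t ∈ D) (hxy : x ≤ y) (hls : l ≤ s) (htr : t ≤ r) :
    bil Q (F y - F x) (F t - F s) ≤ bil Q (F y - F x) (F r - F l) := by
  have h1 := h.increments_nonneg hQ hx hy hl hs hxy hls
  have h2 := h.increments_nonneg hQ hx hy ht hr hxy htr
  have : F r - F l = (F s - F l) + (F t - F s) + (F r - F t) := by abel
  rw [this, map_add, map_add]
  linarith

/-- Iterated quasisymmetry. -/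
lemma bil_le_pow (h : IsTimelikeCurve Q A B a D F) (hA : 1 < A) (hB : 1 < B) (N : ℕ) {x y z : ℝ}
    (hx : x ∈ D) (hy : y ∈ D) (hz : z ∈ D) (hxy : x < y) (hyz : y < z)
    (hN : z - x < A ^ N * (y - x)) : -bil Q (F x) (F z) ≤ B ^ N * -bil Q (F x) (F y) := by
  induction N generalizing y with
  | zero => linarith
  | succ N ih =>
    have hpos : 0 < -bil Q (F x) (F y) := by linarith [h.bil_neg x hx y hy hxy]
    have step : ∀ w ∈ D, y < w → w - x < A * (y - x) →
        -bil Q (F x) (F w) ≤ B * -bil Q (F x) (F y) := by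
      intro w hw hyw hwx
      refine h.quasisymmetric x hx w hw y hy (by linarith) (by linarith) (by linarith) ?_ ?_
      · rw [abs_sub_comm, abs_of_pos (by linarith), abs_sub_comm, abs_of_pos (by linarith)]
        linarith
      · rw [abs_sub_comm, abs_of_pos (by linarith), abs_sub_comm, abs_of_pos (by linarith)]
        nlinarith
    by_cases hzA : z - x < A * (y - x)
    · refine (step z hz hyz hzA).trans ?_
      rw [pow_succ']
      have := one_le_pow₀ (n := N) hB.le
      have : B * 1 ≤ B * B ^ N := by gcongr
      nlinarith
    · push Not at hzA
      have hAN : 0 < A ^ N := by positivity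
      -- The intermediate point must be within ratio `A` of `y`, for one use of quasisymmetry, and
      -- far enough that the remaining ratio is below `A ^ N`.
      obtain ⟨w, hw, hw1, hw2⟩ := h.exists_mem_Ioo
        (s := max y (x + (z - x) / A ^ N)) (t := x + A * (y - x)) (by
          refine max_lt (by nlinarith) ?_
          rw [add_lt_add_iff_left, div_lt_iff₀ hAN]
          rw [pow_succ] at hN
          linarith)
      have hyw := (le_max_left _ _).trans_lt hw1
      have hxw := (le_max_right _ _).trans_lt hw1
      have h1 := step w hw hyw (by linarith)
      have h2 := ih hw (by linarith) (by linarith) (by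
        have : (z - x) / A ^ N < w - x := by linarith
        rw [div_lt_iff₀ hAN] at this
        linarith)
      calc _ ≤ _ := h2
        _ ≤ B ^ N * (B * -bil Q (F x) (F y)) := by gcongr
        _ = _ := by ring

/-- Increments are doubling. -/
lemma increment_le (h : IsTimelikeCurve Q A B a D F) (hQ : HasSignature Q 2 q)
    (hA : 1 < A) (hB : 1 < B) {N : ℕ}
    (hN : 3 < A ^ N) {x y z l r : ℝ} (hx : x ∈ D) (hy : y ∈ D) (hz : z ∈ D) (hl : l ∈ D)
    (hr : r ∈ D) (hxy : x < y) (hyz : y < z) (hlr : l < r) (hd : z - x ≤ 3 * (z - y)) :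
    bil Q (F y - F x) (F r - F l) ≤ B ^ N * bil Q (F z - F y) (F r - F l) := by
  refine bil_le_of_map_add_le hQ h.ne_zero h.map_base (h.bil_sub hx hy) (h.bil_sub hy hz)
    (h.bil_sub hl hr) (h.map_sub_pos hx hy hxy) (h.map_sub_pos hy hz hyz)
    (h.map_sub_pos hl hr hlr) (h.increments_pos hQ hl hr hy hz hlr hyz) (by positivity) ?_
  -- The two chords compared, over `[x, z]` and `[y, z]`, share their right end, hence the
  -- reflection. The ratio of their lengths is at most `3 < A ^ N`.
  have := h.reflect.bil_le_pow hA hB N (x := -z) (y := -y) (z := -x) (by simpa using hz)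
    (by simpa using hy) (by simpa using hx) (by linarith) (by linarith) (by nlinarith)
  simp only [neg_neg] at this
  have h1 : F y - F x + (F z - F y) = F z - F x := by abel
  rw [h1, h.map_sub_eq hx hz, h.map_sub_eq hy hz, bil_comm (F x), bil_comm (F y)]
  linarith

/-- Doubling bounds an increment by a fraction `K / (K + 1)` of the increment over an interval at
most twice as long; this is iterated `k` times. The margin `x + 1 ≤ r` keeps the enlarged intervals
inside `[l, r]`. -/
lemma increment_le_pow (h : IsTimelikeCurve Q A B a D F) (hQ : HasSignature Q 2 q)
    (hA : 1 < A) (hB : 1 < B) {N : ℕ} (hN : 3 < A ^ N) {l r : ℝ} (hl : l ∈ D) (hr : r ∈ D)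
    (k : ℕ) {x y : ℝ} (hx : x ∈ D) (hy : y ∈ D) (hxy : x < y) (hlx : l ≤ x) (hxr : x + 1 ≤ r)
    (hk : 2 ^ k * (y - x) ≤ 1) :
    bil Q (F y - F x) (F r - F l) ≤
      (B ^ N / (B ^ N + 1)) ^ k * bil Q (F r - F l) (F r - F l) := by
  have hlr : l < r := by linarith
  induction k generalizing y with
  | zero =>
    rw [pow_zero, one_mul, bil_comm]
    exact h.increments_mono hQ hl hr hl hr hx hy hlr.le hlx (by linarith)
  | succ k ih =>
    -- Exact doubling may leave `D`, so `z` is only taken in a range: `z - y > (y - x) / 2` gives `z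
    -- - x ≤ 3 (z - y)`, and `z - x` is at most twice `y - x`.
    obtain ⟨z, hz, hz1, hz2⟩ := h.exists_mem_Ioo (s := y + (y - x) / 2) (t := y + (y - x))
      (by linarith)
    have h1 := h.increment_le hQ hA hB hN hx hy hz hl hr hxy (by linarith) hlr (by linarith)
    have hk' : (2 : ℝ) ^ k * (z - x) ≤ 1 := by
      rw [pow_succ] at hk
      have : (2 : ℝ) ^ k * (z - x) ≤ 2 ^ k * (2 * (y - x)) := by gcongr; linarith
      linarith
    have h2 := ih hz (by linarith) hk'
    have h3 : F z - F x = (F y - F x) + (F z - F y) := by abel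
    rw [h3, map_add, LinearMap.add_apply] at h2
    have hK : 0 < B ^ N := by positivity
    set K := B ^ N
    have h4 : bil Q (F y - F x) (F r - F l) * (K + 1) ≤
        K * (bil Q (F y - F x) (F r - F l) + bil Q (F z - F y) (F r - F l)) := by linarith
    rw [← le_div_iff₀ (by positivity)] at h4
    calc _ ≤ _ := h4
      _ = K / (K + 1) * (bil Q (F y - F x) (F r - F l) + bil Q (F z - F y) (F r - F l)) := by
        ring
      _ ≤ K / (K + 1) * ((K / (K + 1)) ^ k * bil Q (F r - F l) (F r - F l)) := by gcongr
      _ = _ := by ring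

end IsTimelikeCurve

/-- Geometric decay at dyadic scales is Hölder decay. -/
lemma rpow_bound_of_dyadic {κ : ℝ} (hκ : 0 < κ) {s : ℝ} (hs : 0 < s) (hs1 : s ≤ 1) :
    ∃ k : ℕ, 2 ^ k * s ≤ 1 ∧ (κ < 1 → κ ^ k ≤ κ⁻¹ * s ^ (-Real.logb 2 κ)) := by
  obtain ⟨k, hk1, hk2⟩ := exists_nat_pow_near (x := 1 / s) (y := (2 : ℝ))
    ((one_le_div hs).2 hs1) one_lt_two
  rw [le_div_iff₀ hs] at hk1
  refine ⟨k, hk1, fun hκ1 => ?_⟩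
  have hα : 0 ≤ -Real.logb 2 κ := by
    rw [neg_nonneg]
    exact (Real.logb_neg one_lt_two hκ hκ1).le
  have h1 : (2 ^ (k + 1) : ℝ)⁻¹ ≤ s := by
    rw [inv_le_comm₀ (by positivity) hs, ← one_div]
    exact hk2.le
  have h2 : κ ^ (k + 1) = ((2 ^ (k + 1) : ℝ)⁻¹) ^ (-Real.logb 2 κ) := by
    rw [Real.rpow_neg (by positivity), Real.inv_rpow (by positivity), inv_inv,
      ← Real.rpow_natCast 2, ← Real.rpow_mul (by norm_num), mul_comm, Real.rpow_mul (by norm_num),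
      Real.rpow_logb (by norm_num) (by norm_num) hκ, Real.rpow_natCast]
  calc κ ^ k = κ⁻¹ * κ ^ (k + 1) := by rw [pow_succ]; field_simp
    _ ≤ _ := by
      rw [h2]
      gcongr

namespace IsTimelikeCurve

variable {A B : ℝ} {a : E} {D : Set ℝ} {F : ℝ → E} {q : ℕ}

/-- As `F x` and `F y` are isotropic, `F y - F x` is orthogonal to `F x + F y`. Its pairing with the
point `F s` is thus minus the mean of its pairings with the chords from `F s` to `F x` and `F y`. -/
lemma bil_increment_point (h : IsTimelikeCurve Q A B a D F) (hQ : HasSignature Q 2 q)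
    {x y l r s : ℝ} (hx : x ∈ D) (hy : y ∈ D) (hl : l ∈ D) (hr : r ∈ D) (hs : s ∈ D)
    (hxy : x ≤ y) (hlx : l ≤ x) (hyr : y ≤ r) (hls : l ≤ s) (hsr : s ≤ r) :
    |bil Q (F y - F x) (F s)| ≤ bil Q (F y - F x) (F r - F l) := by
  have key : ∀ u ∈ D, l ≤ u → u ≤ r →
      |bil Q (F y - F x) (F u - F s)| ≤ bil Q (F y - F x) (F r - F l) := by
    intro u hu hlu hur
    rcases le_total s u with hsu | hsu
    · rw [abs_of_nonneg (h.increments_nonneg hQ hx hy hs hu hxy hsu)]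
      exact h.increments_mono hQ hx hy hl hr hs hu hxy hls hur
    · rw [← neg_sub (F s), map_neg, abs_neg,
        abs_of_nonneg (h.increments_nonneg hQ hx hy hu hs hxy hsu)]
      exact h.increments_mono hQ hx hy hl hr hu hs hxy hlu hsr
  have h1 : bil Q (F y - F x) (F s) =
      -(1 / 2) * (bil Q (F y - F x) (F x - F s) + bil Q (F y - F x) (F y - F s)) := by
    simp only [map_sub, LinearMap.sub_apply, bil_self, h.map_eq x hx, h.map_eq y hy,
      bil_comm (F y) (F x)]
    ring
  have h2 := key x hx hlx (hxy.trans hyr)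
  have h3 := key y hy (hlx.trans hxy) hyr
  rw [h1, abs_mul]
  have h4 := abs_add_le (bil Q (F y - F x) (F x - F s)) (bil Q (F y - F x) (F y - F s))
  have h5 : |(-(1 / 2) : ℝ)| = 1 / 2 := by norm_num
  rw [h5]
  linarith

/-- Hölder estimate for a normalized curve. -/
theorem holder (hQ : HasSignature Q 2 q) (hA : 1 < A) (hB : 1 < B) :
    ∃ M α : ℝ, 0 < M ∧ 0 < α ∧ ∀ (a : E) (D : Set ℝ) (F : ℝ → E), IsTimelikeCurve Q A B a D F →
      (0 : ℝ) ∈ D → (1 : ℝ) ∈ D → bil Q (F 0) (F 1) = -1 →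
      ∀ x ∈ D, ∀ y ∈ D, x ≤ y → -2 ≤ x → y ≤ 2 →
        |bil Q (F y - F x) (F 0)| ≤ M * (y - x) ^ α ∧
        |bil Q (F y - F x) (F 1)| ≤ M * (y - x) ^ α := by
  -- The bound `4` covers the ratio `3` needed for doubling, the ratio `r / 1 < 4`, and `(r - l) / r
  -- < 7 / 3`, for the `l` and `r` chosen below.
  obtain ⟨N, hN⟩ := pow_unbounded_of_one_lt 4 hA
  set κ := B ^ N / (B ^ N + 1) with hκ
  have hK : 0 < B ^ N := by positivity
  have hκ0 : 0 < κ := by positivity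
  have hκ1 : κ < 1 := by rw [hκ, div_lt_one (by positivity)]; linarith
  have hα : 0 < -Real.logb 2 κ := by
    rw [neg_pos]
    exact Real.logb_neg one_lt_two hκ0 hκ1
  refine ⟨κ⁻¹ * (2 * B ^ N * B ^ N), -Real.logb 2 κ, by positivity, hα, ?_⟩
  intro a D F h h0 h1 h01 x hx y hy hxy hx2 hy2
  rcases hxy.lt_or_eq with hxy' | rfl
  swap
  · simp [Real.zero_rpow hα.ne']
  obtain ⟨l, hl, hl1, hl2⟩ := h.exists_mem_Ioo (s := -3) (t := -2) (by norm_num)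
  obtain ⟨r, hr, hr1, hr2⟩ := h.exists_mem_Ioo (s := 3) (t := 4) (by norm_num)
  -- The reference chord is compared with `[0, 1]` in two moves, from `[l, r]` to `[0, r]` and then
  -- to `[0, 1]`, where the pairing is `-1`.
  have hT : bil Q (F r - F l) (F r - F l) ≤ 2 * B ^ N * B ^ N := by
    have e1 := h.bil_le_pow hA hB N h0 h1 hr (by norm_num) (by linarith) (by linarith)
    have e2 := h.reflect.bil_le_pow hA hB N (x := -r) (y := -0) (z := -l) (by simpa using hr)
      (by simpa using h0) (by simpa using hl) (by linarith) (by linarith) (by nlinarith)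
    simp only [neg_neg] at e2
    rw [bil_self, h.map_sub_eq hl hr, bil_comm]
    rw [h01] at e1
    rw [bil_comm (F r) (F 0)] at e2
    have : B ^ N * -bil Q (F 0) (F r) ≤ B ^ N * (B ^ N * - -1) := by gcongr
    linarith
  have hT0 : 0 ≤ bil Q (F r - F l) (F r - F l) := by
    rw [bil_self]
    exact (h.map_sub_pos hl hr (by linarith)).le
  have main : bil Q (F y - F x) (F r - F l) ≤
      κ⁻¹ * (2 * B ^ N * B ^ N) * (y - x) ^ (-Real.logb 2 κ) := by
    rcases le_total (y - x) 1 with hle | hle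
    · obtain ⟨k, hk1, hk2⟩ := rpow_bound_of_dyadic hκ0 (sub_pos.2 hxy') hle
      calc _ ≤ _ := h.increment_le_pow hQ hA hB (by linarith) hl hr k hx hy hxy' (by linarith)
            (by linarith) hk1
        _ ≤ κ⁻¹ * (y - x) ^ (-Real.logb 2 κ) * (2 * B ^ N * B ^ N) := by
          gcongr
          exact hk2 hκ1
        _ = _ := by ring
    · have e1 : 1 ≤ (y - x) ^ (-Real.logb 2 κ) := Real.one_le_rpow hle hα.le
      have e2 : 1 ≤ κ⁻¹ := (one_le_inv₀ hκ0).2 hκ1.le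
      have e3 := h.increments_mono hQ hl hr hl hr hx hy (by linarith) (by linarith) (by linarith)
      rw [bil_comm]
      calc _ ≤ 1 * (2 * B ^ N * B ^ N) * 1 := by linarith
        _ ≤ _ := by gcongr
  exact ⟨(h.bil_increment_point hQ hx hy hl hr h0 hxy (by linarith) (by linarith) (by linarith)
      (by linarith)).trans main, (h.bil_increment_point hQ hx hy hl hr h1 hxy (by linarith)
      (by linarith) (by linarith) (by linarith)).trans main⟩

/-- Every linear functional is controlled by the increments. -/
lemma exists_functional_bound (h : IsTimelikeCurve Q A B a D F) (hQ : HasSignature Q 2 q)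
    {l r : ℝ} (hl : l ∈ D) (hr : r ∈ D) (hlr : l < r) (g : E) :
    ∃ C : ℝ, 0 < C ∧ ∀ x ∈ D, ∀ y ∈ D, x < y → l ≤ x → y ≤ r →
      |bil Q (F y - F x) g| ≤ C * bil Q (F y - F x) (F r - F l) := by
  set e := F r - F l with he
  have hae : bil Q a e = 0 := h.bil_sub hl hr
  have he0 : 0 < Q e := h.map_sub_pos hl hr hlr
  set g' := g + bil Q a g • F l with hg'
  have hag : bil Q a g' = 0 := by simp [hg', h.bil_base l hl]
  -- Large enough for both `k e + g'` and `k e - g'` to be timelike in the half cone of `e`.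
  set k := 1 + (2 * |bil Q e g'| + |Q g'|) / Q e with hk
  have hk1 : 1 ≤ k := by
    rw [hk]
    have : 0 ≤ (2 * |bil Q e g'| + |Q g'|) / Q e := by positivity
    linarith
  have hke : k * Q e = Q e + 2 * |bil Q e g'| + |Q g'| := by
    rw [hk]
    field_simp
    ring
  refine ⟨k + |bil Q a g|, by positivity, fun x hx y hy hxy hlx hyr => ?_⟩
  have hv : 0 < bil Q (F y - F x) e := h.increments_pos hQ hx hy hl hr hxy hlr
  have habs := abs_nonneg (bil Q e g')
  have aux : ∀ w, bil Q a w = 0 → |bil Q e w| = |bil Q e g'| → Q w = Q g' →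
      -bil Q (F y - F x) w ≤ k * bil Q (F y - F x) e := by
    intro w haw hew hqw
    have h1 := neg_abs_le (bil Q e w)
    have h2 := neg_abs_le (Q w)
    rw [hew] at h1
    rw [hqw] at h2
    have h3 : 0 < Q (k • e + w) := by
      rw [map_add_bil, QuadraticMap.map_smul, map_smul, LinearMap.smul_apply, hqw, smul_eq_mul,
        smul_eq_mul]
      have : k * (k * Q e) = k * (Q e + 2 * |bil Q e g'| + |Q g'|) := by rw [hke]
      nlinarith [abs_nonneg (Q g')]
    have h4 : 0 < bil Q (k • e + w) e := by
      simp only [map_add, map_smul, LinearMap.add_apply, LinearMap.smul_apply, smul_eq_mul,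
        bil_self, bil_comm w e]
      have := abs_nonneg (Q g')
      linarith
    have h5 := same_cone_trans hQ h.ne_zero h.map_base (h.bil_sub hx hy)
      (by simp [hae, haw]) hae (h.map_sub_pos hx hy hxy) h3 he0 hv h4
    rw [map_add, map_smul, smul_eq_mul] at h5
    linarith
  have h1 := aux g' hag rfl rfl
  have h2 := aux (-g') (by simp [hag]) (by simp) (by simp)
  have h3 := h.bil_increment_point hQ hx hy hl hr hl hxy.le hlx hyr le_rfl hlr.le
  have h4 : bil Q (F y - F x) g = bil Q (F y - F x) g' - bil Q a g * bil Q (F y - F x) (F l) := by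
    rw [hg', map_add, map_smul, smul_eq_mul]
    ring
  rw [map_neg] at h2
  have h5 : |bil Q (F y - F x) g'| ≤ k * bil Q (F y - F x) e := abs_le.2 ⟨by linarith, by linarith⟩
  calc _ = |bil Q (F y - F x) g' - bil Q a g * bil Q (F y - F x) (F l)| := by rw [h4]
    _ ≤ |bil Q (F y - F x) g'| + |bil Q a g * bil Q (F y - F x) (F l)| := abs_sub _ _
    _ ≤ k * bil Q (F y - F x) e + |bil Q a g| * bil Q (F y - F x) e := by
      rw [abs_mul]
      gcongr
    _ = _ := by ring

/-- Increments near `t` decay geometrically against the reference chord, which dominates every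
functional. The time `t` need not belong to `D`. -/
lemma cauchy_functional (h : IsTimelikeCurve Q A B a D F) (hQ : HasSignature Q 2 q)
    (hA : 1 < A) (hB : 1 < B) (t : ℝ) (g : E) :
    ∃ ℓ, Tendsto (fun x => bil Q (F x) g) (𝓝[D] t) (𝓝 ℓ) := by
  have : (𝓝[D] t).NeBot := mem_closure_iff_nhdsWithin_neBot.1 (h.dense t)
  refine cauchy_map_iff_exists_tendsto.1 ?_
  obtain ⟨l, hl, hl1, hl2⟩ := h.exists_mem_Ioo (s := t - 2) (t := t - 1) (by linarith)
  obtain ⟨r, hr, hr1, hr2⟩ := h.exists_mem_Ioo (s := t + 2) (t := t + 3) (by linarith)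
  obtain ⟨C, hC, hb⟩ := h.exists_functional_bound hQ hl hr (by linarith) g
  obtain ⟨N, hN⟩ := pow_unbounded_of_one_lt 3 hA
  set T := bil Q (F r - F l) (F r - F l) with hT
  have hT0 : 0 < T := by
    rw [hT, bil_self]
    exact h.map_sub_pos hl hr (by linarith)
  rw [Metric.cauchy_iff]
  refine ⟨inferInstance, fun ε hε => ?_⟩
  have hK : 0 < B ^ N := by positivity
  obtain ⟨k, hk⟩ := exists_pow_lt_of_lt_one (x := ε / (C * T)) (by positivity)
    (show B ^ N / (B ^ N + 1) < 1 by rw [div_lt_one (by positivity)]; linarith)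
  -- Two points within `δ` of `t` differ by less than `2δ = 2 ^ (-k)`, the scale at which `k`
  -- halvings apply.
  set δ : ℝ := (2 * 2 ^ k)⁻¹ with hδ
  have hδ0 : 0 < δ := by positivity
  have hδ1 : δ ≤ 1 := by
    rw [hδ]
    refine inv_le_one_of_one_le₀ ?_
    have : (1 : ℝ) ≤ 2 ^ k := one_le_pow₀ (by norm_num)
    linarith
  have main : ∀ x ∈ D, ∀ y ∈ D, x < y → |x - t| < δ → |y - t| < δ →
      |bil Q (F y) g - bil Q (F x) g| < ε := by
    intro x hx y hy hxy hxt hyt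
    rw [abs_lt] at hxt hyt
    rw [← LinearMap.sub_apply, ← map_sub]
    refine (hb x hx y hy hxy (by linarith) (by linarith)).trans_lt ?_
    have h2 : 2 ^ k * (y - x) ≤ 1 := by
      have : (2 : ℝ) ^ k * (y - x) ≤ 2 ^ k * (2 * δ) := by gcongr; linarith
      refine this.trans_eq ?_
      rw [hδ]
      field_simp
    have h1 := h.increment_le_pow hQ hA hB hN hl hr k hx hy hxy (by linarith) (by linarith) h2
    rw [lt_div_iff₀ (by positivity)] at hk
    calc _ ≤ C * _ := mul_le_mul_of_nonneg_left h1 hC.le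
      _ < ε := by linarith
  refine ⟨(fun x => bil Q (F x) g) '' (D ∩ Metric.ball t δ), image_mem_map
    (inter_mem self_mem_nhdsWithin (mem_nhdsWithin_of_mem_nhds (Metric.ball_mem_nhds t hδ0))), ?_⟩
  rintro _ ⟨x, ⟨hx, hxt⟩, rfl⟩ _ ⟨y, ⟨hy, hyt⟩, rfl⟩
  rw [Metric.mem_ball, Real.dist_eq] at hxt hyt
  rw [Real.dist_eq]
  rcases lt_trichotomy x y with hxy | rfl | hxy
  · rw [abs_sub_comm]
    exact main x hx y hy hxy hxt hyt
  · simpa using hε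
  · exact main y hy x hx hxy hyt hxt

end IsTimelikeCurve

/-- The signature exhausts the dimension, so the radical is zero and `Q` identifies `E` with its
dual. -/
lemma HasSignature.exists_bil_eq {p r : ℕ} (hQ : HasSignature Q p r) (hpos : 0 < p + r)
    (φ : E →ₗ[ℝ] ℝ) : ∃ g, ∀ x, bil Q x g = φ x := by
  have := hQ.finiteDimensional hpos
  have h1 := QuadraticForm.sigPos_add_sigNeg_add_radical (Q := Q)
  rw [hQ.1, hQ.2.1, hQ.2.2] at h1
  have h2 : Q.radical = ⊥ := Submodule.finrank_eq_zero.1 (by omega)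
  have hinj : Function.Injective (bil Q) := by
    rw [← LinearMap.ker_eq_bot, Submodule.eq_bot_iff]
    intro x hx
    rw [← Submodule.mem_bot (R := ℝ), ← h2]
    rw [QuadraticMap.mem_radical_iff']
    have hx' : ∀ y, bil Q x y = 0 := fun y => by rw [LinearMap.mem_ker.1 hx]; rfl
    refine ⟨by rw [← bil_self, hx'], fun y => ?_⟩
    rw [map_add_bil, hx', ← bil_self x, hx']
    simp
  have hsurj := (LinearMap.injective_iff_surjective_of_finrank_eq_finrank
    (Subspace.dual_finrank_eq (K := ℝ) (V := E)).symm).1 hinj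
  obtain ⟨g, hg⟩ := hsurj φ
  exact ⟨g, fun x => by rw [bil_comm, hg]⟩

variable [TopologicalSpace E] [IsTopologicalAddGroup E] [ContinuousSMul ℝ E] [T2Space E]

/-- Convergence can be tested on the functionals `⟨·, g⟩`. -/
lemma HasSignature.exists_tendsto {p r : ℕ} (hQ : HasSignature Q p r) (hpos : 0 < p + r)
    {ι : Type*} {f : ι → E} {l : Filter ι}
    (h : ∀ g, ∃ ℓ, Tendsto (fun x => bil Q (f x) g) l (𝓝 ℓ)) : ∃ L, Tendsto f l (𝓝 L) := by
  have := hQ.finiteDimensional hpos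
  let b := Module.finBasis ℝ E
  choose g hg using fun i => hQ.exists_bil_eq hpos (b.coord i)
  choose ℓ hℓ using h
  refine ⟨b.equivFunL.symm (fun i => ℓ (g i)), ?_⟩
  have h1 : Tendsto (fun x => b.equivFunL (f x)) l (𝓝 fun i => ℓ (g i)) := by
    rw [tendsto_pi_nhds]
    intro i
    have := hℓ (g i)
    simp only [hg] at this
    exact this
  have h2 := (b.equivFunL.symm.continuous.tendsto _).comp h1
  refine h2.congr fun x => ?_
  simp

lemma HasSignature.tendsto {p r : ℕ} (hQ : HasSignature Q p r) (hpos : 0 < p + r)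
    {ι : Type*} {f : ι → E} {l : Filter ι} {L : E}
    (h : ∀ g, Tendsto (fun x => bil Q (f x) g) l (𝓝 (bil Q L g))) : Tendsto f l (𝓝 L) := by
  have := hQ.finiteDimensional hpos
  let b := Module.finBasis ℝ E
  choose g hg using fun i => hQ.exists_bil_eq hpos (b.coord i)
  have h1 : Tendsto (fun x => b.equivFunL (f x)) l (𝓝 (b.equivFunL L)) := by
    rw [tendsto_pi_nhds]
    intro i
    have := h (g i)
    simp only [hg] at this
    exact this
  have h2 := (b.equivFunL.symm.continuous.tendsto _).comp h1
  rw [ContinuousLinearEquiv.symm_apply_apply] at h2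
  refine h2.congr fun x => ?_
  simp

end Curve

end

end QSEinstein

/-! ### Topology of real projective spaces. -/

namespace QSEinstein

noncomputable section

section ProjectiveTopology

open Filter Topology

variable {M : Type*} [AddCommGroup M] [Module ℝ M]

/-- The choice `rep` is not continuous, but rescaling it by a functional cancels the choice and
gives an affine chart. -/
lemma smul_inv_smul_rep (φ : M →ₗ[ℝ] ℝ) (v : M) (hv : v ≠ 0) :
    (φ (Projectivization.mk ℝ v hv).rep)⁻¹ • (Projectivization.mk ℝ v hv).rep =
      (φ v)⁻¹ • v := by
  obtain ⟨a, ha⟩ := Projectivization.exists_smul_eq_mk_rep ℝ v hv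
  rw [← ha, Units.smul_def, map_smul, smul_smul, smul_eq_mul, mul_inv, mul_right_comm,
    inv_mul_cancel₀ a.ne_zero, one_mul]

variable [TopologicalSpace M] [ContinuousSMul ℝ M]

lemma isOpenQuotientMap_mk' :
    IsOpenQuotientMap (Projectivization.mk' ℝ : {v : M // v ≠ 0} → ℙ ℝ M) := by
  have hq : IsQuotientMap (Projectivization.mk' ℝ : {v : M // v ≠ 0} → ℙ ℝ M) :=
    ⟨⟨rfl⟩, fun x => ⟨⟨x.rep, x.rep_nonzero⟩, x.mk_rep⟩⟩
  refine .of_isOpenMap_isQuotientMap (fun U hU => ?_) hq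
  rw [← hq.isOpen_preimage]
  have hsm : ∀ t : ℝˣ, Continuous fun v : {v : M // v ≠ 0} =>
      (⟨t • (v : M), (smul_ne_zero_iff_ne t).2 v.2⟩ : {v : M // v ≠ 0}) := fun t =>
    (continuous_subtype_val.const_smul (t : ℝ)).subtype_mk _
  -- The saturation of `U` is the union of its dilates, each of which is open.
  have : Projectivization.mk' ℝ ⁻¹' (Projectivization.mk' ℝ '' U) =
      ⋃ t : ℝˣ, (fun v : {v : M // v ≠ 0} =>
        (⟨t • (v : M), (smul_ne_zero_iff_ne t).2 v.2⟩ : {v : M // v ≠ 0})) ⁻¹' U := by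
    ext v
    simp only [Set.mem_preimage, Set.mem_image, Set.mem_iUnion]
    constructor
    · rintro ⟨w, hw, hwv⟩
      obtain ⟨t, ht⟩ := (Projectivization.mk_eq_mk_iff ℝ _ _ w.2 v.2).1 hwv
      refine ⟨t, ?_⟩
      convert hw
    · rintro ⟨t, ht⟩
      exact ⟨_, ht, (Projectivization.mk_eq_mk_iff ℝ _ _ _ v.2).2 ⟨t, rfl⟩⟩
  rw [this]
  exact isOpen_iUnion fun t => hU.preimage (hsm t)

lemma tendsto_mk {ι : Type*} {l : Filter ι} {f : ι → M} {v : M} (hv : v ≠ 0)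
    (hf : Tendsto f l (𝓝 v)) {g : ι → ℙ ℝ M}
    (hfg : ∀ᶠ i in l, ∃ h : f i ≠ 0, Projectivization.mk ℝ (f i) h = g i) :
    Tendsto g l (𝓝 (Projectivization.mk ℝ v hv)) := by
  classical
  -- The default `v` is harmless, as `f i` is eventually nonzero.
  set f' : ι → {v : M // v ≠ 0} := fun i => if h : f i ≠ 0 then ⟨f i, h⟩ else ⟨v, hv⟩ with hf'
  have h1 : Tendsto f' l (𝓝 ⟨v, hv⟩) := by
    rw [tendsto_subtype_rng]
    refine hf.congr' ?_
    filter_upwards [hfg] with i hi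
    obtain ⟨h, -⟩ := hi
    simp [hf', h]
  have h2 := ((isOpenQuotientMap_mk' (M := M)).continuous.tendsto ⟨v, hv⟩).comp h1
  refine h2.congr' ?_
  filter_upwards [hfg] with i hi
  obtain ⟨h, hi⟩ := hi
  simp [hf', h, hi]

variable [IsTopologicalAddGroup M] [T2Space M] [FiniteDimensional ℝ M]

lemma continuousAt_normalized (φ : M →ₗ[ℝ] ℝ) (x : ℙ ℝ M) (hx : φ x.rep ≠ 0) :
    ContinuousAt (fun y : ℙ ℝ M => (φ y.rep)⁻¹ • y.rep) x := by
  have hφ : Continuous φ := φ.continuous_of_finiteDimensional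
  have h := (isOpenQuotientMap_mk' (M := M)).continuousAt_comp_iff
    (g := fun y : ℙ ℝ M => (φ y.rep)⁻¹ • y.rep) (x := ⟨x.rep, x.rep_nonzero⟩)
  rw [Projectivization.mk'_eq_mk] at h
  simp only [Projectivization.mk_rep] at h
  rw [← h]
  have : ((fun y : ℙ ℝ M => (φ y.rep)⁻¹ • y.rep) ∘ Projectivization.mk' ℝ) =
      fun v : {v : M // v ≠ 0} => (φ v)⁻¹ • (v : M) := by
    ext v
    exact smul_inv_smul_rep φ v v.2
  rw [this]
  have h1 : ContinuousAt (fun v : {v : M // v ≠ 0} => φ v) ⟨x.rep, x.rep_nonzero⟩ :=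
    (hφ.comp continuous_subtype_val).continuousAt
  exact (h1.inv₀ hx).smul continuous_subtype_val.continuousAt

/-- A choice of representatives which is continuous at a given point. -/
lemma exists_continuousAt_lift (x : ℙ ℝ M) :
    ∃ s : ℙ ℝ M → M, ContinuousAt s x ∧ s x = x.rep ∧ ∀ y, ∃ c : ℝ, s y = c • y.rep := by
  obtain ⟨φ, hφ⟩ : ∃ φ : M →ₗ[ℝ] ℝ, φ x.rep ≠ 0 := by
    by_contra! h
    exact x.rep_nonzero ((Module.forall_dual_apply_eq_zero_iff ℝ x.rep).1 h)
  refine ⟨fun y => φ x.rep • ((φ y.rep)⁻¹ • y.rep),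
    (continuousAt_normalized φ x hφ).const_smul _, ?_, fun y => ⟨φ x.rep * (φ y.rep)⁻¹, ?_⟩⟩
  · simp only [smul_smul, mul_inv_cancel₀ hφ, one_smul]
  · simp only [smul_smul]

/-- A line is recovered from the normalized matrix `v vᵀ / |v|²`, which depends continuously on it
and not on `v`. -/
instance : T2Space (ℙ ℝ M) := by
  let b := Module.finBasis ℝ M
  let g : M → (Fin (Module.finrank ℝ M) × Fin (Module.finrank ℝ M)) → ℝ := fun v ij =>
    b.coord ij.1 v * b.coord ij.2 v / ∑ k, b.coord k v ^ 2
  have hsum : ∀ v : M, v ≠ 0 → 0 < ∑ k, b.coord k v ^ 2 := by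
    intro v hv
    refine (Finset.sum_nonneg fun k _ => sq_nonneg _).lt_of_ne fun h => hv ?_
    rw [eq_comm, Finset.sum_eq_zero_iff_of_nonneg (fun k _ => sq_nonneg _)] at h
    refine b.forall_coord_eq_zero_iff.1 fun k => ?_
    exact pow_eq_zero_iff (two_ne_zero) |>.1 (h k (Finset.mem_univ k))
  have hg : ∀ (v : M) (t : ℝ), t ≠ 0 → g (t • v) = g v := by
    intro v t ht
    ext ij
    simp only [g, map_smul, smul_eq_mul, mul_pow, ← Finset.mul_sum]
    rw [mul_mul_mul_comm, ← sq, mul_div_mul_left _ _ (pow_ne_zero 2 ht)]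
  have hcont : Continuous fun x : ℙ ℝ M => g x.rep := by
    rw [← (isOpenQuotientMap_mk' (M := M)).continuous_comp_iff]
    have : ((fun x : ℙ ℝ M => g x.rep) ∘ Projectivization.mk' ℝ) =
        fun v : {v : M // v ≠ 0} => g v := by
      funext v
      obtain ⟨a, ha⟩ := Projectivization.exists_smul_eq_mk_rep ℝ (v : M) v.2
      simp only [Function.comp, Projectivization.mk'_eq_mk, ← ha, Units.smul_def]
      exact hg _ _ a.ne_zero
    rw [this]
    have hc : ∀ k, Continuous fun v : {v : M // v ≠ 0} => b.coord k v := fun k =>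
      ((b.coord k).continuous_of_finiteDimensional).comp continuous_subtype_val
    refine continuous_pi fun ij => ?_
    refine ((hc ij.1).mul (hc ij.2)).div (continuous_finsetSum _ fun k _ => (hc k).pow 2)
      fun v => (hsum v v.2).ne'
  refine T2Space.of_injective_continuous (f := fun x : ℙ ℝ M => g x.rep) (fun x y hxy => ?_) hcont
  rw [← x.mk_rep, ← y.mk_rep, Projectivization.mk_eq_mk_iff']
  have hx := hsum x.rep x.rep_nonzero
  have hy := hsum y.rep y.rep_nonzero
  obtain ⟨j, hj⟩ : ∃ j, b.coord j x.rep ≠ 0 := by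
    by_contra! h
    exact x.rep_nonzero (b.forall_coord_eq_zero_iff.1 h)
  have hxy' : ∀ i k, b.coord i x.rep * b.coord k x.rep * ∑ k, b.coord k y.rep ^ 2 =
      b.coord i y.rep * b.coord k y.rep * ∑ k, b.coord k x.rep ^ 2 := by
    intro i k
    have := congr_fun hxy (i, k)
    simp only [g] at this
    rwa [div_eq_div_iff hx.ne' hy.ne'] at this
  refine ⟨b.coord j y.rep * (∑ k, b.coord k x.rep ^ 2) /
    (b.coord j x.rep * ∑ k, b.coord k y.rep ^ 2), ?_⟩
  refine b.ext_elem fun i => ?_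
  have := hxy' i j
  simp only [Module.Basis.coord_apply] at *
  rw [map_smul, Finsupp.smul_apply, smul_eq_mul]
  field_simp
  linarith

/-- The unit sphere of coordinates surjects onto the projective space. Together with separation,
this yields the regularity required by `continuous_extendFrom`. -/
instance : CompactSpace (ℙ ℝ M) := by
  let b := (Module.finBasis ℝ M).equivFunL
  have hK : IsCompact (b.toHomeomorph ⁻¹' Metric.sphere 0 1) :=
    b.toHomeomorph.isCompact_preimage.2 (isCompact_sphere _ _)
  have hK0 : ∀ v ∈ b.toHomeomorph ⁻¹' Metric.sphere 0 1, v ≠ 0 := by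
    rintro v hv rfl
    simp at hv
  have hK' : IsCompact ((Subtype.val : {v : M // v ≠ 0} → M) ⁻¹'
      (b.toHomeomorph ⁻¹' Metric.sphere 0 1)) := by
    refine IsInducing.subtypeVal.isCompact_preimage_iff (fun v hv => ?_) |>.2 hK
    exact ⟨⟨v, hK0 v hv⟩, rfl⟩
  refine ⟨?_⟩
  convert hK'.image (isOpenQuotientMap_mk' (M := M)).continuous
  symm
  rw [Set.eq_univ_iff_forall]
  intro x
  have hb : b x.rep ≠ 0 := by simpa using x.rep_nonzero
  have hn : 0 < ‖b x.rep‖ := norm_pos_iff.2 hb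
  refine ⟨⟨‖b x.rep‖⁻¹ • x.rep, smul_ne_zero (by positivity) x.rep_nonzero⟩, ?_, ?_⟩
  · simp only [Set.mem_preimage, mem_sphere_zero_iff_norm]
    change ‖b (‖b x.rep‖⁻¹ • x.rep)‖ = 1
    rw [map_smul, norm_smul, norm_inv, norm_norm, inv_mul_cancel₀ hn.ne']
  · rw [Projectivization.mk'_eq_mk]
    conv_rhs => rw [← x.mk_rep]
    rw [Projectivization.mk_eq_mk_iff']
    exact ⟨‖b x.rep‖⁻¹, rfl⟩

end ProjectiveTopology

end

end QSEinstein

/-! ### Separation on the projective line, positivity in the Einstein universe, and the reverse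
Ptolemy inequality. -/

namespace QSEinstein

noncomputable section

open Filter Topology

section Area

variable {V : Type*} [AddCommGroup V] [Module ℝ V]

lemma update_pair_zero {α : Type*} (v w u : α) : Function.update ![v, w] 0 u = ![u, w] := by
  ext i
  fin_cases i <;> rfl

lemma update_pair_one {α : Type*} (v w u : α) : Function.update ![v, w] 1 u = ![v, u] := by
  ext i
  fin_cases i <;> rfl

/-- The area form as a bilinear map. -/
def area (ω : V [⋀^Fin 2]→ₗ[ℝ] ℝ) : V →ₗ[ℝ] V →ₗ[ℝ] ℝ :=
  LinearMap.mk₂ ℝ (fun v w => ω ![v, w])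
    (fun v v' w => by
      have := ω.map_update_add ![v, w] 0 v v'
      rwa [update_pair_zero, update_pair_zero, update_pair_zero] at this)
    (fun t v w => by
      have := ω.map_update_smul ![v, w] 0 t v
      rwa [update_pair_zero, update_pair_zero] at this)
    (fun v w w' => by
      have := ω.map_update_add ![v, w] 1 w w'
      rwa [update_pair_one, update_pair_one, update_pair_one] at this)
    (fun t v w => by
      have := ω.map_update_smul ![v, w] 1 t w
      rwa [update_pair_one, update_pair_one] at this)

variable {ω : V [⋀^Fin 2]→ₗ[ℝ] ℝ}

lemma area_apply (v w : V) : ω ![v, w] = area ω v w := rfl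

@[simp] lemma area_self (v : V) : area ω v v = 0 :=
  ω.map_eq_zero_of_eq ![v, v] (i := 0) (j := 1) rfl (by decide)

lemma area_swap (v w : V) : area ω v w = -area ω w v := by
  have := area_self (ω := ω) (v + w)
  simp only [map_add, LinearMap.add_apply, area_self] at this
  linarith

lemma linearIndependent_of_area_ne_zero {v w : V} (h : area ω v w ≠ 0) :
    LinearIndependent ℝ ![v, w] := by
  refine LinearIndependent.pair_iff.2 fun s t hst => ?_
  have h1 : area ω (s • v + t • w) w = 0 := by rw [hst]; simp
  have h2 : area ω v (s • v + t • w) = 0 := by rw [hst]; simp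
  simp only [map_add, map_smul, LinearMap.add_apply, LinearMap.smul_apply, area_self, smul_eq_mul,
    mul_zero, add_zero, zero_add] at h1 h2
  exact ⟨(mul_eq_zero.1 h1).resolve_right h, (mul_eq_zero.1 h2).resolve_right h⟩

lemma eq_smul_add_smul_of_area (hV : Module.finrank ℝ V = 2) {a b : V} (h : area ω a b ≠ 0)
    (c : V) : c = (area ω c b / area ω a b) • a + (area ω a c / area ω a b) • b := by
  have : FiniteDimensional ℝ V := .of_finrank_pos (by omega)
  have hli := linearIndependent_of_area_ne_zero h
  have hspan := hli.span_eq_top_of_card_eq_finrank' (by rw [hV, Fintype.card_fin])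
  have hc : c ∈ Submodule.span ℝ (Set.range ![a, b]) := by rw [hspan]; trivial
  rw [Matrix.range_cons, Matrix.range_cons, Matrix.range_empty, Set.union_empty,
    Set.singleton_union, Submodule.mem_span_pair] at hc
  obtain ⟨r, s, rfl⟩ := hc
  simp [h]

lemma area_rep_ne_zero (hV : Module.finrank ℝ V = 2) (hω : ω ≠ 0) {x y : ℙ ℝ V} (hxy : x ≠ y) :
    area ω x.rep y.rep ≠ 0 := by
  have hli : LinearIndependent ℝ ![x.rep, y.rep] := by
    rw [LinearIndependent.pair_iff' x.rep_nonzero]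
    intro t ht
    apply hxy
    rw [← x.mk_rep, ← y.mk_rep, eq_comm, Projectivization.mk_eq_mk_iff']
    exact ⟨t, ht⟩
  let b := basisOfLinearIndependentOfCardEqFinrank hli (by rw [hV, Fintype.card_fin])
  have := (ω.map_basis_ne_zero_iff b).2 hω
  rwa [coe_basisOfLinearIndependentOfCardEqFinrank] at this

lemma area_rep_eq_zero_iff (hV : Module.finrank ℝ V = 2) (hω : ω ≠ 0) {x y : ℙ ℝ V} :
    area ω x.rep y.rep = 0 ↔ x = y := by
  refine ⟨fun h => ?_, fun h => by simp [h]⟩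
  by_contra hxy
  exact area_rep_ne_zero hV hω hxy h

lemma exists_rep_eq_smul (v : V) (hv : v ≠ 0) :
    ∃ a : ℝ, a ≠ 0 ∧ (Projectivization.mk ℝ v hv).rep = a • v := by
  obtain ⟨a, ha⟩ := Projectivization.exists_smul_eq_mk_rep ℝ v hv
  exact ⟨a, a.ne_zero, ha.symm⟩

/-- The pairs `{w, y}` and `{x, z}` separate each other on the projective line. -/
def Separated (ω : V [⋀^Fin 2]→ₗ[ℝ] ℝ) (w x y z : ℙ ℝ V) : Prop :=
  area ω w.rep x.rep * area ω y.rep x.rep * (area ω w.rep z.rep * area ω y.rep z.rep) < 0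

lemma Separated.ne {w x y z : ℙ ℝ V} (h : Separated ω w x y z) :
    w ≠ x ∧ x ≠ y ∧ w ≠ z ∧ y ≠ z ∧ w ≠ y ∧ x ≠ z := by
  unfold Separated at h
  refine ⟨?_, ?_, ?_, ?_, ?_, ?_⟩
  · rintro rfl; simp at h
  · rintro rfl; simp at h
  · rintro rfl; simp at h
  · rintro rfl; simp at h
  · rintro rfl
    nlinarith [mul_nonneg (mul_self_nonneg (area ω w.rep x.rep))
      (mul_self_nonneg (area ω w.rep z.rep))]
  · rintro rfl
    nlinarith [mul_self_nonneg (area ω w.rep x.rep * area ω y.rep x.rep)]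

variable [TopologicalSpace V] [ContinuousSMul ℝ V]

lemma isOpen_of_homogeneous {f : V → ℝ} (hf : Continuous f)
    (hs : ∀ (t : ℝ) (v : V), f (t • v) = t ^ 2 * f v) : IsOpen {u : ℙ ℝ V | 0 < f u.rep} := by
  rw [← (isOpenQuotientMap_mk' (M := V)).isQuotientMap.isOpen_preimage]
  have : Projectivization.mk' ℝ ⁻¹' {u : ℙ ℝ V | 0 < f u.rep} =
      {v : {v : V // v ≠ 0} | 0 < f v} := by
    ext v
    obtain ⟨a, ha, h⟩ := exists_rep_eq_smul (v : V) v.2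
    simp only [Set.mem_preimage, Set.mem_ofPred_eq, Projectivization.mk'_eq_mk, h, hs]
    exact mul_pos_iff_of_pos_left (by positivity)
  rw [this]
  exact isOpen_lt continuous_const (hf.comp continuous_subtype_val)

variable [IsTopologicalAddGroup V] [T2Space V]

lemma isOpen_area_mul_pos (hV : Module.finrank ℝ V = 2) (v w : V) :
    IsOpen {u : ℙ ℝ V | 0 < area ω v u.rep * area ω w u.rep} := by
  have : FiniteDimensional ℝ V := .of_finrank_pos (by omega)
  refine isOpen_of_homogeneous (f := fun u => area ω v u * area ω w u) ?_ fun t u => ?_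
  · exact ((area ω v).continuous_of_finiteDimensional).mul
      ((area ω w).continuous_of_finiteDimensional)
  · simp only [map_smul, smul_eq_mul]
    ring

lemma isOpen_area_mul_neg (hV : Module.finrank ℝ V = 2) (v w : V) :
    IsOpen {u : ℙ ℝ V | area ω v u.rep * area ω w u.rep < 0} := by
  have := isOpen_area_mul_pos (ω := ω) hV (-v) w
  simpa using this

/-- The sign of `ω(w, u) ω(y, u)` depends only on the line of `u` and vanishes only at `w` and `y`,
so it is constant on each component of the complement. -/
lemma Separated.isPositiveQuadrupleLine (hV : Module.finrank ℝ V = 2) (hω : ω ≠ 0)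
    {w x y z : ℙ ℝ V} (h : Separated ω w x y z) : IsPositiveQuadrupleLine w x y z := by
  obtain ⟨hwx, hyx, hwz, hyz, hwy, hxz⟩ := h.ne
  unfold Separated at h
  refine ⟨by simp [hwx, hwy, hwz, hyx, hxz, hyz], fun heq => ?_⟩
  have hz : z ∈ connectedComponentIn ({w, y}ᶜ : Set (ℙ ℝ V)) x := by
    rw [heq]
    exact mem_connectedComponentIn (by simp [hwz.symm, hyz.symm])
  have hx : x ∈ connectedComponentIn ({w, y}ᶜ : Set (ℙ ℝ V)) x :=
    mem_connectedComponentIn (by simp [hwx.symm, hyx])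
  have hcover : connectedComponentIn ({w, y}ᶜ : Set (ℙ ℝ V)) x ⊆
      {u | 0 < area ω w.rep u.rep * area ω y.rep u.rep} ∪
      {u | area ω w.rep u.rep * area ω y.rep u.rep < 0} := by
    intro u hu
    have hu' := connectedComponentIn_subset _ _ hu
    simp only [Set.mem_compl_iff, Set.mem_insert_iff, Set.mem_singleton_iff, not_or] at hu'
    have h1 := area_rep_ne_zero hV hω (Ne.symm hu'.1)
    have h2 := area_rep_ne_zero hV hω (Ne.symm hu'.2)
    exact (mul_ne_zero h1 h2).lt_or_gt.symm
  have hdisj : Disjoint {u : ℙ ℝ V | 0 < area ω w.rep u.rep * area ω y.rep u.rep}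
      {u | area ω w.rep u.rep * area ω y.rep u.rep < 0} := by
    rw [Set.disjoint_left]
    intro u hu hu'
    exact lt_asymm (a := (0 : ℝ)) hu hu'
  rcases isPreconnected_connectedComponentIn.subset_or_subset (isOpen_area_mul_pos hV _ _)
    (isOpen_area_mul_neg hV _ _) hdisj hcover with hs | hs
  · have h1 := hs hx
    have h2 := hs hz
    simp only [Set.mem_ofPred_eq] at h1 h2
    nlinarith [mul_pos h1 h2]
  · have h1 := hs hx
    have h2 := hs hz
    simp only [Set.mem_ofPred_eq] at h1 h2
    nlinarith [mul_pos_of_neg_of_neg h1 h2]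

/-- Given two points, a dense set meets the arcs which separate a third point from them. -/
lemma exists_separated (hV : Module.finrank ℝ V = 2) (hω : ω ≠ 0) {Ω : Set (ℙ ℝ V)}
    (hΩ : Dense Ω) {w x y : ℙ ℝ V} (hwx : w ≠ x) (hxy : x ≠ y) (hwy : w ≠ y) :
    ∃ z ∈ Ω, Separated ω w x y z := by
  have h1 := area_rep_ne_zero hV hω hwx
  have h2 := area_rep_ne_zero hV hω hxy.symm
  have h3 := area_rep_ne_zero hV hω hwy
  set k := area ω w.rep x.rep * area ω y.rep x.rep with hk
  have hk0 : k ≠ 0 := mul_ne_zero h1 h2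
  have hopen : IsOpen {z : ℙ ℝ V | Separated ω w x y z} := by
    have := isOpen_area_mul_neg (ω := ω) hV (k • w.rep) y.rep
    simpa [Separated, ← hk, mul_assoc] using this
  -- The lines of `w + k y`, for `k` of a fixed sign, fill one of the two arcs; the sign of this `k`
  -- selects the arc not containing `x`.
  have hne : w.rep + k • y.rep ≠ 0 := by
    intro h0
    have : area ω (w.rep + k • y.rep) y.rep = 0 := by rw [h0]; simp
    simp [h3] at this
  obtain ⟨c, hc, hrep⟩ := exists_rep_eq_smul _ hne
  have hmem : Projectivization.mk ℝ (w.rep + k • y.rep) hne ∈ {z | Separated ω w x y z} := by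
    simp only [Separated, Set.mem_ofPred_eq, hrep, map_smul, map_add, area_self, smul_eq_mul,
      ← hk, area_swap y.rep w.rep]
    have : k * (c * (0 + k * area ω w.rep y.rep) * (c * (-area ω w.rep y.rep + k * 0))) =
      -(k * c * area ω w.rep y.rep) ^ 2 := by ring
    rw [this]
    have : 0 < (k * c * area ω w.rep y.rep) ^ 2 := by positivity
    linarith
  obtain ⟨z, hz, hz'⟩ := hΩ.inter_open_nonempty _ hopen ⟨_, hmem⟩
  exact ⟨z, hz', hz⟩

end Area

section Einstein

variable {E : Type*} [AddCommGroup E] [Module ℝ E] {Q : QuadraticForm ℝ E}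

lemma tripleSpan_eq (a b c : EinsteinUniverse Q) :
    tripleSpan Q a b c = Submodule.span ℝ (Set.range ![a.1.rep, b.1.rep, c.1.rep]) := by
  rw [tripleSpan, Projectivization.submodule_eq, Projectivization.submodule_eq,
    Projectivization.submodule_eq, Matrix.range_cons, Matrix.range_cons, Matrix.range_cons,
    Matrix.range_empty, Set.union_empty, Submodule.span_union, Submodule.span_union, sup_assoc]

lemma pairing_self (a : EinsteinUniverse Q) : pairing Q a a = 0 := by
  rw [pairing, bil_self, a.2]

lemma pairing_comm (a b : EinsteinUniverse Q) : pairing Q a b = pairing Q b a :=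
  bil_comm _ _

/-- Each representative occurs twice in the product, so the sign is independent of choices. From
here on positivity is used in this form only. -/
lemma isPositiveTriple_iff (a b c : EinsteinUniverse Q) :
    IsPositiveTriple Q a b c ↔ pairing Q a b * pairing Q b c * pairing Q c a < 0 := by
  unfold IsPositiveTriple
  rw [tripleSpan_eq]
  constructor
  · rintro ⟨-, -, -, h⟩
    exact triple_product_neg a.2 b.2 c.2 h
  · intro h
    refine ⟨?_, ?_, ?_, hasSignature_span_of_triple_product_neg a.2 b.2 c.2 h⟩
    · rintro rfl; simp [pairing_self] at h
    · rintro rfl; simp [pairing_self] at h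
    · rintro rfl; simp [pairing_self] at h

/-- The point of the Einstein universe spanned by an isotropic vector. -/
def toEinstein (v : E) (hv : v ≠ 0) (hq : Q v = 0) : EinsteinUniverse Q :=
  ⟨Projectivization.mk ℝ v hv, by
    obtain ⟨a, -, h⟩ := exists_rep_eq_smul v hv
    rw [h, QuadraticMap.map_smul, hq, smul_zero]⟩

lemma toEinstein_eq {v : E} (hv : v ≠ 0) (hq : Q v = 0) {x : EinsteinUniverse Q} {c : ℝ}
    (h : v = c • x.1.rep) : toEinstein v hv hq = x := by
  ext
  conv_rhs => rw [← x.1.mk_rep]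
  rw [toEinstein, Projectivization.mk_eq_mk_iff']
  exact ⟨c, h.symm⟩

variable [TopologicalSpace E] [IsTopologicalAddGroup E] [ContinuousSMul ℝ E]

/-- Two points whose differences with `c` lie in the same half of the cone belong to the same
diamond. -/
lemma diamond_eq {a c b d : EinsteinUniverse Q} {c' b' d' : E} {β γ δ : ℝ}
    (hb : b' = β • b.1.rep) (hc : c' = γ • c.1.rep) (hd : d' = δ • d.1.rep) (hγ : γ ≠ 0)
    (hab : bil Q a.1.rep b' = -1) (hac : bil Q a.1.rep c' = -1) (had : bil Q a.1.rep d' = -1)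
    (hbc : bil Q b' c' < 0) (hcd : bil Q c' d' < 0) (hpos : 0 < bil Q (b' - c') (d' - c')) :
    diamond Q a c b = diamond Q a c d := by
  have qb : Q b' = 0 := by rw [hb, QuadraticMap.map_smul, b.2, smul_zero]
  have qc : Q c' = 0 := by rw [hc, QuadraticMap.map_smul, c.2, smul_zero]
  have qd : Q d' = 0 := by rw [hd, QuadraticMap.map_smul, d.2, smul_zero]
  set u := bil Q b' c' with hu
  set w := bil Q c' d' with hw
  set m := bil Q (b' - c') (d' - c') with hm
  have hm' : m = bil Q b' d' - u - w := by
    rw [hm, hu, hw]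
    simp only [map_sub, LinearMap.sub_apply, bil_self, qc]
    ring
  -- The path joins `b' - c'` to `d' - c'` by a segment in the convex half cone; `q t` is the square
  -- of its vector. The multiple `κ t` of `a` restores isotropy, and `⟨c', X t⟩ = -q t / 2 < 0`
  -- keeps the triple positive.
  let q : ℝ → ℝ := fun t => -2 * (1 - t) ^ 2 * u + 2 * t * (1 - t) * m - 2 * t ^ 2 * w
  let κ : ℝ → ℝ := fun t => (1 - t) * u + t * w + q t / 2
  let X : ℝ → E := fun t => c' + ((1 - t) • (b' - c') + t • (d' - c')) + κ t • a.1.rep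
  have hcb : bil Q c' b' = u := by rw [bil_comm]
  have hdc : bil Q d' c' = w := by rw [bil_comm]
  have hba : bil Q b' a.1.rep = -1 := by rw [bil_comm, hab]
  have hca : bil Q c' a.1.rep = -1 := by rw [bil_comm, hac]
  have hda : bil Q d' a.1.rep = -1 := by rw [bil_comm, had]
  have hbd : bil Q b' d' = m + u + w := by linarith
  have hdb : bil Q d' b' = m + u + w := by rw [bil_comm, hbd]
  have haa : bil Q a.1.rep a.1.rep = 0 := by rw [bil_self, a.2]
  have hQX : ∀ t, Q (X t) = 0 := by
    intro t
    rw [← bil_self]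
    simp only [X, κ, q, map_add, map_sub, map_smul, LinearMap.add_apply, LinearMap.sub_apply,
      LinearMap.smul_apply, smul_eq_mul, hcb, hdc, hba, hca, hda, hbd, hdb, hab, hac, had, haa,
      bil_self, qb, qc, qd, ← hu, ← hw]
    ring
  have haX : ∀ t, bil Q a.1.rep (X t) = -1 := by
    intro t
    simp only [X, map_add, map_sub, map_smul, smul_eq_mul, hab, hac, had, haa]
    ring
  have hXc : ∀ t, bil Q c' (X t) = -(q t / 2) := by
    intro t
    simp only [X, κ, map_add, map_sub, map_smul, smul_eq_mul, hcb, hca, bil_self, qc, ← hw]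
    ring
  have hX0 : ∀ t, X t ≠ 0 := by
    intro t h0
    have := haX t
    rw [h0, map_zero] at this
    norm_num at this
  have hq : ∀ t ∈ Set.Icc (0 : ℝ) 1, 0 < q t := by
    rintro t ⟨h0, h1⟩
    simp only [q]
    have e1 : 0 ≤ (1 - t) ^ 2 * (-u) := mul_nonneg (sq_nonneg _) (by linarith)
    have e2 : 0 ≤ t * (1 - t) * m := mul_nonneg (mul_nonneg h0 (by linarith)) hpos.le
    have e3 : 0 ≤ t ^ 2 * (-w) := mul_nonneg (sq_nonneg _) (by linarith)
    rcases h0.lt_or_eq with h0 | rfl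
    · have e3 : 0 < t ^ 2 * (-w) := mul_pos (by positivity) (by linarith)
      linarith
    · norm_num
      linarith
  let g : ℝ → EinsteinUniverse Q := fun t => toEinstein (X t) (hX0 t) (hQX t)
  have hg : Continuous g := by
    refine Continuous.subtype_mk ?_ _
    exact (isOpenQuotientMap_mk' (M := E)).continuous.comp
      (Continuous.subtype_mk (by fun_prop : Continuous X) hX0)
  have hpre : IsPreconnected (g '' Set.Icc 0 1) := isPreconnected_Icc.image _ hg.continuousOn
  have hsub : g '' Set.Icc 0 1 ⊆ {x | IsPositiveTriple Q a c x} := by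
    rintro _ ⟨t, ht, rfl⟩
    simp only [Set.mem_ofPred_eq, isPositiveTriple_iff]
    obtain ⟨s, hs, hrep⟩ := exists_rep_eq_smul (X t) (hX0 t)
    have h1 : pairing Q a c = -γ⁻¹ := by
      rw [pairing]
      rw [hc, map_smul, smul_eq_mul] at hac
      field_simp
      linarith
    have h2 : pairing Q c (g t) = γ⁻¹ * s * -(q t / 2) := by
      rw [pairing, ← hXc, hc]
      simp only [g, toEinstein, hrep, map_smul, LinearMap.smul_apply, smul_eq_mul]
      field_simp
    have h3 : pairing Q (g t) a = -s := by
      rw [pairing, bil_comm]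
      simp only [g, toEinstein, hrep, map_smul, smul_eq_mul, haX]
      ring
    rw [h1, h2, h3]
    have := hq t ht
    have : 0 < (γ⁻¹ * s) ^ 2 * (q t / 2) := by positivity
    linarith
  have h0 : g 0 = b := toEinstein_eq _ _ (c := β) (by
    have : κ 0 = 0 := by simp only [κ, q]; ring
    simp [X, this, hb])
  have h1 : g 1 = d := toEinstein_eq _ _ (c := δ) (by
    have : κ 1 = 0 := by simp only [κ, q]; ring
    simp [X, this, hd])
  refine connectedComponentIn_eq ?_
  refine hpre.subset_connectedComponentIn ?_ hsub ?_
  · exact ⟨0, by simp, h0⟩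
  · exact ⟨1, by simp, h1⟩

/-- The reverse Ptolemy inequality for positive quadruples. -/
lemma IsPositiveQuadruple.ptolemy {a b c d : EinsteinUniverse Q}
    (h : IsPositiveQuadruple Q a b c d) :
    |pairing Q a b| * |pairing Q c d| + |pairing Q a d| * |pairing Q b c| ≤
      |pairing Q a c| * |pairing Q b d| := by
  obtain ⟨habc, habd, hacd, hbcd, hne⟩ := h
  rw [isPositiveTriple_iff] at habc habd hacd hbcd
  have hab : pairing Q a b ≠ 0 := by intro h0; simp [h0] at habc
  have hac : pairing Q a c ≠ 0 := by intro h0; simp [h0] at hacd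
  have had : pairing Q a d ≠ 0 := by rw [pairing_comm]; intro h0; simp [h0] at hacd
  set β := -(pairing Q a b)⁻¹ with hβ
  set γ := -(pairing Q a c)⁻¹ with hγ
  set δ := -(pairing Q a d)⁻¹ with hδ
  have key : ∀ {x y : EinsteinUniverse Q}, pairing Q a x * pairing Q x y * pairing Q y a < 0 →
      bil Q (-(pairing Q a x)⁻¹ • x.1.rep) (-(pairing Q a y)⁻¹ • y.1.rep) < 0 := by
    intro x y hxy
    simp only [map_smul, LinearMap.smul_apply, smul_eq_mul, neg_smul, LinearMap.neg_apply,
      map_neg]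
    change -((pairing Q a y)⁻¹ * -((pairing Q a x)⁻¹ * pairing Q x y)) < 0
    rw [mul_neg, neg_neg]
    rw [pairing_comm y a] at hxy
    have hx : pairing Q a x ≠ 0 := by intro h0; simp [h0] at hxy
    have hy : pairing Q a y ≠ 0 := by intro h0; simp [h0] at hxy
    have : (pairing Q a y)⁻¹ * ((pairing Q a x)⁻¹ * pairing Q x y) =
      ((pairing Q a y)⁻¹ * (pairing Q a x)⁻¹) ^ 2 *
        (pairing Q a x * pairing Q x y * pairing Q a y) := by field_simp
    rw [this]
    exact mul_neg_of_pos_of_neg (by positivity) hxy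
  have one : ∀ {x : EinsteinUniverse Q}, pairing Q a x ≠ 0 →
      bil Q a.1.rep (-(pairing Q a x)⁻¹ • x.1.rep) = -1 := by
    intro x hx
    simp only [map_smul, smul_eq_mul]
    change -(pairing Q a x)⁻¹ * pairing Q a x = -1
    field_simp
  have hbc := key habc
  have hcd := key hacd
  have hbd := key habd
  -- Distinct diamonds mean opposite half cones as seen from `c`. Expanding this sign and undoing
  -- the normalization at `a` is the reverse Ptolemy inequality.
  have hle : bil Q (β • b.1.rep - γ • c.1.rep) (δ • d.1.rep - γ • c.1.rep) ≤ 0 := by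
    by_contra! hpos
    exact hne (diamond_eq rfl rfl rfl (neg_ne_zero.2 (inv_ne_zero hac)) (one hab) (one hac) (one had)
      hbc hcd hpos)
  rw [← hβ, ← hγ] at hbc
  rw [← hγ, ← hδ] at hcd
  rw [← hβ, ← hδ] at hbd
  simp only [map_sub, LinearMap.sub_apply, bil_self (γ • c.1.rep), QuadraticMap.map_smul, c.2,
    smul_zero] at hle
  rw [bil_comm (γ • c.1.rep) (δ • d.1.rep)] at hcd
  have e1 : |bil Q (β • b.1.rep) (γ • c.1.rep)| + |bil Q (δ • d.1.rep) (γ • c.1.rep)| ≤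
      |bil Q (β • b.1.rep) (δ • d.1.rep)| := by
    rw [abs_of_neg hbc, abs_of_neg hbd, abs_of_neg hcd]
    rw [bil_comm (δ • d.1.rep)]
    linarith
  simp only [map_smul, LinearMap.smul_apply, smul_eq_mul, abs_mul] at e1
  change |γ| * (|β| * |pairing Q b c|) + |γ| * (|δ| * |pairing Q d c|) ≤
    |δ| * (|β| * |pairing Q b d|) at e1
  rw [hβ, hγ, hδ, abs_neg, abs_neg, abs_neg, abs_inv, abs_inv, abs_inv, pairing_comm d c] at e1
  have pab : 0 < |pairing Q a b| := abs_pos.2 hab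
  have pac : 0 < |pairing Q a c| := abs_pos.2 hac
  have pad : 0 < |pairing Q a d| := abs_pos.2 had
  have e2 := mul_le_mul_of_nonneg_left e1
    (by positivity : 0 ≤ |pairing Q a b| * |pairing Q a c| * |pairing Q a d|)
  field_simp at e2
  linarith

end Einstein

end

end QSEinstein

/-! ### From quasisymmetric maps to timelike curves in affine charts. -/

namespace QSEinstein

noncomputable section

open Filter Topology

variable {V : Type*} [AddCommGroup V] [Module ℝ V] {ω : V [⋀^Fin 2]→ₗ[ℝ] ℝ}
  {E : Type*} [AddCommGroup E] [Module ℝ E] {Q : QuadraticForm ℝ E} {A B : ℝ}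
  {Ω : Set (ℙ ℝ V)} {ξ : ℙ ℝ V → EinsteinUniverse Q}

/-- The properties of quasisymmetric maps in terms of the pairings: positivity of triples, reverse
Ptolemy inequality and control of the cross-ratios. -/
structure IsAdmissible (ω : V [⋀^Fin 2]→ₗ[ℝ] ℝ) (Q : QuadraticForm ℝ E) (A B : ℝ)
    (Ω : Set (ℙ ℝ V)) (ξ : ℙ ℝ V → EinsteinUniverse Q) : Prop where
  triple : ∀ x ∈ Ω, ∀ y ∈ Ω, ∀ z ∈ Ω, x ≠ y → y ≠ z → x ≠ z →
    pairing Q (ξ x) (ξ y) * pairing Q (ξ y) (ξ z) * pairing Q (ξ z) (ξ x) < 0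
  ptolemy : ∀ w ∈ Ω, ∀ x ∈ Ω, ∀ y ∈ Ω, ∀ z ∈ Ω, Separated ω w x y z →
    |pairing Q (ξ w) (ξ x)| * |pairing Q (ξ y) (ξ z)| +
      |pairing Q (ξ w) (ξ z)| * |pairing Q (ξ x) (ξ y)| ≤
    |pairing Q (ξ w) (ξ y)| * |pairing Q (ξ x) (ξ z)|
  crossRatio : ∀ x ∈ Ω, ∀ y ∈ Ω, ∀ z ∈ Ω, ∀ t ∈ Ω, x ≠ z → y ≠ t →
    |area ω x.rep y.rep * area ω z.rep t.rep| < A * |area ω x.rep t.rep * area ω z.rep y.rep| →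
    |area ω x.rep t.rep * area ω z.rep y.rep| < A * |area ω x.rep y.rep * area ω z.rep t.rep| →
    |pairing Q (ξ x) (ξ y) * pairing Q (ξ z) (ξ t)| ≤
      B * |pairing Q (ξ x) (ξ t) * pairing Q (ξ z) (ξ y)|

section OfQuasisymmetric

variable [TopologicalSpace V] [IsTopologicalAddGroup V] [ContinuousSMul ℝ V] [T2Space V]
  [TopologicalSpace E] [IsTopologicalAddGroup E] [ContinuousSMul ℝ E]

/-- By density every triple of `Ω` extends to a positive quadruple, hence has a positive image. The
cross-ratio hypothesis is stated with strict inequalities between products, an open condition, so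
that the bound will pass to limits. -/
lemma IsQuasisymmetric.isAdmissible (hV : Module.finrank ℝ V = 2) (hω : ω ≠ 0) (hΩ : Dense Ω)
    (hA : 1 < A) {ζ : Ω → EinsteinUniverse Q} (h : IsQuasisymmetric ω Q A B ζ)
    (hξ : ∀ x : Ω, ξ x = ζ x) : IsAdmissible ω Q A B Ω ξ := by
  have htriple : ∀ x ∈ Ω, ∀ y ∈ Ω, ∀ z ∈ Ω, x ≠ y → y ≠ z → x ≠ z →
      pairing Q (ξ x) (ξ y) * pairing Q (ξ y) (ξ z) * pairing Q (ξ z) (ξ x) < 0 := by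
    intro x hx y hy z hz hxy hyz hxz
    obtain ⟨w, hw, hs⟩ := exists_separated hV hω hΩ hxy hyz hxz
    have := (h.1 ⟨x, hx⟩ ⟨y, hy⟩ ⟨z, hz⟩ ⟨w, hw⟩ (hs.isPositiveQuadrupleLine hV hω)).1
    rw [isPositiveTriple_iff, ← hξ, ← hξ, ← hξ] at this
    exact this
  have hne : ∀ x ∈ Ω, ∀ y ∈ Ω, ∀ z ∈ Ω, x ≠ y → y ≠ z → x ≠ z →
      pairing Q (ξ x) (ξ y) ≠ 0 := by
    intro x hx y hy z hz hxy hyz hxz h0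
    have := htriple x hx y hy z hz hxy hyz hxz
    simp [h0] at this
  refine ⟨htriple, ?_, ?_⟩
  · intro w hw x hx y hy z hz hs
    have := (h.1 ⟨w, hw⟩ ⟨x, hx⟩ ⟨y, hy⟩ ⟨z, hz⟩ (hs.isPositiveQuadrupleLine hV hω)).ptolemy
    rw [← hξ, ← hξ, ← hξ, ← hξ] at this
    exact this
  · intro x hx y hy z hz t ht hxz hyt h1 h2
    -- The two strict inequalities force numerator and denominator to be nonzero, so the four points
    -- are pairwise distinct.
    have hN : |area ω x.rep y.rep * area ω z.rep t.rep| ≠ 0 := by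
      intro h0
      rw [h0, mul_zero] at h2
      linarith [abs_nonneg (area ω x.rep t.rep * area ω z.rep y.rep)]
    have hD : |area ω x.rep t.rep * area ω z.rep y.rep| ≠ 0 := by
      intro h0
      rw [h0, mul_zero] at h1
      linarith [abs_nonneg (area ω x.rep y.rep * area ω z.rep t.rep)]
    have hxy : x ≠ y := by rintro rfl; simp at hN
    have hzt : z ≠ t := by rintro rfl; simp at hN
    have hxt : x ≠ t := by rintro rfl; simp at hD
    have hzy : z ≠ y := by rintro rfl; simp at hD
    have hN' : 0 < |area ω x.rep y.rep * area ω z.rep t.rep| := (abs_nonneg _).lt_of_ne hN.symm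
    have hD' : 0 < |area ω x.rep t.rep * area ω z.rep y.rep| := (abs_nonneg _).lt_of_ne hD.symm
    have key := (h.2 ⟨x, hx⟩ ⟨y, hy⟩ ⟨z, hz⟩ ⟨t, ht⟩
      (by simp [hxy, hxz, hxt, hzy.symm, hyt, hzt])
      (by
        simp only [QSEinstein.crossRatio, area_apply, abs_div]
        rw [inv_le_comm₀ (by linarith) (div_pos hN' hD'), inv_div, div_le_iff₀ hN']
        exact h2.le)
      (by
        simp only [QSEinstein.crossRatio, area_apply, abs_div]
        rw [div_le_iff₀ hD']
        exact h1.le)).2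
    rw [crossRatioEin, ← hξ, ← hξ, ← hξ, ← hξ, abs_div, div_le_iff₀] at key
    · exact key
    · refine abs_pos.2 (mul_ne_zero ?_ ?_)
      · exact hne x hx t ht z hz hxt hzt.symm hxz
      · exact hne z hz y hy x hx hzy hxy.symm hxz.symm

end OfQuasisymmetric

/-- The affine chart of the projective line in which the line of `v` is the point at infinity and
the line of `w` is the origin. -/
def chart (v w : V) (h : area ω v w ≠ 0) (t : ℝ) : ℙ ℝ V :=
  Projectivization.mk ℝ (w + t • v) (by
    intro h0
    have : area ω v (w + t • v) = 0 := by rw [h0, map_zero]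
    simp [h] at this)

section Chart

variable {v w : V} (h : area ω v w ≠ 0)

lemma exists_chart_rep (t : ℝ) : ∃ c : ℝ, c ≠ 0 ∧ (chart v w h t).rep = c • (w + t • v) :=
  exists_rep_eq_smul _ _

lemma area_chart (s t : ℝ) :
    area ω (w + s • v) (w + t • v) = (s - t) * area ω v w := by
  simp only [map_add, map_smul, LinearMap.add_apply, LinearMap.smul_apply, area_self, smul_eq_mul,
    area_swap w v]
  ring

lemma area_base_chart (t : ℝ) : area ω v (w + t • v) = area ω v w := by
  simp

lemma chart_eq_mk {t : ℝ} {u : V} (hu : u ≠ 0) {c : ℝ} (hc : u = c • (w + t • v)) :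
    Projectivization.mk ℝ u hu = chart v w h t := by
  rw [chart, Projectivization.mk_eq_mk_iff']
  exact ⟨c, hc.symm⟩

/-- The coordinate of a point in an affine chart. -/
lemma chart_coordinate (hV : Module.finrank ℝ V = 2) {u : V} (hu : u ≠ 0) (hvu : area ω v u ≠ 0) :
    Projectivization.mk ℝ u hu = chart v w h (area ω u w / area ω v u) := by
  refine chart_eq_mk h hu (c := area ω v u / area ω v w) ?_
  conv_lhs => rw [eq_smul_add_smul_of_area hV h u]
  rw [smul_add, smul_smul, add_comm]
  congr 2
  field_simp

lemma chart_ne {a : ℙ ℝ V} (h : area ω a.rep w ≠ 0) (t : ℝ) : a ≠ chart a.rep w h t := by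
  intro h0
  obtain ⟨c, hc, hrep⟩ := exists_chart_rep h t
  rw [← h0] at hrep
  have : area ω a.rep (c • (w + t • a.rep)) = 0 := by rw [← hrep, area_self]
  simp [hc, h] at this

lemma chart_injective : Function.Injective (chart v w h) := by
  intro s t hst
  obtain ⟨c, hc, hs⟩ := exists_chart_rep h s
  obtain ⟨d, hd, ht⟩ := exists_chart_rep h t
  have h1 : area ω (chart v w h s).rep (chart v w h t).rep = 0 := by rw [hst, area_self]
  rw [hs, ht] at h1
  simp only [map_smul, LinearMap.smul_apply, smul_eq_mul, area_chart] at h1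
  have := mul_ne_zero hd hc
  have h2 : (d * c) * ((s - t) * area ω v w) = 0 := by rw [← h1]; ring
  have h3 := (mul_eq_zero.1 ((mul_eq_zero.1 h2).resolve_left this)).resolve_right h
  linarith

lemma dense_preimage_chart [TopologicalSpace V] [IsTopologicalAddGroup V] [ContinuousSMul ℝ V]
    [T2Space V] (hV : Module.finrank ℝ V = 2)
    (hΩ : Dense Ω) : Dense (chart v w h ⁻¹' Ω) := by
  refine dense_of_exists_between fun s t hst => ?_
  have hopen := isOpen_area_mul_neg (ω := ω) hV (w + s • v) (w + t • v)
  have hk : 0 < area ω v w ^ 2 := by positivity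
  obtain ⟨u, hu, huΩ⟩ := hΩ.inter_open_nonempty _ hopen ⟨chart v w h ((s + t) / 2), by
    obtain ⟨c, hc, hrep⟩ := exists_chart_rep h ((s + t) / 2)
    simp only [Set.mem_ofPred_eq, hrep, map_smul, smul_eq_mul, area_chart]
    have : c * ((s - (s + t) / 2) * area ω v w) * (c * ((t - (s + t) / 2) * area ω v w)) =
      -(c ^ 2 * ((t - s) / 2) ^ 2 * area ω v w ^ 2) := by ring
    rw [this]
    have : 0 < t - s := sub_pos.2 hst
    have : 0 < c ^ 2 * ((t - s) / 2) ^ 2 * area ω v w ^ 2 := by positivity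
    linarith⟩
  simp only [Set.mem_ofPred_eq] at hu
  -- The point at infinity is not in the arc, since the product of areas there is `ω(v, w)² > 0`.
  have hvu : area ω v u.rep ≠ 0 := by
    intro h0
    have hur := eq_smul_add_smul_of_area hV h u.rep
    rw [h0, zero_div, zero_smul, add_zero] at hur
    rw [hur] at hu
    simp only [map_smul, map_add, LinearMap.add_apply, LinearMap.smul_apply, area_self,
      smul_eq_mul, mul_zero, add_zero] at hu
    nlinarith [mul_self_nonneg (area ω u.rep w / area ω v w * area ω w v)]
  have hcoord := chart_coordinate h hV u.rep_nonzero hvu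
  rw [Projectivization.mk_rep] at hcoord
  set x := area ω u.rep w / area ω v u.rep
  refine ⟨x, by rwa [Set.mem_preimage, ← hcoord], ?_⟩
  obtain ⟨c, hc, hrep⟩ := exists_chart_rep h x
  rw [hcoord, hrep] at hu
  simp only [map_smul, smul_eq_mul, area_chart] at hu
  have h1 : (s - x) * (t - x) < 0 := by
    by_contra! h0
    have : c * ((s - x) * area ω v w) * (c * ((t - x) * area ω v w)) =
      c ^ 2 * area ω v w ^ 2 * ((s - x) * (t - x)) := by ring
    rw [this] at hu
    have : 0 ≤ c ^ 2 * area ω v w ^ 2 * ((s - x) * (t - x)) := by positivity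
    linarith
  constructor <;> nlinarith

end Chart

/-- The lift of `ξ` in an affine chart. -/
def chartLift (ξ : ℙ ℝ V → EinsteinUniverse Q) (a : E) (v w : V) (h : area ω v w ≠ 0) (t : ℝ) : E :=
  -(bil Q a (ξ (chart v w h t)).1.rep)⁻¹ • (ξ (chart v w h t)).1.rep

lemma IsAdmissible.pairing_ne_zero (hadm : IsAdmissible ω Q A B Ω ξ) {x y z : ℙ ℝ V}
    (hx : x ∈ Ω) (hy : y ∈ Ω) (hz : z ∈ Ω) (hxy : x ≠ y) (hyz : y ≠ z) (hxz : x ≠ z) :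
    pairing Q (ξ x) (ξ y) ≠ 0 := by
  intro h0
  have := hadm.triple x hx y hy z hz hxy hyz hxz
  simp [h0] at this

/-- With pairings against `a` normalized, triples containing `a` give the sign of the pairings,
Ptolemy for `(a, x, y, z)` gives superadditivity, and the cross-ratio with a point at `a` gives
quasisymmetry. The factor `σ` is left free in order to normalize a triple later. -/
theorem IsAdmissible.isTimelikeCurve [TopologicalSpace V] [IsTopologicalAddGroup V]
    [ContinuousSMul ℝ V] [T2Space V] (hV : Module.finrank ℝ V = 2)
    (hΩ : Dense Ω) (hadm : IsAdmissible ω Q A B Ω ξ) {a : ℙ ℝ V} (ha : a ∈ Ω) {w : V}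
    (h : area ω a.rep w ≠ 0) {σ : ℝ} (hσ : σ ≠ 0) :
    IsTimelikeCurve Q A B (σ • (ξ a).1.rep) (chart a.rep w h ⁻¹' Ω)
      (chartLift ξ (σ • (ξ a).1.rep) a.rep w h) := by
  have hdense := dense_preimage_chart h hV hΩ
  set φ := chart a.rep w h with hφ
  have hk : 0 < |area ω a.rep w| := abs_pos.2 h
  -- the pairings with the base point do not vanish
  have hp : ∀ t ∈ φ ⁻¹' Ω, pairing Q (ξ a) (ξ (φ t)) ≠ 0 := by
    intro t ht
    obtain ⟨s, hs, hs1⟩ := hdense.exists_between (lt_add_one t)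
    exact hadm.pairing_ne_zero ha ht hs (chart_ne h t)
      (fun h0 => hs1.1.ne (chart_injective h h0)) (chart_ne h s)
  have hbil : ∀ s t, bil Q (chartLift ξ (σ • (ξ a).1.rep) a.rep w h s)
      (chartLift ξ (σ • (ξ a).1.rep) a.rep w h t) =
      (σ * pairing Q (ξ a) (ξ (φ s)))⁻¹ * (σ * pairing Q (ξ a) (ξ (φ t)))⁻¹ *
        pairing Q (ξ (φ s)) (ξ (φ t)) := by
    intro s t
    simp only [chartLift, map_smul, LinearMap.smul_apply, smul_eq_mul, pairing, ← hφ]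
    ring
  have hneg : ∀ s ∈ φ ⁻¹' Ω, ∀ t ∈ φ ⁻¹' Ω, s < t →
      bil Q (chartLift ξ (σ • (ξ a).1.rep) a.rep w h s)
      (chartLift ξ (σ • (ξ a).1.rep) a.rep w h t) < 0 := by
    intro s hs t ht hst
    have h1 := hadm.triple a ha _ hs _ ht (chart_ne h s)
      (fun h0 => hst.ne (chart_injective h h0)) (chart_ne h t)
    rw [hbil]
    have e1 := hp s hs
    have e2 := hp t ht
    have : (σ * pairing Q (ξ a) (ξ (φ s)))⁻¹ * (σ * pairing Q (ξ a) (ξ (φ t)))⁻¹ *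
        pairing Q (ξ (φ s)) (ξ (φ t)) =
        ((σ * pairing Q (ξ a) (ξ (φ s)))⁻¹ * (pairing Q (ξ a) (ξ (φ t)))⁻¹) ^ 2 *
        (pairing Q (ξ a) (ξ (φ s)) * pairing Q (ξ (φ s)) (ξ (φ t)) *
          pairing Q (ξ (φ t)) (ξ a)) := by
      rw [pairing_comm (ξ (φ t)) (ξ a)]
      field_simp
    rw [this]
    exact mul_neg_of_pos_of_neg (by positivity) h1
  have habs : ∀ s ∈ φ ⁻¹' Ω, ∀ t ∈ φ ⁻¹' Ω, s < t →
      |pairing Q (ξ (φ s)) (ξ (φ t))| = -bil Q (chartLift ξ (σ • (ξ a).1.rep) a.rep w h s)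
      (chartLift ξ (σ • (ξ a).1.rep) a.rep w h t) *
        (σ ^ 2 * |pairing Q (ξ a) (ξ (φ s))| * |pairing Q (ξ a) (ξ (φ t))|) := by
    intro s hs t ht hst
    rw [← abs_of_neg (hneg s hs t ht hst), hbil, abs_mul, abs_mul, abs_inv, abs_inv, abs_mul,
      abs_mul, ← sq_abs σ]
    have e1 := abs_pos.2 (hp s hs)
    have e2 := abs_pos.2 (hp t ht)
    have e3 := abs_pos.2 hσ
    field_simp
  refine ⟨smul_ne_zero hσ (ξ a).1.rep_nonzero, ?_, hdense, ?_, ?_, hneg, ?_, ?_⟩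
  · rw [QuadraticMap.map_smul, (ξ a).2, smul_zero]
  · intro t ht
    rw [chartLift, QuadraticMap.map_smul, (ξ _).2, smul_zero]
  · intro t ht
    have h1 := hp t ht
    simp only [chartLift, map_smul, LinearMap.smul_apply, smul_eq_mul]
    change -(σ * pairing Q (ξ a) (ξ (φ t)))⁻¹ * (σ * pairing Q (ξ a) (ξ (φ t))) = -1
    field_simp
  · intro x hx y hy z hz hxy hyz
    have hsep : Separated ω a (φ x) (φ y) (φ z) := by
      obtain ⟨c, hc, h1⟩ := exists_chart_rep h x
      obtain ⟨d, hd, h2⟩ := exists_chart_rep h y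
      obtain ⟨e, he, h3⟩ := exists_chart_rep h z
      unfold Separated
      rw [hφ, h1, h2, h3]
      simp only [map_smul, LinearMap.smul_apply, smul_eq_mul, area_chart, area_base_chart]
      set k := area ω a.rep w
      have : c * k * (c * (d * ((y - x) * k))) * (e * k * (e * (d * ((y - z) * k)))) =
        -((c * e * d * k ^ 2) ^ 2 * ((y - x) * (z - y))) := by ring
      rw [this, neg_lt_zero]
      have := mul_pos (sub_pos.2 hxy) (sub_pos.2 hyz)
      positivity
    have key := hadm.ptolemy a ha _ hx _ hy _ hz hsep
    rw [habs x hx y hy hxy, habs y hy z hz hyz, habs x hx z hz (hxy.trans hyz)] at key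
    have e1 := abs_pos.2 (hp x hx)
    have e2 := abs_pos.2 (hp y hy)
    have e3 := abs_pos.2 (hp z hz)
    have e4 : 0 < σ ^ 2 * |pairing Q (ξ a) (ξ (φ x))| * |pairing Q (ξ a) (ξ (φ y))| *
      |pairing Q (ξ a) (ξ (φ z))| := by positivity
    refine le_of_mul_le_mul_right ?_ e4
    linarith
  · intro x hx y hy t ht hxy hxt hyt h1 h2
    obtain ⟨c, hc, r1⟩ := exists_chart_rep h x
    obtain ⟨d, hd, r2⟩ := exists_chart_rep h y
    obtain ⟨e, he, r3⟩ := exists_chart_rep h t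
    have cc : 0 < |c| * |d| * |e| * |area ω a.rep w| ^ 2 := by
      have := abs_pos.2 hc
      have := abs_pos.2 hd
      have := abs_pos.2 he
      positivity
    -- With the third point at infinity, the cross-ratio is `(x - y) / (x - t)` in the affine
    -- coordinate.
    have key := hadm.crossRatio _ hx _ hy _ ha _ ht (chart_ne h x).symm
      (fun h0 => hyt (chart_injective h h0))
      (by
        rw [hφ, r1, r2, r3]
        simp only [map_smul, LinearMap.smul_apply, smul_eq_mul, area_chart, area_base_chart,
          abs_mul]
        calc _ = |c| * |d| * |e| * |area ω a.rep w| ^ 2 * |x - y| := by ring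
          _ < |c| * |d| * |e| * |area ω a.rep w| ^ 2 * (A * |x - t|) := by gcongr
          _ = _ := by ring)
      (by
        rw [hφ, r1, r2, r3]
        simp only [map_smul, LinearMap.smul_apply, smul_eq_mul, area_chart, area_base_chart,
          abs_mul]
        calc _ = |c| * |d| * |e| * |area ω a.rep w| ^ 2 * |x - t| := by ring
          _ < |c| * |d| * |e| * |area ω a.rep w| ^ 2 * (A * |x - y|) := by gcongr
          _ = _ := by ring)
    have habs' : ∀ s ∈ φ ⁻¹' Ω, ∀ t ∈ φ ⁻¹' Ω, s ≠ t →
      |pairing Q (ξ (φ s)) (ξ (φ t))| = -bil Q (chartLift ξ (σ • (ξ a).1.rep) a.rep w h s)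
      (chartLift ξ (σ • (ξ a).1.rep) a.rep w h t) *
        (σ ^ 2 * |pairing Q (ξ a) (ξ (φ s))| * |pairing Q (ξ a) (ξ (φ t))|) := by
      intro s hs t ht hst
      rcases hst.lt_or_gt with hst | hst
      · exact habs s hs t ht hst
      · rw [pairing_comm, habs t ht s hs hst, bil_comm]
        ring
    rw [abs_mul, abs_mul, habs' x hx y hy hxy, habs' x hx t ht hxt] at key
    have e1 := abs_pos.2 (hp x hx)
    have e2 := abs_pos.2 (hp y hy)
    have e3 := abs_pos.2 (hp t ht)
    have e4 : 0 < σ ^ 2 * |pairing Q (ξ a) (ξ (φ x))| * |pairing Q (ξ a) (ξ (φ y))| *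
      |pairing Q (ξ a) (ξ (φ t))| := by positivity
    refine le_of_mul_le_mul_right ?_ e4
    linarith

end

end QSEinstein

/-! ### Continuous extension, and stability of admissibility under limits. -/

namespace QSEinstein

noncomputable section

open Filter Topology

section Lift

variable {M : Type*} [AddCommGroup M] [Module ℝ M] [TopologicalSpace M] [IsTopologicalAddGroup M]
  [ContinuousSMul ℝ M] [T2Space M] [FiniteDimensional ℝ M]

lemma continuous_bilinear (β : M →ₗ[ℝ] M →ₗ[ℝ] ℝ) : Continuous fun p : M × M => β p.1 p.2 := by
  let b := Module.finBasis ℝ M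
  have : (fun p : M × M => β p.1 p.2) = fun p => ∑ i, b.coord i p.1 * β (b i) p.2 := by
    funext p
    conv_lhs => rw [← b.sum_repr p.1, map_sum, LinearMap.sum_apply]
    simp only [map_smul, LinearMap.smul_apply, smul_eq_mul, Module.Basis.coord_apply]
  rw [this]
  refine continuous_finsetSum _ fun i _ => ?_
  exact ((b.coord i).continuous_of_finiteDimensional.comp continuous_fst).mul
    ((β (b i)).continuous_of_finiteDimensional.comp continuous_snd)

lemma tendsto_bilinear (β : M →ₗ[ℝ] M →ₗ[ℝ] ℝ) {ι : Type*} {l : Filter ι} {f g : ι → M} {x y : M}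
    (hf : Tendsto f l (𝓝 x)) (hg : Tendsto g l (𝓝 y)) :
    Tendsto (fun i => β (f i) (g i)) l (𝓝 (β x y)) :=
  ((continuous_bilinear β).tendsto (x, y)).comp (hf.prodMk_nhds hg)

/-- Lifts of a convergent family of points of a projective space. -/
lemma exists_tendsto_lift {ι : Type*} {l : Filter ι} {g : ι → ℙ ℝ M} {x : ℙ ℝ M}
    (hg : Tendsto g l (𝓝 x)) :
    ∃ s : ι → M, Tendsto s l (𝓝 x.rep) ∧ ∀ i, ∃ c : ℝ, s i = c • (g i).rep := by
  obtain ⟨s, hs, hx, h⟩ := exists_continuousAt_lift x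
  refine ⟨s ∘ g, ?_, fun i => h _⟩
  rw [← hx]
  exact hs.tendsto.comp hg

end Lift

variable {V : Type*} [AddCommGroup V] [Module ℝ V] {ω : V [⋀^Fin 2]→ₗ[ℝ] ℝ}
  {E : Type*} [AddCommGroup E] [Module ℝ E] {Q : QuadraticForm ℝ E} {A B : ℝ}
  {Ω : Set (ℙ ℝ V)} {ξ : ℙ ℝ V → EinsteinUniverse Q}

/-- The vectors `r x - s y` and `s y - p z` have Gram matrix `-prs` times `(2, -1; -1, 2)`, so they
span a positive definite plane, whose orthogonal is negative definite. -/
lemma triple_orthogonal_eq_zero {q : ℕ} (hQ : HasSignature Q 2 q) {x y z a : E} (hx : Q x = 0)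
    (hy : Q y = 0) (hz : Q z = 0) (h : bil Q x y * bil Q y z * bil Q z x < 0) (ha : Q a = 0)
    (hxa : bil Q x a = 0) (hya : bil Q y a = 0) (hza : bil Q z a = 0) : a = 0 := by
  by_contra ha0
  set p := bil Q x y with hp
  set r := bil Q y z with hr
  set s := bil Q z x with hs
  have h1 : Q (r • x - s • y) = -2 * (p * r * s) := by
    simp only [← bil_self, map_sub, map_smul, LinearMap.sub_apply, LinearMap.smul_apply,
      smul_eq_mul, bil_comm y x, ← hp]
    simp only [bil_self, hx, hy]
    ring
  have h2 : Q (s • y - p • z) = -2 * (p * r * s) := by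
    simp only [← bil_self, map_sub, map_smul, LinearMap.sub_apply, LinearMap.smul_apply,
      smul_eq_mul, bil_comm z y, ← hr]
    simp only [bil_self, hz, hy]
    ring
  have h3 : bil Q (r • x - s • y) (s • y - p • z) = p * r * s := by
    simp only [map_sub, map_smul, LinearMap.sub_apply, LinearMap.smul_apply,
      smul_eq_mul, bil_comm x z, ← hr, ← hs, ← hp, bil_self, hy]
    ring
  have := neg_of_orthogonal hQ (v := r • x - s • y) (w := s • y - p • z) (z := a)
    (by rw [h1]; linarith) (by rw [h1, h2, h3]; nlinarith) (by simp [hxa, hya])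
    (by simp [hya, hza]) ha0
  linarith

lemma exists_area_ne_zero (hV : Module.finrank ℝ V = 2) (hω : ω ≠ 0) (x : ℙ ℝ V) :
    ∃ y : ℙ ℝ V, area ω x.rep y.rep ≠ 0 := by
  have : FiniteDimensional ℝ V := .of_finrank_pos (by omega)
  obtain ⟨y, hy⟩ := exists_linearIndependent_pair_of_one_lt_finrank (R := ℝ) (M := V) (by omega)
    x.rep_nonzero
  have hy0 : y ≠ 0 := by
    have := hy.ne_zero 1
    simpa using this
  refine ⟨Projectivization.mk ℝ y hy0, area_rep_ne_zero hV hω fun h => ?_⟩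
  obtain ⟨a, ha⟩ := (Projectivization.mk_eq_mk_iff' ℝ _ _ x.rep_nonzero hy0).1 (x.mk_rep.trans h)
  have := LinearIndependent.pair_iff.1 hy 1 (-a) (by rw [one_smul, ← ha]; module)
  simpa using this.1

lemma infinite_projectiveLine (hV : Module.finrank ℝ V = 2) (hω : ω ≠ 0) :
    Infinite (ℙ ℝ V) := by
  have : Nontrivial V := Module.nontrivial_of_finrank_pos (R := ℝ) (by omega)
  obtain ⟨v, hv⟩ := exists_ne (0 : V)
  obtain ⟨y, hy⟩ := exists_area_ne_zero hV hω (Projectivization.mk ℝ v hv)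
  exact Infinite.of_injective _ (chart_injective hy)

lemma IsAdmissible.congr (hadm : IsAdmissible ω Q A B Ω ξ) {ζ : ℙ ℝ V → EinsteinUniverse Q}
    (h : ∀ x ∈ Ω, ζ x = ξ x) : IsAdmissible ω Q A B Ω ζ where
  triple x hx y hy z hz := by
    rw [h x hx, h y hy, h z hz]
    exact hadm.triple x hx y hy z hz
  ptolemy w hw x hx y hy z hz := by
    rw [h w hw, h x hx, h y hy, h z hz]
    exact hadm.ptolemy w hw x hx y hy z hz
  crossRatio x hx y hy z hz t ht := by
    rw [h t ht, h x hx, h y hy, h z hz]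
    exact hadm.crossRatio x hx y hy z hz t ht

variable [TopologicalSpace V] [IsTopologicalAddGroup V] [ContinuousSMul ℝ V] [T2Space V]
  [TopologicalSpace E] [IsTopologicalAddGroup E] [ContinuousSMul ℝ E] [T2Space E]

lemma exists_mem_dense_notMem (hV : Module.finrank ℝ V = 2) (hω : ω ≠ 0) (hΩ : Dense Ω)
    (S : Finset (ℙ ℝ V)) : ∃ x ∈ Ω, x ∉ S := by
  have : FiniteDimensional ℝ V := .of_finrank_pos (by omega)
  have := infinite_projectiveLine hV hω
  obtain ⟨y, hy⟩ := Infinite.exists_notMem_finset S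
  obtain ⟨x, hx, hxΩ⟩ := hΩ.inter_open_nonempty _ S.finite_toSet.isClosed.isOpen_compl ⟨y, hy⟩
  exact ⟨x, hxΩ, hx⟩

/-- In a chart with `x` at the origin and infinity in `Ω`, the lifts converge. The relation `⟨a, L⟩
= -1` passes to the limit, so the limit vector is nonzero and spans a point. -/
lemma IsAdmissible.exists_tendsto {q : ℕ} (hQ : HasSignature Q 2 q)
    (hV : Module.finrank ℝ V = 2) (hω : ω ≠ 0) (hΩ : Dense Ω) (hA : 1 < A) (hB : 1 < B)
    (hadm : IsAdmissible ω Q A B Ω ξ) (x : ℙ ℝ V) : ∃ y, Tendsto ξ (𝓝[Ω] x) (𝓝 y) := by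
  have : FiniteDimensional ℝ V := .of_finrank_pos (by omega)
  have := hQ.finiteDimensional (by omega)
  obtain ⟨a, ha, hax⟩ := exists_mem_dense_notMem hV hω hΩ {x}
  have hax : a ≠ x := by simpa using hax
  have h := area_rep_ne_zero hV hω hax
  have hc := hadm.isTimelikeCurve hV hΩ ha h one_ne_zero
  set D := chart a.rep x.rep h ⁻¹' Ω with hD
  set α := (1 : ℝ) • (ξ a).1.rep with hα
  set F := chartLift ξ α a.rep x.rep h with hF
  obtain ⟨L, hL⟩ := hQ.exists_tendsto (by omega) (hc.cauchy_functional hQ hA hB 0)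
  have hne : (𝓝[D] (0 : ℝ)).NeBot := mem_closure_iff_nhdsWithin_neBot.1 (hc.dense 0)
  have hαL : bil Q α L = -1 := by
    refine tendsto_nhds_unique (tendsto_bilinear (bil Q) tendsto_const_nhds hL) ?_
    refine tendsto_const_nhds.congr' ?_
    filter_upwards [self_mem_nhdsWithin] with t ht
    exact (hc.bil_base t ht).symm
  have hL0 : L ≠ 0 := by
    rintro rfl
    simp at hαL
  have hQL : Q L = 0 := by
    rw [← bil_self]
    refine tendsto_nhds_unique (tendsto_bilinear (bil Q) hL hL) ?_
    refine tendsto_const_nhds.congr' ?_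
    filter_upwards [self_mem_nhdsWithin] with t ht
    rw [bil_self]
    exact (hc.map_eq t ht).symm
  -- the affine coordinate near `x`
  obtain ⟨s, hs, hs'⟩ := exists_tendsto_lift (l := 𝓝[Ω] x) (g := id) (x := x)
    (tendsto_id.mono_left nhdsWithin_le_nhds)
  have hcont : ∀ v : V, Continuous (area ω v) := fun v =>
    (area ω v).continuous_of_finiteDimensional
  have h1 : Tendsto (fun u => area ω (s u) x.rep) (𝓝[Ω] x) (𝓝 0) := by
    have := tendsto_bilinear (area ω) hs (tendsto_const_nhds (x := x.rep))
    rwa [area_self] at this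
  have h2 : Tendsto (fun u => area ω a.rep (s u)) (𝓝[Ω] x) (𝓝 (area ω a.rep x.rep)) :=
    ((hcont a.rep).tendsto _).comp hs
  have h3 := h1.div h2 h
  rw [zero_div] at h3
  have h4 : ∀ᶠ u in 𝓝[Ω] x, area ω a.rep (s u) ≠ 0 := h2.eventually_ne h
  -- The affine coordinate of `u`; it tends to `0` inside `D` as `u` tends to `x` inside `Ω`.
  set τ : ℙ ℝ V → ℝ := fun u => area ω u.rep x.rep / area ω a.rep u.rep with hτ
  have h5 : ∀ᶠ u in 𝓝[Ω] x, area ω (s u) x.rep / area ω a.rep (s u) = τ u ∧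
      area ω a.rep u.rep ≠ 0 := by
    filter_upwards [h4] with u hu
    obtain ⟨c, hc⟩ := hs' u
    rw [id] at hc
    have hc0 : c ≠ 0 := by
      rintro rfl
      simp [hc] at hu
    simp only [hc, map_smul, LinearMap.smul_apply, smul_eq_mul] at hu ⊢
    refine ⟨mul_div_mul_left _ _ hc0, fun h0 => hu (by rw [h0, mul_zero])⟩
  have h6 : Tendsto τ (𝓝[Ω] x) (𝓝 0) := h3.congr' (h5.mono fun u hu => hu.1)
  have h7 : ∀ᶠ u in 𝓝[Ω] x, u = chart a.rep x.rep h (τ u) := by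
    filter_upwards [h5] with u hu
    have := chart_coordinate h hV u.rep_nonzero hu.2
    rwa [Projectivization.mk_rep] at this
  have h8 : Tendsto τ (𝓝[Ω] x) (𝓝[D] 0) := by
    refine tendsto_nhdsWithin_iff.2 ⟨h6, ?_⟩
    filter_upwards [h7, self_mem_nhdsWithin] with u hu huΩ
    rwa [hD, Set.mem_preimage, ← hu]
  refine ⟨toEinstein L hL0 hQL, ?_⟩
  rw [tendsto_subtype_rng]
  refine tendsto_mk hL0 (hL.comp h8) ?_
  filter_upwards [h7, h8.eventually self_mem_nhdsWithin] with u hu huD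
  have hF0 : F (τ u) ≠ 0 := by
    intro h0
    have := hc.bil_base _ huD
    rw [h0] at this
    simp at this
  refine ⟨hF0, ?_⟩
  have : F (τ u) = -(bil Q α (ξ u).1.rep)⁻¹ • (ξ u).1.rep := by
    rw [hF, chartLift, ← hu]
  conv_rhs => rw [← (ξ u).1.mk_rep]
  rw [Projectivization.mk_eq_mk_iff']
  exact ⟨_, this.symm⟩

theorem IsAdmissible.exists_continuous_extension {q : ℕ} (hQ : HasSignature Q 2 q)
    (hV : Module.finrank ℝ V = 2) (hω : ω ≠ 0) (hΩ : Dense Ω) (hA : 1 < A) (hB : 1 < B)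
    (hadm : IsAdmissible ω Q A B Ω ξ) :
    ∃ Ξ : ℙ ℝ V → EinsteinUniverse Q, Continuous Ξ ∧ ∀ x ∈ Ω, Ξ x = ξ x := by
  have := hQ.finiteDimensional (by omega)
  refine ⟨extendFrom Ω ξ, continuous_extendFrom hΩ (hadm.exists_tendsto hQ hV hω hΩ hA hB), ?_⟩
  intro x hx
  obtain ⟨y, hy⟩ := hadm.exists_tendsto hQ hV hω hΩ hA hB x
  rw [extendFrom_eq (hΩ x) hy]
  exact tendsto_nhds_unique (hy.mono_left (pure_le_nhdsWithin hx)) (tendsto_pure_nhds ξ x)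

/-- A continuous map which is admissible on a dense subset is admissible. -/
theorem IsAdmissible.of_dense {q : ℕ} (hQ : HasSignature Q 2 q)
    (hV : Module.finrank ℝ V = 2) (hω : ω ≠ 0) (hΩ : Dense Ω)
    (hadm : IsAdmissible ω Q A B Ω ξ) (hξ : Continuous ξ) :
    IsAdmissible ω Q A B Set.univ ξ := by
  have : FiniteDimensional ℝ V := .of_finrank_pos (by omega)
  have := hQ.finiteDimensional (by omega)
  have hne : ∀ x, (𝓝[Ω] x).NeBot := fun x => mem_closure_iff_nhdsWithin_neBot.1 (hΩ x)
  -- simultaneous approximation of four points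
  have approx : ∀ p : Fin 4 → ℙ ℝ V, ∃ l : Filter (Fin 4 → ℙ ℝ V), l.NeBot ∧
      (∀ i, ∀ᶠ u in l, u i ∈ Ω) ∧ (∀ i, Tendsto (fun u => u i) l (𝓝 (p i))) ∧
      ∃ (e : Fin 4 → (Fin 4 → ℙ ℝ V) → E) (v : Fin 4 → (Fin 4 → ℙ ℝ V) → V),
      (∀ i, Tendsto (e i) l (𝓝 (ξ (p i)).1.rep)) ∧ (∀ i, Tendsto (v i) l (𝓝 (p i).rep)) ∧
      (∀ i u, ∃ c : ℝ, e i u = c • (ξ (u i)).1.rep) ∧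
      (∀ i u, ∃ c : ℝ, v i u = c • (u i).rep) := by
    intro p
    have hl : ∀ i, Tendsto (fun u : Fin 4 → ℙ ℝ V => u i) (Filter.pi fun i => 𝓝[Ω] (p i))
      (𝓝[Ω] (p i)) := fun i => tendsto_eval_pi _ i
    have hl' := fun i => (hl i).mono_right nhdsWithin_le_nhds
    choose e he he' using fun i => exists_tendsto_lift
      (((continuous_subtype_val.comp hξ).tendsto (p i)).comp (hl' i))
    choose v hv hv' using fun i => exists_tendsto_lift (hl' i)
    exact ⟨Filter.pi fun i => 𝓝[Ω] (p i), inferInstance,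
      fun i => (hl i).eventually self_mem_nhdsWithin, hl', e, v, he, hv, he', hv'⟩
  have ptolemy : ∀ w x y z, Separated ω w x y z →
      |pairing Q (ξ w) (ξ x)| * |pairing Q (ξ y) (ξ z)| +
        |pairing Q (ξ w) (ξ z)| * |pairing Q (ξ x) (ξ y)| ≤
      |pairing Q (ξ w) (ξ y)| * |pairing Q (ξ x) (ξ z)| := by
    intro w x y z hsep
    obtain ⟨l, hl, hmem, -, e, v, he, hv, he', hv'⟩ := approx ![w, x, y, z]
    have hB : ∀ i j, Tendsto (fun u => |bil Q (e i u) (e j u)|) l _ := fun i j =>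
      (tendsto_bilinear (bil Q) (he i) (he j)).abs
    have hA : ∀ i j, Tendsto (fun u => area ω (v i u) (v j u)) l _ := fun i j =>
      tendsto_bilinear (area ω) (hv i) (hv j)
    have hsep' := (((hA 0 1).mul (hA 2 1)).mul ((hA 0 3).mul (hA 2 3))).eventually_lt_const hsep
    refine le_of_tendsto_of_tendsto
      (((hB 0 1).mul (hB 2 3)).add ((hB 0 3).mul (hB 1 2))) ((hB 0 2).mul (hB 1 3)) ?_
    filter_upwards [hsep', hmem 0, hmem 1, hmem 2, hmem 3] with u hu h0 h1 h2 h3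
    obtain ⟨c0, k0⟩ := hv' 0 u
    obtain ⟨c1, k1⟩ := hv' 1 u
    obtain ⟨c2, k2⟩ := hv' 2 u
    obtain ⟨c3, k3⟩ := hv' 3 u
    simp only [k0, k1, k2, k3, map_smul, LinearMap.smul_apply, smul_eq_mul] at hu
    have hs : Separated ω (u 0) (u 1) (u 2) (u 3) := by
      unfold Separated
      by_contra! h
      have : 0 ≤ (c0 * c1 * c2 * c3) ^ 2 *
        (area ω (u 0).rep (u 1).rep * area ω (u 2).rep (u 1).rep *
          (area ω (u 0).rep (u 3).rep * area ω (u 2).rep (u 3).rep)) := by positivity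
      linarith
    have key := hadm.ptolemy _ h0 _ h1 _ h2 _ h3 hs
    obtain ⟨d0, m0⟩ := he' 0 u
    obtain ⟨d1, m1⟩ := he' 1 u
    obtain ⟨d2, m2⟩ := he' 2 u
    obtain ⟨d3, m3⟩ := he' 3 u
    simp only [m0, m1, m2, m3, map_smul, LinearMap.smul_apply, smul_eq_mul, abs_mul]
    have := mul_le_mul_of_nonneg_left key
      (by positivity : 0 ≤ |d0| * |d1| * |d2| * |d3|)
    unfold pairing at this
    linarith
  have crossRatio : ∀ x y z t : ℙ ℝ V, x ≠ z → y ≠ t →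
      |area ω x.rep y.rep * area ω z.rep t.rep| < A * |area ω x.rep t.rep * area ω z.rep y.rep| →
      |area ω x.rep t.rep * area ω z.rep y.rep| < A * |area ω x.rep y.rep * area ω z.rep t.rep| →
      |pairing Q (ξ x) (ξ y) * pairing Q (ξ z) (ξ t)| ≤
        B * |pairing Q (ξ x) (ξ t) * pairing Q (ξ z) (ξ y)| := by
    intro x y z t hxz hyt hc1 hc2
    obtain ⟨l, hl, hmem, hlim, e, v, he, hv, he', hv'⟩ := approx ![x, y, z, t]
    have hB : ∀ i j, Tendsto (fun u => bil Q (e i u) (e j u)) l _ := fun i j =>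
      tendsto_bilinear (bil Q) (he i) (he j)
    have hA : ∀ i j, Tendsto (fun u => area ω (v i u) (v j u)) l _ := fun i j =>
      tendsto_bilinear (area ω) (hv i) (hv j)
    have e1 := ((hA 0 1).mul (hA 2 3)).abs.eventually_lt
      (((hA 0 3).mul (hA 2 1)).abs.const_mul A) hc1
    have e2 := ((hA 0 3).mul (hA 2 1)).abs.eventually_lt
      (((hA 0 1).mul (hA 2 3)).abs.const_mul A) hc2
    have e3 := ((hlim 0).prodMk_nhds (hlim 2)).eventually
      ((isOpen_ne_fun continuous_fst continuous_snd).mem_nhds hxz)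
    have e4 := ((hlim 1).prodMk_nhds (hlim 3)).eventually
      ((isOpen_ne_fun continuous_fst continuous_snd).mem_nhds hyt)
    refine le_of_tendsto_of_tendsto ((hB 0 1).mul (hB 2 3)).abs
      (((hB 0 3).mul (hB 2 1)).abs.const_mul B) ?_
    filter_upwards [e1, e2, e3, e4, hmem 0, hmem 1, hmem 2, hmem 3] with u e1 e2 e3 e4 h0 h1 h2 h3
    obtain ⟨c0, k0⟩ := hv' 0 u
    obtain ⟨c1, k1⟩ := hv' 1 u
    obtain ⟨c2, k2⟩ := hv' 2 u
    obtain ⟨c3, k3⟩ := hv' 3 u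
    simp only [k0, k1, k2, k3, map_smul, LinearMap.smul_apply, smul_eq_mul, abs_mul] at e1 e2
    have hcc : 0 ≤ |c0| * |c1| * |c2| * |c3| := by positivity
    have key := hadm.crossRatio _ h0 _ h1 _ h2 _ h3 e3 e4
      (by
        rw [abs_mul, abs_mul]
        refine lt_of_mul_lt_mul_left ?_ hcc
        linarith)
      (by
        rw [abs_mul, abs_mul]
        refine lt_of_mul_lt_mul_left ?_ hcc
        linarith)
    obtain ⟨d0, m0⟩ := he' 0 u
    obtain ⟨d1, m1⟩ := he' 1 u
    obtain ⟨d2, m2⟩ := he' 2 u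
    obtain ⟨d3, m3⟩ := he' 3 u
    simp only [m0, m1, m2, m3, map_smul, LinearMap.smul_apply, smul_eq_mul, abs_mul]
    have := mul_le_mul_of_nonneg_left key
      (by positivity : 0 ≤ |d0| * |d1| * |d2| * |d3|)
    rw [abs_mul, abs_mul] at this
    unfold pairing at this
    linarith
  have hΩne : ∀ x ∈ Ω, ∀ y ∈ Ω, x ≠ y → pairing Q (ξ x) (ξ y) ≠ 0 := by
    classical
    intro x hx y hy hxy
    obtain ⟨z, hz, hz'⟩ := exists_mem_dense_notMem hV hω hΩ {x, y}
    simp only [Finset.mem_insert, Finset.mem_singleton, not_or] at hz'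
    exact hadm.pairing_ne_zero hx hy hz hxy (Ne.symm hz'.2) (Ne.symm hz'.1)
  -- If the pairing vanished, Ptolemy with zero right-hand side would make `ξ a` orthogonal to `ξ y`
  -- for the other points `y` of `Ω`, hence to a positive triple.
  have hne1 : ∀ a, ∀ x ∈ Ω, a ≠ x → pairing Q (ξ a) (ξ x) ≠ 0 := by
    classical
    intro a x hx hax h0
    have hort : ∀ y ∈ Ω, y ≠ x → y ≠ a → pairing Q (ξ y) (ξ a) = 0 := by
      intro y hy hyx hya
      obtain ⟨z, hz, hsep⟩ := exists_separated hV hω hΩ hya.symm hyx hax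
      have h1 := ptolemy _ _ _ _ hsep
      rw [h0, abs_zero, zero_mul] at h1
      have h2 := abs_pos.2 (hΩne x hx z hz hsep.ne.2.2.2.1)
      have h3 : |pairing Q (ξ a) (ξ y)| * |pairing Q (ξ x) (ξ z)| ≤ 0 := by
        have : 0 ≤ |pairing Q (ξ a) (ξ z)| * |pairing Q (ξ y) (ξ x)| := by positivity
        linarith
      have h4 : |pairing Q (ξ a) (ξ y)| ≤ 0 := nonpos_of_mul_nonpos_left h3 h2
      rw [pairing_comm]
      exact abs_eq_zero.1 (h4.antisymm (abs_nonneg _))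
    obtain ⟨y, hy, hy'⟩ := exists_mem_dense_notMem hV hω hΩ {x, a}
    simp only [Finset.mem_insert, Finset.mem_singleton, not_or] at hy'
    obtain ⟨z, hz, hz'⟩ := exists_mem_dense_notMem hV hω hΩ {x, a, y}
    simp only [Finset.mem_insert, Finset.mem_singleton, not_or] at hz'
    refine (ξ a).1.rep_nonzero (triple_orthogonal_eq_zero hQ (ξ x).2 (ξ y).2 (ξ z).2
      (hadm.triple x hx y hy z hz (Ne.symm hy'.1) (Ne.symm hz'.2.2) (Ne.symm hz'.1)) (ξ a).2
      ?_ (hort y hy hy'.1 hy'.2) (hort z hz hz'.1 hz'.2.1))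
    rw [bil_comm]
    exact h0
  -- With `x` and `z` in `Ω` separated by `a` and `b`, Ptolemy bounds the product of the nonzero
  -- pairings of `a, x` and `b, z` by a multiple of the pairing of `a, b`.
  have hne2 : ∀ a b, a ≠ b → pairing Q (ξ a) (ξ b) ≠ 0 := by
    classical
    intro a b hab h0
    obtain ⟨x, hx, hx'⟩ := exists_mem_dense_notMem hV hω hΩ {a, b}
    simp only [Finset.mem_insert, Finset.mem_singleton, not_or] at hx'
    obtain ⟨z, hz, hsep⟩ := exists_separated hV hω hΩ (Ne.symm hx'.1) hx'.2 hab
    have h1 := ptolemy _ _ _ _ hsep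
    rw [h0, abs_zero, zero_mul] at h1
    have h2 := abs_pos.2 (hne1 a x hx (Ne.symm hx'.1))
    have h3 := abs_pos.2 (hne1 b z hz hsep.ne.2.2.2.1)
    have : 0 ≤ |pairing Q (ξ a) (ξ z)| * |pairing Q (ξ x) (ξ b)| := by positivity
    have := mul_pos h2 h3
    linarith
  refine ⟨fun x _ y _ z _ hxy hyz hxz => ?_, fun w _ x _ y _ z _ => ptolemy w x y z,
    fun x _ y _ z _ t _ => crossRatio x y z t⟩
  refine lt_of_le_of_ne ?_ (mul_ne_zero (mul_ne_zero (hne2 x y hxy) (hne2 y z hyz))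
    (hne2 z x hxz.symm))
  -- Only three points matter; the fourth entry is padding.
  obtain ⟨l, hl, hmem, hlim, e, v, he, hv, he', hv'⟩ := approx ![x, y, z, z]
  have hB : ∀ i j, Tendsto (fun u => bil Q (e i u) (e j u)) l _ := fun i j =>
    tendsto_bilinear (bil Q) (he i) (he j)
  have e1 := ((hlim 0).prodMk_nhds (hlim 1)).eventually
    ((isOpen_ne_fun continuous_fst continuous_snd).mem_nhds hxy)
  have e2 := ((hlim 1).prodMk_nhds (hlim 2)).eventually
    ((isOpen_ne_fun continuous_fst continuous_snd).mem_nhds hyz)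
  have e3 := ((hlim 0).prodMk_nhds (hlim 2)).eventually
    ((isOpen_ne_fun continuous_fst continuous_snd).mem_nhds hxz)
  refine le_of_tendsto (((hB 0 1).mul (hB 1 2)).mul (hB 2 0)) ?_
  filter_upwards [e1, e2, e3, hmem 0, hmem 1, hmem 2] with u e1 e2 e3 h0 h1 h2
  have key := hadm.triple _ h0 _ h1 _ h2 e1 e2 e3
  obtain ⟨d0, m0⟩ := he' 0 u
  obtain ⟨d1, m1⟩ := he' 1 u
  obtain ⟨d2, m2⟩ := he' 2 u
  simp only [m0, m1, m2, map_smul, LinearMap.smul_apply, smul_eq_mul]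
  have := mul_nonneg (sq_nonneg (d0 * d1 * d2)) (neg_nonneg.2 key.le)
  unfold pairing at this
  linarith

end

end QSEinstein

/-! ### Visual distance of a positive plane, and the barycentric plane of a triple. -/

namespace QSEinstein

noncomputable section

open Filter Topology

variable {E : Type*} [AddCommGroup E] [Module ℝ E] {Q : QuadraticForm ℝ E}

/-- `e₁, e₂` is an orthonormal basis of the plane `U`. -/
structure IsOrthonormalBasis (Q : QuadraticForm ℝ E) (U : Submodule ℝ E) (e₁ e₂ : E) : Prop where
  map_fst : Q e₁ = 1
  map_snd : Q e₂ = 1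
  ortho : bil Q e₁ e₂ = 0
  mem_iff : ∀ u, u ∈ U ↔ ∃ s t : ℝ, u = s • e₁ + t • e₂

namespace IsOrthonormalBasis

variable {U : Submodule ℝ E} {e₁ e₂ : E}

lemma proj_mem (h : IsOrthonormalBasis Q U e₁ e₂) (s t : ℝ) : s • e₁ + t • e₂ ∈ U :=
  (h.mem_iff _).2 ⟨s, t, rfl⟩

lemma mem_orthogonal_iff (h : IsOrthonormalBasis Q U e₁ e₂) (w : E) :
    w ∈ (bil Q).orthogonal U ↔ bil Q e₁ w = 0 ∧ bil Q e₂ w = 0 := by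
  rw [LinearMap.BilinForm.mem_orthogonal_iff]
  constructor
  · intro hw
    exact ⟨hw e₁ ((h.mem_iff _).2 ⟨1, 0, by simp⟩), hw e₂ ((h.mem_iff _).2 ⟨0, 1, by simp⟩)⟩
  · rintro ⟨h1, h2⟩ u hu
    obtain ⟨s, t, rfl⟩ := (h.mem_iff _).1 hu
    simp [h1, h2]

lemma sub_proj_mem (h : IsOrthonormalBasis Q U e₁ e₂) (g : E) :
    g - (bil Q g e₁ • e₁ + bil Q g e₂ • e₂) ∈ (bil Q).orthogonal U := by
  rw [h.mem_orthogonal_iff]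
  simp [bil_self, h.map_fst, h.map_snd, h.ortho, bil_comm e₂ e₁, bil_comm g]

lemma map_lin (h : IsOrthonormalBasis Q U e₁ e₂) (s t : ℝ) :
    Q (s • e₁ + t • e₂) = s ^ 2 + t ^ 2 := by
  simp only [← bil_self, map_add, map_smul, LinearMap.add_apply, LinearMap.smul_apply,
    smul_eq_mul, h.ortho, bil_comm e₂ e₁]
  simp only [bil_self, h.map_fst, h.map_snd]
  ring

lemma bil_lin (h : IsOrthonormalBasis Q U e₁ e₂) (s t s' t' : ℝ) :
    bil Q (s • e₁ + t • e₂) (s' • e₁ + t' • e₂) = s * s' + t * t' := by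
  simp only [map_add, map_smul, LinearMap.add_apply, LinearMap.smul_apply,
    smul_eq_mul, h.ortho, bil_comm e₂ e₁]
  simp only [bil_self, h.map_fst, h.map_snd]
  ring

lemma bil_eq_zero (h : IsOrthonormalBasis Q U e₁ e₂) {u v : E} (hu : u ∈ U)
    (hv : v ∈ (bil Q).orthogonal U) : bil Q u v = 0 := by
  obtain ⟨s, t, rfl⟩ := (h.mem_iff _).1 hu
  obtain ⟨h1, h2⟩ := (h.mem_orthogonal_iff _).1 hv
  simp [h1, h2]

lemma neg_orthogonal (h : IsOrthonormalBasis Q U e₁ e₂) {q : ℕ} (hQ : HasSignature Q 2 q) {w : E}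
    (hw : w ∈ (bil Q).orthogonal U) (hw0 : w ≠ 0) : Q w < 0 := by
  obtain ⟨h1, h2⟩ := (h.mem_orthogonal_iff _).1 hw
  exact neg_of_orthogonal hQ (by rw [h.map_fst]; norm_num)
    (by rw [h.map_fst, h.map_snd, h.ortho]; norm_num) h1 h2 hw0

lemma nonpos_orthogonal (h : IsOrthonormalBasis Q U e₁ e₂) {q : ℕ} (hQ : HasSignature Q 2 q)
    {w : E} (hw : w ∈ (bil Q).orthogonal U) : Q w ≤ 0 := by
  rcases eq_or_ne w 0 with rfl | hw0
  · simp
  · exact (h.neg_orthogonal hQ hw hw0).le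

/-- The Cauchy-Schwarz inequality on the orthogonal of the plane. -/
lemma cauchy_schwarz_orthogonal (h : IsOrthonormalBasis Q U e₁ e₂) {q : ℕ}
    (hQ : HasSignature Q 2 q) {v w : E} (hv : v ∈ (bil Q).orthogonal U)
    (hw : w ∈ (bil Q).orthogonal U) : bil Q v w ^ 2 ≤ Q v * Q w := by
  have hquad : ∀ t : ℝ, 0 ≤ -Q w * (t * t) + (-2 * bil Q v w) * t + -Q v := by
    intro t
    have h1 := h.nonpos_orthogonal hQ (Submodule.add_mem _ hv (Submodule.smul_mem _ t hw))
    rw [map_add_bil, QuadraticMap.map_smul, map_smul, smul_eq_mul, smul_eq_mul] at h1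
    linarith
  have := discrim_le_zero hquad
  rw [discrim] at this
  linarith

/-- The decomposition of an isotropic vector. -/
lemma exists_decomposition (h : IsOrthonormalBasis Q U e₁ e₂) {X : E} (hX : Q X = 0) {r : ℝ}
    (hr : 0 < r) (hr2 : r ^ 2 = bil Q X e₁ ^ 2 + bil Q X e₂ ^ 2) :
    ∃ v ∈ (bil Q).orthogonal U,
      ((bil Q X e₁ / r) • e₁ + (bil Q X e₂ / r) • e₂) + v = r⁻¹ • X ∧
      Q ((bil Q X e₁ / r) • e₁ + (bil Q X e₂ / r) • e₂) = 1 ∧ -Q v = 1 := by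
  set s := bil Q X e₁
  set t := bil Q X e₂
  have hmem := Submodule.smul_mem _ r⁻¹ (h.sub_proj_mem X)
  have hadd : ((s / r) • e₁ + (t / r) • e₂) + r⁻¹ • (X - (s • e₁ + t • e₂)) = r⁻¹ • X := by
    rw [smul_sub, smul_add, smul_smul, smul_smul, div_eq_inv_mul, div_eq_inv_mul]
    abel
  have h1 : Q ((s / r) • e₁ + (t / r) • e₂) = 1 := by
    rw [h.map_lin, div_pow, div_pow, ← add_div, ← hr2]
    exact div_self (by positivity)
  refine ⟨_, hmem, hadd, h1, ?_⟩
  have h2 := congrArg Q hadd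
  rw [map_add_bil, h1, h.bil_eq_zero (h.proj_mem _ _) hmem, QuadraticMap.map_smul Q r⁻¹ X, hX] at h2
  simp only [smul_zero, mul_zero, add_zero] at h2
  linarith

/-- An isotropic vector without component in the plane would lie in its negative definite
orthogonal. -/
lemma exists_pos_decomposition (h : IsOrthonormalBasis Q U e₁ e₂) {q : ℕ}
    (hQ : HasSignature Q 2 q) {X : E} (hX : Q X = 0) (hX0 : X ≠ 0) :
    0 < bil Q X e₁ ^ 2 + bil Q X e₂ ^ 2 := by
  by_contra! hle
  have h1 : bil Q X e₁ = 0 := by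
    have : bil Q X e₁ ^ 2 = 0 := by nlinarith [sq_nonneg (bil Q X e₁), sq_nonneg (bil Q X e₂)]
    exact pow_eq_zero_iff (two_ne_zero) |>.1 this
  have h2 : bil Q X e₂ = 0 := by
    have : bil Q X e₂ ^ 2 = 0 := by nlinarith [sq_nonneg (bil Q X e₁), sq_nonneg (bil Q X e₂)]
    exact pow_eq_zero_iff (two_ne_zero) |>.1 this
  have := h.neg_orthogonal hQ ((h.mem_orthogonal_iff X).2 ⟨by rw [bil_comm, h1],
    by rw [bil_comm, h2]⟩) hX0
  linarith

end IsOrthonormalBasis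

lemma visualDistPlane_nonneg (U : Submodule ℝ E) (x y : EinsteinUniverse Q) :
    0 ≤ visualDistPlane Q U x y := by
  refine Real.sInf_nonneg ?_
  rintro r ⟨u, -, v, -, u', -, v', -, -, -, -, -, -, -, rfl⟩
  exact Real.sqrt_nonneg _

/-- Jordan's inequality at the half-angle: `2 - 2 cos θ = 4 sin² (θ / 2) ≥ 4 θ² / π²`. -/
lemma arccos_sq_le {c : ℝ} (hc : -1 ≤ c) (hc1 : c ≤ 1) :
    Real.arccos c ^ 2 ≤ Real.pi ^ 2 / 4 * (2 - 2 * c) := by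
  have h0 := Real.arccos_nonneg c
  have hpi := Real.arccos_le_pi c
  have h1 := Real.mul_le_sin (x := Real.arccos c / 2) (by linarith) (by linarith)
  have h2 : c = 1 - 2 * Real.sin (Real.arccos c / 2) ^ 2 := by
    rw [Real.sin_sq_eq_half_sub, mul_div_cancel₀ _ (two_ne_zero), Real.cos_arccos hc hc1]
    ring
  have h3 : Real.arccos c / Real.pi ≤ Real.sin (Real.arccos c / 2) := by
    refine le_trans (le_of_eq ?_) h1
    field_simp
  have h4 : 0 ≤ Real.arccos c / Real.pi := div_nonneg h0 Real.pi_pos.le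
  have h5 := pow_le_pow_left₀ h4 h3 2
  rw [div_pow, div_le_iff₀ (by positivity)] at h5
  nlinarith

/-- For two points in spacelike position, the visual distance is controlled by the components in
the positive definite plane. -/
lemma visualDistPlane_le {U : Submodule ℝ E} {e₁ e₂ : E} (h : IsOrthonormalBasis Q U e₁ e₂)
    {x y : EinsteinUniverse Q} {X Y : E} (hX : X ∈ x.1.submodule) (hY : Y ∈ y.1.submodule)
    (hQX : Q X = 0) (hQY : Q Y = 0) (hXY : bil Q X Y ≤ 0) {m δ : ℝ} (hm : 0 < m)
    (hmX : m ^ 2 ≤ bil Q X e₁ ^ 2 + bil Q X e₂ ^ 2) (hmY : m ^ 2 ≤ bil Q Y e₁ ^ 2 + bil Q Y e₂ ^ 2)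
    (h1 : |bil Q X e₁ - bil Q Y e₁| ≤ δ) (h2 : |bil Q X e₂ - bil Q Y e₂| ≤ δ) :
    visualDistPlane Q U x y ≤ Real.pi * (δ / m) := by
  have hδ : 0 ≤ δ := (abs_nonneg _).trans h1
  set x₁ := bil Q X e₁
  set x₂ := bil Q X e₂
  set y₁ := bil Q Y e₁
  set y₂ := bil Q Y e₂
  have hm2 : 0 < m ^ 2 := by positivity
  set r := Real.sqrt (x₁ ^ 2 + x₂ ^ 2) with hr
  set r' := Real.sqrt (y₁ ^ 2 + y₂ ^ 2) with hr'
  have hr0 : 0 < r := Real.sqrt_pos.2 (by linarith)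
  have hr0' : 0 < r' := Real.sqrt_pos.2 (by linarith)
  have hrr : r ^ 2 = x₁ ^ 2 + x₂ ^ 2 := Real.sq_sqrt (by positivity)
  have hrr' : r' ^ 2 = y₁ ^ 2 + y₂ ^ 2 := Real.sq_sqrt (by positivity)
  have hmr : m ≤ r := by rw [hr]; exact Real.le_sqrt_of_sq_le hmX
  have hmr' : m ≤ r' := by rw [hr']; exact Real.le_sqrt_of_sq_le hmY
  obtain ⟨v, hv, hadd, hu1, hv1⟩ := h.exists_decomposition hQX hr0 hrr
  obtain ⟨v', hv', hadd', hu1', hv1'⟩ := h.exists_decomposition hQY hr0' hrr'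
  set u := (x₁ / r) • e₁ + (x₂ / r) • e₂ with hu
  set u' := (y₁ / r') • e₁ + (y₂ / r') • e₂ with hu'
  have humem : u ∈ U := h.proj_mem _ _
  have humem' : u' ∈ U := h.proj_mem _ _
  have hle : visualDistPlane Q U x y ≤
      Real.sqrt (Real.arccos (bil Q u u') ^ 2 + Real.arccos (-bil Q v v') ^ 2) := by
    refine csInf_le ⟨0, ?_⟩ ⟨u, humem, v, hv, u', humem', v', hv', ?_, hu1, hv1, ?_, hu1', hv1',
      rfl⟩
    · rintro r ⟨u, -, v, -, u', -, v', -, -, -, -, -, -, -, rfl⟩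
      exact Real.sqrt_nonneg _
    · rw [hadd]
      exact Submodule.smul_mem _ _ hX
    · rw [hadd']
      exact Submodule.smul_mem _ _ hY
  -- This is where the sign of `⟨X, Y⟩` enters: `⟨u, u'⟩ ≤ -⟨v, v'⟩`, so the spherical angle is at
  -- most the angle in the plane.
  have hsum : bil Q u u' + bil Q v v' ≤ 0 := by
    have e1 : bil Q (u + v) (u' + v') = bil Q u u' + bil Q v v' := by
      simp only [map_add, LinearMap.add_apply, h.bil_eq_zero humem hv', bil_comm v u',
        h.bil_eq_zero humem' hv]
      ring
    rw [← e1, hadd, hadd']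
    simp only [map_smul, LinearMap.smul_apply, smul_eq_mul]
    have : 0 ≤ r'⁻¹ * r⁻¹ := by positivity
    nlinarith
  have hc : bil Q u u' = (x₁ * y₁ + x₂ * y₂) / (r * r') := by
    rw [hu, hu', h.bil_lin]
    field_simp
  have hcs : (x₁ * y₁ + x₂ * y₂) ^ 2 ≤ (r * r') ^ 2 := by
    rw [mul_pow, hrr, hrr']
    nlinarith [sq_nonneg (x₁ * y₂ - x₂ * y₁)]
  have habs := abs_le_of_sq_le_sq' hcs (by positivity)
  have hc1 : -1 ≤ bil Q u u' := by
    rw [hc, le_div_iff₀ (by positivity)]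
    linarith [habs.1]
  have hc2 : bil Q u u' ≤ 1 := by
    rw [hc, div_le_iff₀ (by positivity)]
    linarith [habs.2]
  have hθ := arccos_sq_le hc1 hc2
  have hφ : Real.arccos (-bil Q v v') ^ 2 ≤ Real.arccos (bil Q u u') ^ 2 :=
    pow_le_pow_left₀ (Real.arccos_nonneg _) (Real.antitone_arccos (by linarith)) 2
  -- The inequality `2 r r' ≤ r² + r'²` bounds the chord of the unit vectors by the distance of the
  -- components divided by `√(r r') ≥ m`.
  have hδ2 : 2 - 2 * bil Q u u' ≤ 2 * (δ / m) ^ 2 := by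
    have e1 : (x₁ - y₁) ^ 2 ≤ δ ^ 2 := sq_le_sq' (by linarith [neg_abs_le (x₁ - y₁)])
      ((le_abs_self _).trans h1)
    have e2 : (x₂ - y₂) ^ 2 ≤ δ ^ 2 := sq_le_sq' (by linarith [neg_abs_le (x₂ - y₂)])
      ((le_abs_self _).trans h2)
    have e3 : 2 * (r * r') - 2 * (x₁ * y₁ + x₂ * y₂) ≤ 2 * δ ^ 2 := by
      have e0 : 2 * (r * r') ≤ r ^ 2 + r' ^ 2 := by linarith [sq_nonneg (r - r')]
      rw [hrr, hrr'] at e0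
      linarith
    have e4 : m ^ 2 ≤ r * r' := by
      rw [sq]
      exact mul_le_mul hmr hmr' hm.le hr0.le
    have e5 : 2 - 2 * bil Q u u' = (2 * (r * r') - 2 * (x₁ * y₁ + x₂ * y₂)) / (r * r') := by
      rw [hc]
      field_simp
    rw [e5, div_pow]
    calc _ ≤ 2 * δ ^ 2 / (r * r') := by gcongr
      _ ≤ 2 * δ ^ 2 / m ^ 2 := by gcongr
      _ = _ := by ring
  refine hle.trans (Real.sqrt_le_iff.2 ⟨by positivity, ?_⟩)
  have hpi : 0 < Real.pi ^ 2 / 4 := by positivity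
  calc _ ≤ 2 * (Real.pi ^ 2 / 4 * (2 - 2 * bil Q u u')) := by linarith
    _ ≤ 2 * (Real.pi ^ 2 / 4 * (2 * (δ / m) ^ 2)) := by gcongr
    _ = _ := by ring

/-- The three equations force `α² = -q / (p r)`, which is positive exactly because `p q r < 0`. -/
lemma exists_normalized_lifts {x y z : E} (h : bil Q x y * bil Q y z * bil Q z x < 0) :
    ∃ α β γ : ℝ, α ≠ 0 ∧ β ≠ 0 ∧ γ ≠ 0 ∧ bil Q (α • x) (β • y) = -1 ∧
      bil Q (β • y) (γ • z) = -1 ∧ bil Q (α • x) (γ • z) = -1 := by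
  set p := bil Q x y with hp
  set q := bil Q y z with hq
  set r := bil Q z x with hr
  have hp0 : p ≠ 0 := by rintro h0; simp [h0] at h
  have hq0 : q ≠ 0 := by rintro h0; simp [h0] at h
  have hr0 : r ≠ 0 := by rintro h0; simp [h0] at h
  have hpos : 0 < -(q / (p * r)) := by
    have : -(q / (p * r)) = -(p * q * r) / (p * r) ^ 2 := by field_simp
    rw [this]
    exact div_pos (by linarith) (by positivity)
  set α := Real.sqrt (-(q / (p * r))) with hα
  have hα0 : 0 < α := Real.sqrt_pos.2 hpos
  have hα2 : α ^ 2 = -(q / (p * r)) := Real.sq_sqrt hpos.le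
  refine ⟨α, -(α * p)⁻¹, -(α * r)⁻¹, hα0.ne', by simp [hα0.ne', hp0], by simp [hα0.ne', hr0],
    ?_, ?_, ?_⟩
  · simp only [map_smul, LinearMap.smul_apply, smul_eq_mul, ← hp]
    field_simp
  · simp only [map_smul, LinearMap.smul_apply, smul_eq_mul, ← hq]
    have : -(α * r)⁻¹ * (-(α * p)⁻¹ * q) = q / (p * r) / α ^ 2 := by field_simp
    rw [this, hα2]
    field_simp
  · simp only [map_smul, LinearMap.smul_apply, smul_eq_mul, bil_comm x z, ← hr]
    field_simp

/-- An orthonormal basis of the barycentric plane. -/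
lemma barycentricPlane_basis {x y z : EinsteinUniverse Q} {a b c : E} {α β γ : ℝ} (hα : α ≠ 0)
    (hβ : β ≠ 0) (hγ : γ ≠ 0) (ha : a = α • x.1.rep) (hb : b = β • y.1.rep) (hc : c = γ • z.1.rep)
    (hab : bil Q a b = -1) (hbc : bil Q b c = -1) (hac : bil Q a c = -1) :
    IsOrthonormalBasis Q (barycentricPlane Q x y z) ((Real.sqrt 6)⁻¹ • ((2 : ℝ) • a - b - c))
      ((Real.sqrt 2)⁻¹ • (b - c)) := by
  have qa : Q a = 0 := by rw [ha, QuadraticMap.map_smul, x.2, smul_zero]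
  have qb : Q b = 0 := by rw [hb, QuadraticMap.map_smul, y.2, smul_zero]
  have qc : Q c = 0 := by rw [hc, QuadraticMap.map_smul, z.2, smul_zero]
  have hba : bil Q b a = -1 := by rw [bil_comm, hab]
  have hcb : bil Q c b = -1 := by rw [bil_comm, hbc]
  have hca : bil Q c a = -1 := by rw [bil_comm, hac]
  have s6 : (Real.sqrt 6)⁻¹ * (Real.sqrt 6)⁻¹ = 1 / 6 := by
    rw [← mul_inv, Real.mul_self_sqrt (by norm_num)]
    norm_num
  have s2 : (Real.sqrt 2)⁻¹ * (Real.sqrt 2)⁻¹ = 1 / 2 := by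
    rw [← mul_inv, Real.mul_self_sqrt (by norm_num)]
    norm_num
  have hp : pairing Q x y = -(α * β)⁻¹ := by
    rw [ha, hb] at hab
    simp only [map_smul, LinearMap.smul_apply, smul_eq_mul] at hab
    rw [pairing]
    field_simp
    linarith
  have hq : pairing Q y z = -(β * γ)⁻¹ := by
    rw [hb, hc] at hbc
    simp only [map_smul, LinearMap.smul_apply, smul_eq_mul] at hbc
    rw [pairing]
    field_simp
    linarith
  have hr : pairing Q z x = -(γ * α)⁻¹ := by
    rw [ha, hc] at hca
    simp only [map_smul, LinearMap.smul_apply, smul_eq_mul] at hca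
    rw [pairing]
    field_simp
    linarith
  -- For normalized lifts the barycenter is a multiple of `a + b + c`, so the plane is the set of
  -- combinations with coefficients of sum zero. There `2a - b - c` and `b - c` are orthogonal, of
  -- squares `6` and `2`.
  have hbar : barycenter Q x y z = -(α * β * γ)⁻¹ • (a + b + c) := by
    rw [barycenter, hp, hq, hr, ha, hb, hc, smul_add, smul_add, smul_smul, smul_smul, smul_smul]
    congr 2
    · congr 1
      field_simp
    · field_simp
    · field_simp
  have hspan : ∀ u, u ∈ tripleSpan Q x y z ↔ ∃ r s t : ℝ, r • a + s • b + t • c = u := by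
    intro u
    rw [tripleSpan_eq, mem_span_three]
    constructor
    · rintro ⟨r, s, t, rfl⟩
      refine ⟨r / α, s / β, t / γ, ?_⟩
      rw [ha, hb, hc, smul_smul, smul_smul, smul_smul, div_mul_cancel₀ _ hα,
        div_mul_cancel₀ _ hβ, div_mul_cancel₀ _ hγ]
    · rintro ⟨r, s, t, rfl⟩
      exact ⟨r * α, s * β, t * γ, by rw [ha, hb, hc, smul_smul, smul_smul, smul_smul]⟩
  refine ⟨?_, ?_, ?_, fun u => ?_⟩
  · rw [QuadraticMap.map_smul, s6, ← bil_self]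
    simp only [map_sub, map_smul, LinearMap.sub_apply, LinearMap.smul_apply, smul_eq_mul, hab, hba,
      hbc, hcb, hac, hca, bil_self, qa, qb, qc]
    norm_num
  · rw [QuadraticMap.map_smul, s2, ← bil_self]
    simp only [map_sub, LinearMap.sub_apply, smul_eq_mul, hbc, hcb, bil_self, qb, qc]
    norm_num
  · simp only [map_sub, map_smul, LinearMap.sub_apply, LinearMap.smul_apply, smul_eq_mul, hab,
      hbc, hcb, hac, bil_self, qb, qc]
    ring
  · rw [barycentricPlane, Submodule.mem_inf, hspan, LinearMap.mem_ker, hbar]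
    constructor
    · rintro ⟨⟨r, s, t, rfl⟩, h0⟩
      have hsum : r + s + t = 0 := by
        simp only [map_add, map_smul, LinearMap.add_apply, LinearMap.smul_apply, smul_eq_mul, hab,
          hba, hbc, hcb, hac, hca, bil_self, qa, qb, qc] at h0
        have hne : (α * β * γ)⁻¹ ≠ 0 := by positivity
        have : (α * β * γ)⁻¹ * (2 * (r + s + t)) = 0 := by linear_combination h0
        have := (mul_eq_zero.1 this).resolve_left hne
        linarith
      refine ⟨r / 2 * Real.sqrt 6, (s - t) / 2 * Real.sqrt 2, ?_⟩
      rw [smul_smul, smul_smul, mul_assoc, mul_assoc, mul_inv_cancel₀ (by positivity),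
        mul_inv_cancel₀ (by positivity)]
      have hr : r = -s - t := by linarith
      subst hr
      module
    · rintro ⟨s, t, rfl⟩
      refine ⟨⟨s * (Real.sqrt 6)⁻¹ * 2, -(s * (Real.sqrt 6)⁻¹) + t * (Real.sqrt 2)⁻¹,
        -(s * (Real.sqrt 6)⁻¹) - t * (Real.sqrt 2)⁻¹, by module⟩, ?_⟩
      simp only [map_add, map_sub, map_smul, LinearMap.add_apply, LinearMap.smul_apply,
        smul_eq_mul, hab, hba, hbc, hcb, hac, hca, bil_self, qa, qb, qc]
      ring

end

end QSEinstein

/-! ### Comparison with the visual distance of the line, and the uniform Hölder estimate. -/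

namespace QSEinstein

noncomputable section

open Filter Topology

variable {V : Type*} [AddCommGroup V] [Module ℝ V] {ω : V [⋀^Fin 2]→ₗ[ℝ] ℝ}
  {E : Type*} [AddCommGroup E] [Module ℝ E] {Q : QuadraticForm ℝ E} {A B : ℝ}
  {Ω : Set (ℙ ℝ V)} {ξ : ℙ ℝ V → EinsteinUniverse Q}

lemma barycenterForm_chart {a b c : ℙ ℝ V} {w : V} {β γ : ℝ}
    (hb : b.rep = β • w) (hc : c.rep = γ • (w + a.rep)) (s t cs ct : ℝ) :
    barycenterForm ω a b c (cs • (w + s • a.rep)) (ct • (w + t • a.rep)) =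
      cs * ct * (β ^ 2 * γ ^ 2 * area ω a.rep w ^ 4) * (2 + 2 * (s * t) - s - t) := by
  simp only [barycenterForm, area_apply, hb, hc, map_add, map_smul, LinearMap.add_apply,
    LinearMap.smul_apply, area_self, smul_eq_mul, area_swap w a.rep]
  ring

/-- In the affine chart in which the triple is `∞, 0, 1`, the visual distance dominates the
Euclidean distance on bounded sets. -/
lemma abs_sub_le_visualDistLine {a b c : ℙ ℝ V} {w : V} (h : area ω a.rep w ≠ 0) {β γ : ℝ}
    (hβ : β ≠ 0) (hγ : γ ≠ 0) (hb : b.rep = β • w) (hc : c.rep = γ • (w + a.rep)) {s t : ℝ}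
    (hs : |s| ≤ 2) (ht : |t| ≤ 2) :
    |s - t| ≤ 7 * visualDistLine ω a b c (chart a.rep w h s) (chart a.rep w h t) := by
  obtain ⟨cs, hcs, hrs⟩ := exists_chart_rep h s
  obtain ⟨ct, hct, hrt⟩ := exists_chart_rep h t
  rw [abs_le] at hs ht
  set K := β ^ 2 * γ ^ 2 * area ω a.rep w ^ 4 with hK
  have hK0 : 0 < K := by
    rw [hK]
    positivity
  set S := 2 + 2 * (s * s) - s - s with hS
  set T := 2 + 2 * (t * t) - t - t with hT
  have hS0 : 0 < S := by rw [hS]; nlinarith [sq_nonneg (s - 1 / 2)]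
  have hT0 : 0 < T := by rw [hT]; nlinarith [sq_nonneg (t - 1 / 2)]
  -- For `|s| ≤ 2`, `2 + 2s² - 2s ≤ 2 + 8 + 4`. The sine of the angle is then at least `|s - t| /
  -- 14`, and the visual distance is twice the angle, whence the constant `7`.
  have hS7 : S ≤ 14 := by rw [hS]; nlinarith
  have hT7 : T ≤ 14 := by rw [hT]; nlinarith
  set N := 2 + 2 * (s * t) - s - t with hN
  have hdisc : S * T - N ^ 2 = 3 * (s - t) ^ 2 := by rw [hS, hT, hN]; ring
  have hcK : 0 < |cs| * |ct| * K := by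
    have := abs_pos.2 hcs
    have := abs_pos.2 hct
    positivity
  have hρ : |barycenterForm ω a b c (chart a.rep w h s).rep (chart a.rep w h t).rep| /
      Real.sqrt (barycenterForm ω a b c (chart a.rep w h s).rep (chart a.rep w h s).rep *
        barycenterForm ω a b c (chart a.rep w h t).rep (chart a.rep w h t).rep) =
      |N| / Real.sqrt (S * T) := by
    rw [hrs, hrt, barycenterForm_chart hb hc, barycenterForm_chart hb hc,
      barycenterForm_chart hb hc, ← hK, ← hN, ← hS, ← hT]
    have e1 : cs * cs * K * S * (ct * ct * K * T) = (|cs| * |ct| * K) ^ 2 * (S * T) := by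
      rw [mul_pow, mul_pow, sq_abs, sq_abs]
      ring
    rw [e1, Real.sqrt_mul (by positivity), Real.sqrt_sq hcK.le, abs_mul, abs_mul, abs_mul,
      abs_of_pos hK0, mul_div_mul_left _ _ hcK.ne']
  rw [visualDistLine, hρ]
  set ρ := |N| / Real.sqrt (S * T) with hρ'
  have hρ2 : 1 - ρ ^ 2 = 3 * (s - t) ^ 2 / (S * T) := by
    rw [hρ', div_pow, sq_abs, Real.sq_sqrt (by positivity), ← hdisc]
    field_simp
  have h1 : ((s - t) / 14) ^ 2 ≤ 1 - ρ ^ 2 := by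
    rw [hρ2, div_pow, div_le_div_iff₀ (by norm_num) (by positivity)]
    have : S * T ≤ 14 * 14 := by gcongr
    nlinarith [mul_le_mul_of_nonneg_left this (sq_nonneg (s - t)), sq_nonneg (s - t)]
  have h2 : |s - t| / 14 ≤ Real.sin (Real.arccos ρ) := by
    rw [Real.sin_arccos]
    refine Real.le_sqrt_of_sq_le ?_
    rwa [div_pow, sq_abs, ← div_pow]
  have h3 := Real.sin_le (Real.arccos_nonneg ρ)
  linarith

lemma visualDistLine_nonneg (a b c x y : ℙ ℝ V) : 0 ≤ visualDistLine ω a b c x y :=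
  mul_nonneg zero_le_two (Real.arccos_nonneg _)

lemma visualDistLine_rotate (a b c x y : ℙ ℝ V) :
    visualDistLine ω b c a x y = visualDistLine ω a b c x y := by
  have : ∀ v w, barycenterForm ω b c a v w = barycenterForm ω a b c v w := by
    intro v w
    unfold barycenterForm
    ring
  simp only [visualDistLine, this]

lemma visualDist_rotate (a b c x y : EinsteinUniverse Q) :
    visualDist Q b c a x y = visualDist Q a b c x y := by
  have h1 : tripleSpan Q b c a = tripleSpan Q a b c := by
    rw [tripleSpan, tripleSpan, sup_comm, sup_assoc]
  have h2 : barycenter Q b c a = barycenter Q a b c := by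
    unfold barycenter
    abel
  rw [visualDist, visualDist, barycentricPlane, barycentricPlane, h1, h2]

lemma mem_submodule_chartLift (a : E) (v w : V) (h : area ω v w ≠ 0) (t : ℝ) :
    chartLift ξ a v w h t ∈ (ξ (chart v w h t)).1.submodule := by
  rw [chartLift, Projectivization.submodule_eq]
  exact Submodule.smul_mem _ _ (Submodule.mem_span_singleton_self _)

lemma IsTimelikeCurve.bil_nonpos {a : E} {D : Set ℝ} {F : ℝ → E}
    (h : IsTimelikeCurve Q A B a D F) {s t : ℝ} (hs : s ∈ D) (ht : t ∈ D) :
    bil Q (F s) (F t) ≤ 0 := by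
  rcases lt_trichotomy s t with hst | rfl | hst
  · exact (h.bil_neg s hs t ht hst).le
  · rw [bil_self, h.map_eq s hs]
  · rw [bil_comm]
    exact (h.bil_neg t ht s hs hst).le

/-- Along a normalized curve, the component in the barycentric plane is bounded below. -/
lemma component_lower_bound {q : ℕ} (hQ : HasSignature Q 2 q) {U : Submodule ℝ E} {a b c X : E}
    (hab : bil Q a b = -1) (hbc : bil Q b c = -1) (hac : bil Q a c = -1) (ha : Q a = 0)
    (hb : Q b = 0) (hc : Q c = 0)
    (hU : IsOrthonormalBasis Q U ((Real.sqrt 6)⁻¹ • ((2 : ℝ) • a - b - c))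
      ((Real.sqrt 2)⁻¹ • (b - c))) (hX : Q X = 0) (haX : bil Q a X = -1) (hbX : bil Q b X ≤ 0)
    (hcX : bil Q c X ≤ 0) :
    (1 / 3) ^ 2 ≤ bil Q X ((Real.sqrt 6)⁻¹ • ((2 : ℝ) • a - b - c)) ^ 2 +
      bil Q X ((Real.sqrt 2)⁻¹ • (b - c)) ^ 2 := by
  set e₁ := (Real.sqrt 6)⁻¹ • ((2 : ℝ) • a - b - c) with he₁
  set e₂ := (Real.sqrt 2)⁻¹ • (b - c) with he₂
  have hba : bil Q b a = -1 := by rw [bil_comm, hab]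
  have hcb : bil Q c b = -1 := by rw [bil_comm, hbc]
  have hca : bil Q c a = -1 := by rw [bil_comm, hac]
  have hN1 : bil Q e₁ (a + b + c) = 0 := by
    simp only [he₁, map_add, map_sub, map_smul, LinearMap.sub_apply, LinearMap.smul_apply,
      smul_eq_mul, hab, hba, hbc, hcb, hac, hca, bil_self, ha, hb, hc]
    ring
  have hN2 : bil Q e₂ (a + b + c) = 0 := by
    simp only [he₂, map_add, map_sub, map_smul, LinearMap.sub_apply, LinearMap.smul_apply,
      smul_eq_mul, hba, hbc, hcb, hca, bil_self, hb, hc]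
    ring
  have hNQ : Q (a + b + c) = -6 := by
    rw [← bil_self]
    simp only [map_add, LinearMap.add_apply, hab, hba, hbc, hcb, hac, hca, bil_self, ha, hb, hc]
    norm_num
  have hN := (hU.mem_orthogonal_iff (a + b + c)).2 ⟨hN1, hN2⟩
  have hv := hU.sub_proj_mem X
  have hcs := hU.cauchy_schwarz_orthogonal hQ hv hN
  clear_value e₁ e₂
  -- The negative component of `X` pairs with `a + b + c`, of square `-6`, to at most `-1`.
  -- Cauchy-Schwarz bounds its squared norm, which equals that of the planar component, below by `1
  -- / 6 ≥ (1 / 3)²`.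
  have h1 : bil Q (X - (bil Q X e₁ • e₁ + bil Q X e₂ • e₂)) (a + b + c) ≤ -1 := by
    rw [map_sub, LinearMap.sub_apply, map_add (bil Q) (bil Q X e₁ • e₁), LinearMap.add_apply,
      map_smul (bil Q), map_smul (bil Q), LinearMap.smul_apply, LinearMap.smul_apply, hN1, hN2,
      bil_comm X, map_add, map_add, LinearMap.add_apply, LinearMap.add_apply, haX]
    simp only [smul_zero, add_zero, sub_zero]
    linarith
  have h2 : Q (X - (bil Q X e₁ • e₁ + bil Q X e₂ • e₂)) =
      -(bil Q X e₁ ^ 2 + bil Q X e₂ ^ 2) := by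
    rw [map_sub_bil, hX, hU.map_lin, map_add, map_smul, map_smul, smul_eq_mul, smul_eq_mul]
    ring
  rw [h2, hNQ] at hcs
  nlinarith

/-- The point `x` is not close to the vertex `a` of the triple `(a, b, c)`. -/
def FarFrom (ω : V [⋀^Fin 2]→ₗ[ℝ] ℝ) (a b c x : ℙ ℝ V) : Prop :=
  |area ω x.rep b.rep * area ω c.rep a.rep| ≤ 2 * |area ω x.rep a.rep * area ω b.rep c.rep|

/-- A point is close to at most one vertex of a triple. -/
lemma farFrom_or (hV : Module.finrank ℝ V = 2) {a b c : ℙ ℝ V} (hab : area ω a.rep b.rep ≠ 0)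
    (x : ℙ ℝ V) :
    (FarFrom ω a b c x ∨ FarFrom ω b c a x) ∧ (FarFrom ω b c a x ∨ FarFrom ω c a b x) ∧
      (FarFrom ω c a b x ∨ FarFrom ω a b c x) := by
  -- By the Plücker relation the three products sum to zero. Closeness to two vertices would mean,
  -- say, `|q| > 2|p|` and `|r| > 2|q|`, contradicting `|r| ≤ |p| + |q|`.
  have hsum : area ω x.rep a.rep * area ω b.rep c.rep + area ω x.rep b.rep * area ω c.rep a.rep +
      area ω x.rep c.rep * area ω a.rep b.rep = 0 := by
    rw [eq_smul_add_smul_of_area hV hab c.rep]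
    simp only [map_add, map_smul, LinearMap.add_apply, LinearMap.smul_apply, smul_eq_mul,
      area_self, area_swap b.rep a.rep]
    ring
  unfold FarFrom
  set p := area ω x.rep a.rep * area ω b.rep c.rep
  set q := area ω x.rep b.rep * area ω c.rep a.rep
  set r := area ω x.rep c.rep * area ω a.rep b.rep
  have hp : |p| ≤ |q| + |r| := by
    have : p = -(q + r) := by linarith
    rw [this, abs_neg]
    exact abs_add_le _ _
  have hq : |q| ≤ |p| + |r| := by
    have : q = -(p + r) := by linarith
    rw [this, abs_neg]
    exact abs_add_le _ _
  have hr : |r| ≤ |p| + |q| := by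
    have : r = -(p + q) := by linarith
    rw [this, abs_neg]
    exact abs_add_le _ _
  have := abs_nonneg p
  have := abs_nonneg q
  have := abs_nonneg r
  refine ⟨?_, ?_, ?_⟩
  · by_contra! h
    linarith [h.1, h.2]
  · by_contra! h
    linarith [h.1, h.2]
  · by_contra! h
    linarith [h.1, h.2]

/-- The affine chart in which a triple is `∞, 0, 1`. -/
lemma exists_chart_of_triple (hV : Module.finrank ℝ V = 2) (hω : ω ≠ 0) {a b c : ℙ ℝ V}
    (hab : a ≠ b) (hbc : b ≠ c) (hac : a ≠ c) :
    ∃ (w : V) (h : area ω a.rep w ≠ 0) (β γ : ℝ), β ≠ 0 ∧ γ ≠ 0 ∧ b.rep = β • w ∧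
      c.rep = γ • (w + a.rep) ∧ ∀ x, FarFrom ω a b c x →
        ∃ s : ℝ, |s| ≤ 2 ∧ x = chart a.rep w h s := by
  have h1 := area_rep_ne_zero hV hω hab
  have h2 := area_rep_ne_zero hV hω hbc
  have h3 := area_rep_ne_zero hV hω hac
  have h2' := area_rep_ne_zero hV hω hbc.symm
  have hc := eq_smul_add_smul_of_area hV h1 c.rep
  -- The vector of `b` is rescaled so that `c` is the line of `k b + a`, that is, has coordinate
  -- `1`.
  set k := area ω a.rep c.rep / area ω c.rep b.rep with hk
  have hk0 : k ≠ 0 := div_ne_zero h3 h2'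
  have hw : area ω a.rep (k • b.rep) ≠ 0 := by
    rw [map_smul, smul_eq_mul]
    exact mul_ne_zero hk0 h1
  refine ⟨k • b.rep, hw, k⁻¹, area ω c.rep b.rep / area ω a.rep b.rep, inv_ne_zero hk0,
    div_ne_zero h2' h1, ?_, ?_, ?_⟩
  · rw [smul_smul, inv_mul_cancel₀ hk0, one_smul]
  · conv_lhs => rw [hc]
    rw [smul_add, smul_smul, add_comm]
    congr 2
    rw [hk]
    field_simp
  · intro x hx
    unfold FarFrom at hx
    have hxa : area ω x.rep a.rep ≠ 0 := by
      intro h0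
      rw [h0, zero_mul, abs_zero, mul_zero, abs_mul] at hx
      have hca : 0 < |area ω c.rep a.rep| := abs_pos.2 (area_rep_ne_zero hV hω hac.symm)
      have : |area ω x.rep b.rep| ≤ 0 := nonpos_of_mul_nonpos_left hx hca
      have hxb := abs_eq_zero.1 (this.antisymm (abs_nonneg _))
      rw [area_rep_eq_zero_iff hV hω] at h0 hxb
      exact hab (h0.symm.trans hxb)
    have hax : area ω a.rep x.rep ≠ 0 := by rwa [area_swap, neg_ne_zero]
    have hcoord := chart_coordinate hw hV x.rep_nonzero hax
    rw [Projectivization.mk_rep] at hcoord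
    refine ⟨_, ?_, hcoord⟩
    rw [map_smul, smul_eq_mul, abs_div, abs_mul, hk, abs_div, area_swap a.rep x.rep, abs_neg,
      div_le_iff₀ (abs_pos.2 hxa), area_swap a.rep c.rep, abs_neg, area_swap c.rep b.rep, abs_neg,
      div_mul_eq_mul_div, div_le_iff₀ (abs_pos.2 h2)]
    rw [abs_mul, abs_mul] at hx
    linarith

variable [TopologicalSpace V] [IsTopologicalAddGroup V] [ContinuousSMul ℝ V] [T2Space V]

/-- The Hölder estimate for pairs of points which are not close to the first vertex. -/
lemma exists_holder_chart {q : ℕ} (hQ : HasSignature Q 2 q) (hV : Module.finrank ℝ V = 2)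
    (hA : 1 < A) (hB : 1 < B) :
    ∃ M α : ℝ, 0 < M ∧ 0 < α ∧ ∀ ξ : ℙ ℝ V → EinsteinUniverse Q,
      IsAdmissible ω Q A B Set.univ ξ → ∀ (a b c : ℙ ℝ V) (w : V) (h : area ω a.rep w ≠ 0)
      (β γ : ℝ), β ≠ 0 → γ ≠ 0 → b.rep = β • w → c.rep = γ • (w + a.rep) → ∀ s t : ℝ,
      |s| ≤ 2 → |t| ≤ 2 →
      visualDist Q (ξ a) (ξ b) (ξ c) (ξ (chart a.rep w h s)) (ξ (chart a.rep w h t)) ≤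
        M * visualDistLine ω a b c (chart a.rep w h s) (chart a.rep w h t) ^ α := by
  obtain ⟨M, α, hM, hα, hol⟩ := IsTimelikeCurve.holder (Q := Q) hQ hA hB
  -- The factor `2` bounds the planar components, `1 / 3` is their lower bound, and `7 ^ α` comes
  -- from the comparison of distances on the line.
  refine ⟨Real.pi * (2 * M / (1 / 3)) * 7 ^ α, α, by positivity, hα, ?_⟩
  intro ξ hadm a b c w h β γ hβ hγ hb hc s t hs ht
  have hw0 : w ≠ 0 := by rintro rfl; simp at h
  have hb0 : b = chart a.rep w h 0 := by
    rw [← b.mk_rep]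
    exact chart_eq_mk h _ (c := β) (by simpa using hb)
  have hc0 : c = chart a.rep w h 1 := by
    rw [← c.mk_rep]
    exact chart_eq_mk h _ (c := γ) (by simpa using hc)
  have hab : a ≠ b := hb0 ▸ chart_ne h 0
  have hac : a ≠ c := hc0 ▸ chart_ne h 1
  have hbc : b ≠ c := by
    rw [hb0, hc0]
    intro h0
    exact zero_ne_one (chart_injective h h0)
  have htri := hadm.triple a trivial b trivial c trivial hab hbc hac
  obtain ⟨σ, β', γ', hσ, hβ', hγ', h1, h2, h3⟩ := exists_normalized_lifts htri
  have hcurve := hadm.isTimelikeCurve hV dense_univ (Set.mem_univ a) h hσ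
  rw [Set.preimage_univ] at hcurve
  set a' := σ • (ξ a).1.rep with ha'
  set b' := β' • (ξ b).1.rep with hb'
  set c' := γ' • (ξ c).1.rep with hc'
  set F := chartLift ξ a' a.rep w h with hF
  have hlift : ∀ (u : ℙ ℝ V) (r k : ℝ), u = chart a.rep w h r →
      bil Q a' (k • (ξ u).1.rep) = -1 → F r = k • (ξ u).1.rep := by
    intro u r k hu hk
    rw [hF, chartLift, ← hu]
    rw [map_smul, smul_eq_mul] at hk
    have hne : bil Q a' (ξ u).1.rep ≠ 0 := by
      intro h0
      rw [h0] at hk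
      norm_num at hk
    congr 1
    field_simp
    linarith
  have hF0 : F 0 = b' := hlift b 0 β' hb0 h1
  have hF1 : F 1 = c' := hlift c 1 γ' hc0 h3
  have hU := barycentricPlane_basis (Q := Q) hσ hβ' hγ' ha' hb' hc' h1 h2 h3
  have qa : Q a' = 0 := hcurve.map_base
  have qb : Q b' = 0 := by rw [← hF0]; exact hcurve.map_eq 0 trivial
  have qc : Q c' = 0 := by rw [← hF1]; exact hcurve.map_eq 1 trivial
  have hlow : ∀ r, (1 / 3) ^ 2 ≤ bil Q (F r) ((Real.sqrt 6)⁻¹ • ((2 : ℝ) • a' - b' - c')) ^ 2 +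
      bil Q (F r) ((Real.sqrt 2)⁻¹ • (b' - c')) ^ 2 := by
    intro r
    refine component_lower_bound hQ h1 h2 h3 qa qb qc hU (hcurve.map_eq r trivial)
      (hcurve.bil_base r trivial) ?_ ?_
    · rw [← hF0]
      exact hcurve.bil_nonpos trivial trivial
    · rw [← hF1]
      exact hcurve.bil_nonpos trivial trivial
  have hdiff : |bil Q (F s - F t) b'| ≤ M * |s - t| ^ α ∧
      |bil Q (F s - F t) c'| ≤ M * |s - t| ^ α := by
    have h01 : bil Q (F 0) (F 1) = -1 := by rw [hF0, hF1, h2]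
    have main := hol _ _ F hcurve trivial trivial h01
    rw [hF0, hF1] at main
    rw [abs_le] at hs ht
    rcases le_total s t with hst | hst
    · have := main s trivial t trivial hst hs.1 ht.2
      rw [abs_sub_comm s t, abs_of_nonneg (sub_nonneg.2 hst), ← neg_sub (F t), map_neg,
        LinearMap.neg_apply, LinearMap.neg_apply, abs_neg, abs_neg]
      exact this
    · have := main t trivial s trivial hst ht.1 hs.2
      rw [abs_of_nonneg (sub_nonneg.2 hst)]
      exact this
  set η := M * |s - t| ^ α with hη
  have hη0 : 0 ≤ η := (abs_nonneg _).trans hdiff.1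
  have s6 : 0 ≤ (Real.sqrt 6)⁻¹ ∧ (Real.sqrt 6)⁻¹ ≤ 1 := by
    refine ⟨by positivity, inv_le_one_of_one_le₀ ?_⟩
    exact Real.one_le_sqrt.2 (by norm_num)
  have s2 : 0 ≤ (Real.sqrt 2)⁻¹ ∧ (Real.sqrt 2)⁻¹ ≤ 1 := by
    refine ⟨by positivity, inv_le_one_of_one_le₀ ?_⟩
    exact Real.one_le_sqrt.2 (by norm_num)
  -- Chords are orthogonal to `a'`, so only the pairings with `b'` and `c'` contribute to the planar
  -- components.
  have hbase : bil Q (F s - F t) a' = 0 := by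
    rw [bil_comm]
    exact hcurve.bil_sub trivial trivial
  have d1 : |bil Q (F s) ((Real.sqrt 6)⁻¹ • ((2 : ℝ) • a' - b' - c')) -
      bil Q (F t) ((Real.sqrt 6)⁻¹ • ((2 : ℝ) • a' - b' - c'))| ≤ 2 * η := by
    rw [← LinearMap.sub_apply, ← map_sub, map_smul, map_sub, map_sub, map_smul, hbase, smul_zero,
      smul_eq_mul, abs_mul, abs_of_nonneg s6.1, zero_sub]
    have : |-bil Q (F s - F t) b' - bil Q (F s - F t) c'| ≤ 2 * η := by
      refine (abs_sub _ _).trans ?_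
      rw [abs_neg]
      linarith [hdiff.1, hdiff.2]
    calc _ ≤ 1 * (2 * η) := by gcongr; exact s6.2
      _ = _ := one_mul _
  have d2 : |bil Q (F s) ((Real.sqrt 2)⁻¹ • (b' - c')) -
      bil Q (F t) ((Real.sqrt 2)⁻¹ • (b' - c'))| ≤ 2 * η := by
    rw [← LinearMap.sub_apply, ← map_sub, map_smul, map_sub, smul_eq_mul, abs_mul,
      abs_of_nonneg s2.1]
    have : |bil Q (F s - F t) b' - bil Q (F s - F t) c'| ≤ 2 * η := by
      refine (abs_sub _ _).trans ?_
      linarith [hdiff.1, hdiff.2]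
    calc _ ≤ 1 * (2 * η) := by gcongr; exact s2.2
      _ = _ := one_mul _
  have key := visualDistPlane_le hU (mem_submodule_chartLift (ξ := ξ) a' a.rep w h s)
    (mem_submodule_chartLift (ξ := ξ) a' a.rep w h t) (hcurve.map_eq s trivial)
    (hcurve.map_eq t trivial) (hcurve.bil_nonpos trivial trivial) (by norm_num)
    (hlow s) (hlow t) d1 d2
  have hline := abs_sub_le_visualDistLine h hβ hγ hb hc hs ht
  have hd0 := visualDistLine_nonneg (ω := ω) a b c (chart a.rep w h s) (chart a.rep w h t)
  have hpow : |s - t| ^ α ≤ 7 ^ α *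
      visualDistLine ω a b c (chart a.rep w h s) (chart a.rep w h t) ^ α := by
    rw [← Real.mul_rpow (by norm_num) hd0]
    exact Real.rpow_le_rpow (abs_nonneg _) hline hα.le
  calc _ ≤ _ := key
    _ = Real.pi * (2 * M / (1 / 3)) * |s - t| ^ α := by rw [hη]; ring
    _ ≤ Real.pi * (2 * M / (1 / 3)) * (7 ^ α *
      visualDistLine ω a b c (chart a.rep w h s) (chart a.rep w h t) ^ α) := by gcongr
    _ = _ := by ring

theorem exists_holder {q : ℕ} (hQ : HasSignature Q 2 q) (hV : Module.finrank ℝ V = 2)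
    (hω : ω ≠ 0) (hA : 1 < A) (hB : 1 < B) :
    ∃ M α : ℝ, 0 < M ∧ 0 < α ∧ ∀ ξ : ℙ ℝ V → EinsteinUniverse Q,
      IsAdmissible ω Q A B Set.univ ξ → IsVisuallyHolder ω Q M α ξ := by
  obtain ⟨M, α, hM, hα, hol⟩ := exists_holder_chart (ω := ω) hQ hV hA hB
  refine ⟨M, α, hM, hα, fun ξ hadm a b c hpos => ?_⟩
  obtain ⟨hab, hbc, hac⟩ := hpos
  refine ⟨(isPositiveTriple_iff _ _ _).2
    (hadm.triple a trivial b trivial c trivial hab hbc hac), fun x y => ?_⟩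
  have main : ∀ a b c : ℙ ℝ V, a ≠ b → b ≠ c → a ≠ c → FarFrom ω a b c x → FarFrom ω a b c y →
      visualDist Q (ξ a) (ξ b) (ξ c) (ξ x) (ξ y) ≤ M * visualDistLine ω a b c x y ^ α := by
    intro a b c hab hbc hac hx hy
    obtain ⟨w, h, β, γ, hβ, hγ, hb, hc, hfar⟩ := exists_chart_of_triple hV hω hab hbc hac
    obtain ⟨s, hs, rfl⟩ := hfar x hx
    obtain ⟨t, ht, rfl⟩ := hfar y hy
    exact hol ξ hadm a b c w h β γ hβ hγ hb hc s t hs ht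
  have hA := area_rep_ne_zero hV hω hab
  obtain ⟨x1, x2, x3⟩ := farFrom_or (c := c) hV hA x
  obtain ⟨y1, y2, y3⟩ := farFrom_or (c := c) hV hA y
  -- Each of the two points is close to at most one of the three vertices, so some vertex is far
  -- from both; a rotation of the triple puts it first.
  have hcases : (FarFrom ω a b c x ∧ FarFrom ω a b c y) ∨ (FarFrom ω b c a x ∧ FarFrom ω b c a y) ∨
      (FarFrom ω c a b x ∧ FarFrom ω c a b y) := by
    tauto
  rcases hcases with h | h | h
  · exact main a b c hab hbc hac h.1 h.2
  · rw [← visualDist_rotate, ← visualDistLine_rotate]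
    exact main b c a hbc hac.symm hab.symm h.1 h.2
  · rw [← visualDist_rotate, ← visualDistLine_rotate, ← visualDist_rotate,
      ← visualDistLine_rotate]
    exact main c a b hac.symm hab hbc.symm h.1 h.2

end

end QSEinstein

/-! ### Visual distances and the topology: Hölder maps are continuous. -/

namespace QSEinstein

noncomputable section

open Filter Topology

section Plane

variable {E : Type*} [AddCommGroup E] [Module ℝ E] {Q : QuadraticForm ℝ E}
  {U : Submodule ℝ E} {e₁ e₂ : E}

namespace IsOrthonormalBasis

lemma bil_add_left (h : IsOrthonormalBasis Q U e₁ e₂) {u v g : E} (hu : u ∈ U)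
    (hv : v ∈ (bil Q).orthogonal U) :
    bil Q u (bil Q g e₁ • e₁ + bil Q g e₂ • e₂) = bil Q u g ∧
      bil Q v (g - (bil Q g e₁ • e₁ + bil Q g e₂ • e₂)) = bil Q v g := by
  constructor
  · have := h.bil_eq_zero hu (h.sub_proj_mem g)
    rw [map_sub, sub_eq_zero] at this
    exact this.symm
  · rw [map_sub, bil_comm v (_ + _), h.bil_eq_zero (h.proj_mem _ _) hv, sub_zero]

/-- The component in the plane of the lifts of a point. -/
lemma sq_mul_eq_one (h : IsOrthonormalBasis Q U e₁ e₂) {u v X : E} {c : ℝ} (hu : u ∈ U)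
    (hv : v ∈ (bil Q).orthogonal U) (huv : u + v = c • X) (hQu : Q u = 1) :
    u = (c * bil Q X e₁) • e₁ + (c * bil Q X e₂) • e₂ ∧
      c ^ 2 * (bil Q X e₁ ^ 2 + bil Q X e₂ ^ 2) = 1 := by
  obtain ⟨s, t, rfl⟩ := (h.mem_iff _).1 hu
  obtain ⟨h1, h2⟩ := (h.mem_orthogonal_iff _).1 hv
  have e1 : s = c * bil Q X e₁ := by
    have := congrArg (fun z => bil Q z e₁) huv
    simpa [bil_self, h.map_fst, bil_comm e₂ e₁, h.ortho, bil_comm v, h1] using this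
  have e2 : t = c * bil Q X e₂ := by
    have := congrArg (fun z => bil Q z e₂) huv
    simpa [bil_self, h.map_snd, h.ortho, bil_comm v, h2] using this
  rw [h.map_lin, e1, e2] at hQu
  exact ⟨by rw [e1, e2], by linarith⟩

/-- The visual distance is attained by lifts. -/
lemma exists_visualDistPlane_eq (h : IsOrthonormalBasis Q U e₁ e₂) {q : ℕ}
    (hQ : HasSignature Q 2 q) (x y : EinsteinUniverse Q) :
    ∃ u ∈ U, ∃ v ∈ (bil Q).orthogonal U, ∃ u' ∈ U, ∃ v' ∈ (bil Q).orthogonal U,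
    u + v ∈ x.1.submodule ∧ Q u = 1 ∧ -Q v = 1 ∧
    u' + v' ∈ y.1.submodule ∧ Q u' = 1 ∧ -Q v' = 1 ∧
    visualDistPlane Q U x y =
      Real.sqrt (Real.arccos (bil Q u u') ^ 2 + Real.arccos (-bil Q v v') ^ 2) := by
  refine Set.Nonempty.csInf_mem (s := {r : ℝ | ∃ u ∈ U, ∃ v ∈ (bil Q).orthogonal U, ∃ u' ∈ U,
    ∃ v' ∈ (bil Q).orthogonal U,
    u + v ∈ x.1.submodule ∧ Q u = 1 ∧ -Q v = 1 ∧
    u' + v' ∈ y.1.submodule ∧ Q u' = 1 ∧ -Q v' = 1 ∧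
    r = Real.sqrt (Real.arccos (bil Q u u') ^ 2 + Real.arccos (-bil Q v v') ^ 2)}) ?_ ?_
  · have hx := h.exists_pos_decomposition hQ x.2 x.1.rep_nonzero
    have hy := h.exists_pos_decomposition hQ y.2 y.1.rep_nonzero
    obtain ⟨v, hv, hadd, hu1, hv1⟩ := h.exists_decomposition x.2 (Real.sqrt_pos.2 hx)
      (Real.sq_sqrt hx.le)
    obtain ⟨v', hv', hadd', hu1', hv1'⟩ := h.exists_decomposition y.2 (Real.sqrt_pos.2 hy)
      (Real.sq_sqrt hy.le)
    refine ⟨_, _, h.proj_mem _ _, v, hv, _, h.proj_mem _ _, v', hv', ?_, hu1, hv1, ?_, hu1', hv1',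
      rfl⟩
    · rw [hadd, Projectivization.submodule_eq]
      exact Submodule.smul_mem _ _ (Submodule.mem_span_singleton_self _)
    · rw [hadd', Projectivization.submodule_eq]
      exact Submodule.smul_mem _ _ (Submodule.mem_span_singleton_self _)
  · set X := x.1.rep
    set Y := y.1.rep
    set N := bil Q X e₁ * bil Q Y e₁ + bil Q X e₂ * bil Q Y e₂ with hN
    set k := Real.sqrt (((bil Q X e₁ ^ 2 + bil Q X e₂ ^ 2) *
      (bil Q Y e₁ ^ 2 + bil Q Y e₂ ^ 2))⁻¹) with hk
    let f : ℝ → ℝ := fun κ =>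
      Real.sqrt (Real.arccos (κ * N) ^ 2 + Real.arccos (-(κ * (bil Q X Y - N))) ^ 2)
    -- Lifts of unit components are determined up to sign, so only two values can occur and the
    -- infimum is attained.
    refine (Set.toFinite {f k, f (-k)}).subset ?_
    rintro r ⟨u, hu, v, hv, u', hu', v', hv', huv, hQu, -, huv', hQu', -, rfl⟩
    rw [Projectivization.submodule_eq, Submodule.mem_span_singleton] at huv huv'
    obtain ⟨c, hc⟩ := huv
    obtain ⟨d, hd⟩ := huv'
    obtain ⟨e1, e2⟩ := h.sq_mul_eq_one hu hv hc.symm hQu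
    obtain ⟨e1', e2'⟩ := h.sq_mul_eq_one hu' hv' hd.symm hQu'
    have hcd : (c * d) ^ 2 = k ^ 2 := by
      rw [hk, Real.sq_sqrt (by positivity)]
      refine eq_inv_of_mul_eq_one_left ?_
      calc _ = (c ^ 2 * (bil Q X e₁ ^ 2 + bil Q X e₂ ^ 2)) *
          (d ^ 2 * (bil Q Y e₁ ^ 2 + bil Q Y e₂ ^ 2)) := by ring
        _ = 1 := by rw [e2, e2', one_mul]
    have huu : bil Q u u' = c * d * N := by
      rw [e1, e1', h.bil_lin, hN]
      ring
    have hvv : bil Q v v' = c * d * (bil Q X Y - N) := by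
      have : bil Q (u + v) (u' + v') = bil Q u u' + bil Q v v' := by
        simp only [map_add, LinearMap.add_apply, h.bil_eq_zero hu hv', bil_comm v u',
          h.bil_eq_zero hu' hv]
        ring
      rw [← hc, ← hd, huu] at this
      simp only [map_smul, LinearMap.smul_apply, smul_eq_mul] at this
      linarith
    rw [huu, hvv]
    rcases sq_eq_sq_iff_eq_or_eq_neg.1 hcd with h0 | h0
    · left
      rw [h0]
    · right
      rw [h0]
      rfl

variable [TopologicalSpace E] [IsTopologicalAddGroup E] [ContinuousSMul ℝ E] [T2Space E]

/-- The visual distance controls the topology of the Einstein universe. -/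
lemma tendsto_of_visualDistPlane (h : IsOrthonormalBasis Q U e₁ e₂) {q : ℕ}
    (hQ : HasSignature Q 2 q) {ι : Type*} {l : Filter ι} {g : ι → EinsteinUniverse Q}
    {p : EinsteinUniverse Q} (hg : Tendsto (fun i => visualDistPlane Q U (g i) p) l (𝓝 0)) :
    Tendsto g l (𝓝 p) := by
  choose u hu v hv u' hu' v' hv' huv hQu hQv huv' hQu' hQv' hd using
    fun i => h.exists_visualDistPlane_eq hQ (g i) p
  have hsq : Tendsto (fun i => visualDistPlane Q U (g i) p ^ 2) l (𝓝 0) := by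
    have := hg.pow 2
    rwa [zero_pow (two_ne_zero)] at this
  have hd2 : ∀ i, visualDistPlane Q U (g i) p ^ 2 =
      Real.arccos (bil Q (u i) (u' i)) ^ 2 + Real.arccos (-bil Q (v i) (v' i)) ^ 2 := by
    intro i
    rw [hd, Real.sq_sqrt (by positivity)]
  have aux : ∀ f : ι → ℝ, (∀ i, -1 ≤ f i) → (∀ i, f i ≤ 1) →
      (∀ i, Real.arccos (f i) ^ 2 ≤ visualDistPlane Q U (g i) p ^ 2) →
      -- Small angles give small chords, by `1 - θ² / 2 ≤ cos θ`.
      Tendsto (fun i => 2 - 2 * f i) l (𝓝 0) := by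
    intro f h1 h2 h3
    refine squeeze_zero (fun i => by linarith [h2 i]) (fun i => ?_) hsq
    have := Real.one_sub_sq_div_two_le_cos (x := Real.arccos (f i))
    rw [Real.cos_arccos (h1 i) (h2 i)] at this
    linarith [h3 i]
  have hU1 : ∀ i, bil Q (u i) (u' i) ^ 2 ≤ 1 := by
    intro i
    obtain ⟨s, t, hst⟩ := (h.mem_iff _).1 (hu i)
    obtain ⟨s', t', hst'⟩ := (h.mem_iff _).1 (hu' i)
    have e1 := hQu i
    have e2 := hQu' i
    rw [hst, h.map_lin] at e1
    rw [hst', h.map_lin] at e2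
    rw [hst, hst', h.bil_lin]
    calc _ ≤ (s ^ 2 + t ^ 2) * (s' ^ 2 + t' ^ 2) := by nlinarith [sq_nonneg (s * t' - t * s')]
      _ = 1 := by rw [e1, e2, one_mul]
  have hV1 : ∀ i, (-bil Q (v i) (v' i)) ^ 2 ≤ 1 := by
    intro i
    have := h.cauchy_schwarz_orthogonal hQ (hv i) (hv' i)
    have e1 : Q (v i) = -1 := by linarith [hQv i]
    have e2 : Q (v' i) = -1 := by linarith [hQv' i]
    rw [e1, e2] at this
    rw [neg_sq]
    linarith
  have hu0 : Tendsto (fun i => Q (u i - u' i)) l (𝓝 0) := by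
    have := aux (fun i => bil Q (u i) (u' i))
      (fun i => (abs_le_of_sq_le_sq' (by rw [one_pow]; exact hU1 i) zero_le_one).1)
      (fun i => (abs_le_of_sq_le_sq' (by rw [one_pow]; exact hU1 i) zero_le_one).2)
      (fun i => by rw [hd2]; linarith [sq_nonneg (Real.arccos (-bil Q (v i) (v' i)))])
    refine this.congr fun i => ?_
    rw [map_sub_bil, hQu, hQu']
    ring
  have hv0 : Tendsto (fun i => Q (v i - v' i)) l (𝓝 0) := by
    have := (aux (fun i => -bil Q (v i) (v' i))
      (fun i => (abs_le_of_sq_le_sq' (by rw [one_pow]; exact hV1 i) zero_le_one).1)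
      (fun i => (abs_le_of_sq_le_sq' (by rw [one_pow]; exact hV1 i) zero_le_one).2)
      (fun i => by rw [hd2]; linarith [sq_nonneg (Real.arccos (bil Q (u i) (u' i)))])).neg
    rw [neg_zero] at this
    refine this.congr fun i => ?_
    have e1 : Q (v i) = -1 := by linarith [hQv i]
    have e2 : Q (v' i) = -1 := by linarith [hQv' i]
    rw [map_sub_bil, e1, e2]
    ring
  set P := p.1.rep with hP
  have hP0 := h.exists_pos_decomposition hQ p.2 p.1.rep_nonzero
  rw [← hP] at hP0
  set r := Real.sqrt (bil Q P e₁ ^ 2 + bil Q P e₂ ^ 2) with hr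
  have hr0 : 0 < r := Real.sqrt_pos.2 hP0
  have hrr : r ^ 2 = bil Q P e₁ ^ 2 + bil Q P e₂ ^ 2 := Real.sq_sqrt hP0.le
  have hc : ∀ i, ∃ c : ℝ, u' i + v' i = c • P ∧ (c * r) ^ 2 = 1 := by
    intro i
    have := huv' i
    rw [Projectivization.submodule_eq, Submodule.mem_span_singleton] at this
    obtain ⟨c, hc⟩ := this
    refine ⟨c, hc.symm, ?_⟩
    rw [mul_pow, hrr]
    exact (h.sq_mul_eq_one (hu' i) (hv' i) hc.symm (hQu' i)).2
  choose c hcP hc1 using hc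
  have hwne : r⁻¹ • P ≠ 0 := smul_ne_zero (by positivity) p.1.rep_nonzero
  -- The attaining lift of `p` may change sign with `i`. The sign `c i * r = ±1` brings it back to
  -- the fixed vector `r⁻¹ P`, towards which the corrected lifts of `g i` converge.
  set ζ : ι → E := fun i => (c i * r) • (u i + v i) with hζ
  have hdiff : ∀ i, ζ i = (c i * r) • ((u i - u' i) + (v i - v' i)) + r⁻¹ • P := by
    intro i
    have e1 : r⁻¹ • P = (c i * r) • (u' i + v' i) := by
      rw [hcP, smul_smul]
      congr 1
      have := hc1 i
      field_simp
      linarith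
    rw [e1, hζ]
    module
  have hlim : Tendsto ζ l (𝓝 (r⁻¹ • P)) := by
    refine hQ.tendsto (by omega) fun z => ?_
    have e1 : Tendsto (fun i => bil Q (u i - u' i) z) l (𝓝 0) := by
      have hb : ∀ i, bil Q (u i - u' i) z ^ 2 ≤
          Q (u i - u' i) * (bil Q z e₁ ^ 2 + bil Q z e₂ ^ 2) := by
        intro i
        have hmem := U.sub_mem (hu i) (hu' i)
        rw [← (h.bil_add_left (g := z) hmem (Submodule.zero_mem _)).1]
        obtain ⟨s, t, hst⟩ := (h.mem_iff _).1 hmem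
        rw [hst, h.bil_lin, h.map_lin]
        nlinarith [sq_nonneg (s * bil Q z e₂ - t * bil Q z e₁)]
      have := squeeze_zero (fun i => sq_nonneg _) hb (by
        have := hu0.mul_const (bil Q z e₁ ^ 2 + bil Q z e₂ ^ 2)
        rwa [zero_mul] at this)
      rw [tendsto_zero_iff_abs_tendsto_zero]
      have := this.sqrt
      simp only [Real.sqrt_zero, Real.sqrt_sq_eq_abs] at this
      exact this
    have e2 : Tendsto (fun i => bil Q (v i - v' i) z) l (𝓝 0) := by
      have hb : ∀ i, bil Q (v i - v' i) z ^ 2 ≤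
          Q (v i - v' i) * Q (z - (bil Q z e₁ • e₁ + bil Q z e₂ • e₂)) := by
        intro i
        have hmem := Submodule.sub_mem _ (hv i) (hv' i)
        rw [← (h.bil_add_left (g := z) (U.zero_mem) hmem).2]
        exact h.cauchy_schwarz_orthogonal hQ hmem (h.sub_proj_mem z)
      have := squeeze_zero (fun i => sq_nonneg _) hb (by
        have := hv0.mul_const (Q (z - (bil Q z e₁ • e₁ + bil Q z e₂ • e₂)))
        rwa [zero_mul] at this)
      rw [tendsto_zero_iff_abs_tendsto_zero]
      have := this.sqrt
      simp only [Real.sqrt_zero, Real.sqrt_sq_eq_abs] at this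
      exact this
    have e3 : Tendsto (fun i => (c i * r) * (bil Q (u i - u' i) z + bil Q (v i - v' i) z)) l
        (𝓝 0) := by
      have := e1.add e2
      rw [add_zero, tendsto_zero_iff_abs_tendsto_zero] at this
      rw [tendsto_zero_iff_abs_tendsto_zero]
      refine this.congr fun i => ?_
      have h1 : |c i * r| = 1 := by
        rw [← sq_eq_sq₀ (abs_nonneg _) zero_le_one, sq_abs, one_pow]
        exact hc1 i
      simp only [Function.comp, abs_mul] at h1 ⊢
      rw [h1, one_mul]
    have e4 := e3.add_const (bil Q (r⁻¹ • P) z)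
    rw [zero_add] at e4
    refine e4.congr fun i => ?_
    rw [hdiff, map_add, LinearMap.add_apply, map_smul (bil Q) (c i * r), LinearMap.smul_apply,
      map_add (bil Q) (u i - u' i), LinearMap.add_apply, smul_eq_mul]
  have hp : p.1 = Projectivization.mk ℝ (r⁻¹ • P) hwne := by
    conv_lhs => rw [← p.1.mk_rep]
    rw [eq_comm, Projectivization.mk_eq_mk_iff']
    exact ⟨r⁻¹, rfl⟩
  rw [tendsto_subtype_rng, hp]
  refine tendsto_mk hwne hlim (Eventually.of_forall fun i => ?_)
  have hcr : c i * r ≠ 0 := by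
    intro h0
    have := hc1 i
    rw [h0] at this
    norm_num at this
  have hne : ζ i ≠ 0 := by
    refine smul_ne_zero hcr fun h0 => ?_
    have h1 : v i = -u i := by rw [eq_neg_iff_add_eq_zero, add_comm, h0]
    have h2 := hQv i
    rw [h1, QuadraticMap.map_neg, hQu] at h2
    norm_num at h2
  refine ⟨hne, ?_⟩
  conv_rhs => rw [← (g i).1.mk_rep]
  have := huv i
  rw [Projectivization.submodule_eq, Submodule.mem_span_singleton] at this
  obtain ⟨d, hd⟩ := this
  rw [Projectivization.mk_eq_mk_iff']
  exact ⟨c i * r * d, by rw [mul_smul, hd]⟩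

end IsOrthonormalBasis

end Plane

variable {V : Type*} [AddCommGroup V] [Module ℝ V] {ω : V [⋀^Fin 2]→ₗ[ℝ] ℝ}
  [TopologicalSpace V] [IsTopologicalAddGroup V] [ContinuousSMul ℝ V] [T2Space V]

lemma tendsto_visualDistLine (hV : Module.finrank ℝ V = 2) (hω : ω ≠ 0) {a b c : ℙ ℝ V}
    (hab : a ≠ b) (hbc : b ≠ c) (hac : a ≠ c) (x : ℙ ℝ V) :
    Tendsto (fun y => visualDistLine ω a b c y x) (𝓝 x) (𝓝 0) := by
  have : FiniteDimensional ℝ V := .of_finrank_pos (by omega)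
  obtain ⟨s, hs, hs'⟩ := exists_tendsto_lift (g := id) (x := x) (tendsto_id (x := 𝓝 x))
  have hform : ∀ {f g : ℙ ℝ V → V} {v w : V}, Tendsto f (𝓝 x) (𝓝 v) → Tendsto g (𝓝 x) (𝓝 w) →
      Tendsto (fun y => barycenterForm ω a b c (f y) (g y)) (𝓝 x)
        (𝓝 (barycenterForm ω a b c v w)) := by
    intro f g v w hf hg
    have hA : ∀ {u : V} {f : ℙ ℝ V → V} {v : V}, Tendsto f (𝓝 x) (𝓝 v) →
        Tendsto (fun y => area ω u (f y)) (𝓝 x) (𝓝 (area ω u v)) := fun hf =>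
      tendsto_bilinear (area ω) tendsto_const_nhds hf
    simp only [barycenterForm, area_apply]
    exact ((((hA hf).mul (hA hg)).const_mul _).add (((hA hf).mul (hA hg)).const_mul _)).add
      (((hA hf).mul (hA hg)).const_mul _)
  have hpos : 0 < barycenterForm ω a b c x.rep x.rep := by
    have h1 := area_rep_ne_zero hV hω hab
    have h2 := area_rep_ne_zero hV hω hbc
    have h3 := area_rep_ne_zero hV hω hac.symm
    simp only [barycenterForm, area_apply]
    have e1 : 0 ≤ area ω b.rep c.rep ^ 2 * (area ω a.rep x.rep * area ω a.rep x.rep) :=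
      mul_nonneg (sq_nonneg _) (mul_self_nonneg _)
    have e2 : 0 ≤ area ω c.rep a.rep ^ 2 * (area ω b.rep x.rep * area ω b.rep x.rep) :=
      mul_nonneg (sq_nonneg _) (mul_self_nonneg _)
    have e3 : 0 ≤ area ω a.rep b.rep ^ 2 * (area ω c.rep x.rep * area ω c.rep x.rep) :=
      mul_nonneg (sq_nonneg _) (mul_self_nonneg _)
    by_cases hax : a = x
    · have hb := mul_self_pos.2 (area_rep_ne_zero hV hω (x := b) (y := x) (hax ▸ hab.symm))
      have : 0 < area ω c.rep a.rep ^ 2 * (area ω b.rep x.rep * area ω b.rep x.rep) := by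
        positivity
      linarith
    · have hb := mul_self_pos.2 (area_rep_ne_zero hV hω hax)
      have : 0 < area ω b.rep c.rep ^ 2 * (area ω a.rep x.rep * area ω a.rep x.rep) := by
        positivity
      linarith
  have hlim := ((Real.continuous_arccos.tendsto _).comp ((hform hs (tendsto_const_nhds
    (x := x.rep))).abs.div ((hform hs hs).mul
    (tendsto_const_nhds (x := barycenterForm ω a b c x.rep x.rep))).sqrt
    (Real.sqrt_pos.2 (mul_pos hpos hpos)).ne')).const_mul 2
  have h0 : 2 * Real.arccos (|barycenterForm ω a b c x.rep x.rep| /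
      Real.sqrt (barycenterForm ω a b c x.rep x.rep * barycenterForm ω a b c x.rep x.rep)) = 0 := by
    rw [Real.sqrt_mul_self hpos.le, abs_of_pos hpos, div_self hpos.ne', Real.arccos_one, mul_zero]
  rw [h0] at hlim
  refine hlim.congr' ?_
  filter_upwards [hs.eventually_ne x.rep_nonzero] with y hy
  obtain ⟨k, hk⟩ := hs' y
  rw [id] at hk
  have hk0 : k ≠ 0 := by
    rintro rfl
    rw [zero_smul] at hk
    exact hy hk
  have f1 : barycenterForm ω a b c (s y) x.rep = k * barycenterForm ω a b c y.rep x.rep := by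
    simp only [hk, barycenterForm, area_apply, map_smul, smul_eq_mul]
    ring
  have f2 : barycenterForm ω a b c (s y) (s y) = |k| ^ 2 * barycenterForm ω a b c y.rep y.rep := by
    simp only [hk, barycenterForm, area_apply, map_smul, smul_eq_mul, sq_abs]
    ring
  simp only [Function.comp, visualDistLine, Pi.div_apply]
  rw [f1, f2, mul_assoc, Real.sqrt_mul (by positivity), Real.sqrt_sq (abs_nonneg k), abs_mul,
    mul_div_mul_left _ _ (abs_pos.2 hk0).ne']

variable {E : Type*} [AddCommGroup E] [Module ℝ E] {Q : QuadraticForm ℝ E}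
  [TopologicalSpace E] [IsTopologicalAddGroup E] [ContinuousSMul ℝ E] [T2Space E]

/-- Maps with the Hölder property are continuous. -/
theorem IsVisuallyHolder.continuous {q : ℕ} (hQ : HasSignature Q 2 q)
    (hV : Module.finrank ℝ V = 2) (hω : ω ≠ 0) {M α : ℝ} (hα : 0 < α)
    {ξ : ℙ ℝ V → EinsteinUniverse Q} (h : IsVisuallyHolder ω Q M α ξ) : Continuous ξ := by
  classical
  rw [continuous_iff_continuousAt]
  intro x
  -- A single triple suffices, since its visual distances already control the topologies on both
  -- sides.
  obtain ⟨a, -, -⟩ := exists_mem_dense_notMem hV hω dense_univ ∅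
  obtain ⟨b, -, hb⟩ := exists_mem_dense_notMem hV hω dense_univ {a}
  obtain ⟨c, -, hc⟩ := exists_mem_dense_notMem hV hω dense_univ {a, b}
  simp only [Finset.mem_insert, Finset.mem_singleton, not_or] at hb hc
  obtain ⟨htri, hol⟩ := h a b c ⟨Ne.symm hb, Ne.symm hc.2, Ne.symm hc.1⟩
  rw [isPositiveTriple_iff] at htri
  obtain ⟨σ, β, γ, hσ, hβ, hγ, h1, h2, h3⟩ := exists_normalized_lifts htri
  have hU := barycentricPlane_basis (Q := Q) hσ hβ hγ rfl rfl rfl h1 h2 h3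
  refine hU.tendsto_of_visualDistPlane hQ ?_
  have hline := tendsto_visualDistLine hV hω (Ne.symm hb) (Ne.symm hc.2) (Ne.symm hc.1) x
  refine squeeze_zero (fun y => visualDistPlane_nonneg _ _ _) (fun y => hol y x) ?_
  have := (hline.rpow_const (p := α) (Or.inr hα.le)).const_mul M
  rwa [Real.zero_rpow hα.ne', mul_zero] at this

end

end QSEinstein

/-! ### The theorem. -/

theorem mainTheorem4 (n : ℕ)
    {V : Type*} [AddCommGroup V] [Module ℝ V] [TopologicalSpace V] [IsTopologicalAddGroup V]
    [ContinuousSMul ℝ V] [T2Space V] (hV : Module.finrank ℝ V = 2)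
    (ω : V [⋀^Fin 2]→ₗ[ℝ] ℝ) (hω : ω ≠ 0)
    {E : Type*} [AddCommGroup E] [Module ℝ E] [TopologicalSpace E] [IsTopologicalAddGroup E]
    [ContinuousSMul ℝ E] [T2Space E]
    (Q : QuadraticForm ℝ E) (hQ : QSEinstein.HasSignature Q 2 (n + 1))
    (A B : ℝ) (hA : 1 < A) (hB : 1 < B) :
    ∃ M α : ℝ, 0 < M ∧ 0 < α ∧
      ∀ (Ω : Set (ℙ ℝ V)) (_ : Dense Ω) (ξ : Ω → QSEinstein.EinsteinUniverse Q),
        QSEinstein.IsQuasisymmetric ω Q A B ξ →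
        ∃ Ξ : ℙ ℝ V → QSEinstein.EinsteinUniverse Q,
          (∀ x : Ω, Ξ x = ξ x) ∧ Continuous Ξ ∧ QSEinstein.IsVisuallyHolder ω Q M α Ξ ∧
          ∀ Ξ' : ℙ ℝ V → QSEinstein.EinsteinUniverse Q, (∀ x : Ω, Ξ' x = ξ x) →
            (Continuous Ξ' ∨ QSEinstein.IsVisuallyHolder ω Q M α Ξ') → Ξ' = Ξ := by
  obtain ⟨M, α, hM, hα, hol⟩ := QSEinstein.exists_holder (ω := ω) hQ hV hω hA hB
  refine ⟨M, α, hM, hα, fun Ω hΩ ξ hξ => ?_⟩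
  classical
  have : FiniteDimensional ℝ E := hQ.finiteDimensional (by omega)
  have : FiniteDimensional ℝ V := .of_finrank_pos (by omega)
  obtain ⟨x₀, hx₀, -⟩ := QSEinstein.exists_mem_dense_notMem hV hω hΩ ∅
  -- The value outside `Ω` is arbitrary: admissibility on `Ω` and the limits along `Ω` do not see
  -- it.
  let ζ : ℙ ℝ V → QSEinstein.EinsteinUniverse Q := fun x =>
    if hx : x ∈ Ω then ξ ⟨x, hx⟩ else ξ ⟨x₀, hx₀⟩
  have hζ : ∀ x : Ω, ζ x = ξ x := fun x => dif_pos x.2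
  have hadm := hξ.isAdmissible hV hω hΩ hA hζ
  obtain ⟨Ξ, hΞ, hext⟩ := hadm.exists_continuous_extension hQ hV hω hΩ hA hB
  have hadm' := (hadm.congr hext).of_dense hQ hV hω hΩ hΞ
  refine ⟨Ξ, fun x => (hext x x.2).trans (hζ x), hΞ, hol Ξ hadm', fun Ξ' hΞ' hor => ?_⟩
  have hcont : Continuous Ξ' := hor.elim id fun h => h.continuous hQ hV hω hα
  exact hcont.ext_on hΩ hΞ fun x hx => by rw [hΞ' ⟨x, hx⟩, hext x hx, ← hζ ⟨x, hx⟩]
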